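/- **Theorem.** For $d,n\ge 1$ let $Q_d^{(2)}(n)$ be the number of partitions of $n$ all of whose parts are $\equiv\pm2\pmod{d+3}$. Let $d\ge4$ be even and write $D=d+3$. Define $R_d(n)$ for $n\ge1$ by $$Q_d^{(2)}(n)=\frac{1}{4(3D)^{1/4}\sin\frac{2\pi}{D}}\,n^{-3/4}\exp\Big(\frac{2\pi\sqrt n}{\sqrt{3D}}\Big)+R_d(n).$$ Then $R_d(n)$ is explicitly bounded as follows. Put $$\xi=\frac{\sqrt2}{2\pi}\int_{-\infty}^{\infty}\big|\zeta(\tfrac12+it)\,\zeta(-\tfrac12+it)\,\Gamma(-\tfrac12+it)\big|\,dt,$$ and let $c_2$ be the minimum of the four numbers $$\frac{2\pi(1-\cos\frac{2\pi}{d+5})(e^{(2d+4)\pi}+e^{(d+5)\pi})}{(e^{D\pi}-1)(e^{D\pi}+1)^2},\qquad \frac{\pi(1-\cos\frac{2\pi}{d+5})(e^{(3d+7)\pi}+e^{2\pi}-e^{(2d+4)\pi}-e^{(d+5)\pi})}{(e^{D\pi}-1)(e^{D\pi}+1)^2},$$ $$\frac{2\pi D(d+1)\big(1-\cos\frac{D-\pi}{D^2}\big)}{(e^{D\pi}-1)(8\pi^2+D^2)},\qquad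 \frac{8\pi}{(e^{D\pi}-1)\big((e^{D/2}-1)^2+4e^{D/2}\big)}.$$ Let $0<\delta<\frac23$ and $0<\varepsilon_1<\frac\delta2$. For $y_{\max}>0$ put $$c_4=\frac{2\pi^4}{3D}-\log\!\Big(2\sin\frac{2\pi}{D}\Big)y_{\max}^{\delta/2}-\xi\,y_{\max}^{(1+\delta)/2},\qquad c_5=c_2+y_{\max}\log\!\Big(2\sin\frac{2\pi}{D}\Big)-\xi\,y_{\max}^{3/2},$$ $$c_3=\min\big(c_4\,y_{\max}^{\varepsilon_1-\delta/2},\;c_5\,y_{\max}^{\varepsilon_1-1}\big),$$ and put $$c_{10}=2\pi\Big(\frac{\pi^2}{3D}\Big)^{\frac12-\frac\delta4},\qquad \varphi=\frac{2^{\frac{22+3\delta}8}\pi^{\frac{22-3\delta}4}}{3D^{\frac{10-3\delta}8}}+\xi\Big(\frac{\pi^2}{2D}\Big)^{1/4},\qquad c_6=\frac{e^{\varphi}-1}{\varphi},$$ $$c_7=c_6c_{10}^3+\xi c_6\,\frac{\pi^{\frac{4-3\delta}4}}{2^{\frac{3\delta}8}\,3^{\frac{2-3\delta}4}\,D^{\frac{4-3\delta}8}}.$$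 (i) For all sufficiently small $y_{\max}>0$ one has $c_4>0$ and $c_5>0$. (ii) For every $y_{\max}>0$ with $c_4>0$ and $c_5>0$, and every $n\ge1$ with $\frac{\pi}{\sqrt{3Dn}}\le y_{\max}$, writing $m=\frac{\pi\sqrt n}{\sqrt{3D}}$, $$|R_d(n)|\le\frac{m\,e^{2m}}{4\pi n\sin\frac{2\pi}{D}}\Big(\frac{2}{\sqrt m}\,e^{-c_{10}m^{\delta/4}}+2c_{10}c_7\,m^{\delta-1}\Big)+\exp\Big(2m-c_3\,m^{\varepsilon_1}\Big(\frac{\pi^2}{3D}\Big)^{-\varepsilon_1}\Big),$$ and also $$\begin{aligned}|R_d(n)|\le{}& n^{-\frac14}\,\frac{\pi^{\frac12}(3D)^{-\frac34}}{2\sin\frac{2\pi}{D}}\exp\Big(2m-2n^{-\frac\delta8}\pi^{2-\frac\delta4}(3D)^{-2+\frac{3\delta}8}\Big)+n^{-1+\frac\delta2}\,\frac{c_7\,\pi^{1+\frac\delta2}}{(3D)^2\sin\frac{2\pi}{D}}\,e^{2m}\\&+\exp\Big(2m-c_3\,n^{\frac{\varepsilon_1}2}\Big(\frac{\pi^2}{3D}\Big)^{-\frac{3\varepsilon_1}2}\Big).\end{aligned}$$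 -/

import Mathlib

open Filter Topology

noncomputable section

namespace AlderQ

/-- `Q_d^{(a)}(n)`: the number of partitions of `n` all of whose parts are
congruent to `a` or to `-a` modulo `d + 3`. -/
def Q (d a n : ℕ) : ℕ :=
  (Nat.Partition.restricted n
    (fun i : ℕ => (i : ℤ) ≡ (a : ℤ) [ZMOD ((d : ℤ) + 3)] ∨
      (i : ℤ) ≡ -(a : ℤ) [ZMOD ((d : ℤ) + 3)])).card

/-- The main term of `Q_d^{(2)}(n)`. -/
def mainTerm (d n : ℕ) : ℝ :=
  1 / (4 * (3 * ((d : ℝ) + 3)) ^ (1 / 4 : ℝ) * Real.sin (2 * Real.pi / ((d : ℝ) + 3))) *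
    (n : ℝ) ^ (-(3 / 4) : ℝ) *
    Real.exp (2 * Real.pi * Real.sqrt n / Real.sqrt (3 * ((d : ℝ) + 3)))

/-- The saddle point `y = π / √(3 (d + 3) n)`. -/
def saddle (d n : ℕ) : ℝ :=
  Real.pi / Real.sqrt (3 * ((d : ℝ) + 3) * n)

/-- `m = n y = π √n / √(3 (d + 3))`. -/
def m (d n : ℕ) : ℝ :=
  (n : ℝ) * saddle d n

/-- The absolute constant
`ξ = (√2 / 2π) ∫ |ζ(1/2 + it) ζ(-1/2 + it) Γ(-1/2 + it)| dt`. -/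
def xi : ℝ :=
  Real.sqrt 2 / (2 * Real.pi) *
    ∫ t : ℝ, ‖riemannZeta (1 / 2 + t * Complex.I) * riemannZeta (-(1 / 2) + t * Complex.I) *
      Complex.Gamma (-(1 / 2) + t * Complex.I)‖

def b1 (d : ℕ) : ℝ :=
  2 * Real.pi * (1 - Real.cos (2 * Real.pi / ((d : ℝ) + 5))) *
      (Real.exp ((2 * (d : ℝ) + 4) * Real.pi) + Real.exp (((d : ℝ) + 5) * Real.pi)) /
    ((Real.exp (((d : ℝ) + 3) * Real.pi) - 1) * (Real.exp (((d : ℝ) + 3) * Real.pi) + 1) ^ 2)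

def b2 (d : ℕ) : ℝ :=
  Real.pi * (1 - Real.cos (2 * Real.pi / ((d : ℝ) + 5))) *
      (Real.exp ((3 * (d : ℝ) + 7) * Real.pi) + Real.exp (2 * Real.pi) -
        Real.exp ((2 * (d : ℝ) + 4) * Real.pi) - Real.exp (((d : ℝ) + 5) * Real.pi)) /
    ((Real.exp (((d : ℝ) + 3) * Real.pi) - 1) * (Real.exp (((d : ℝ) + 3) * Real.pi) + 1) ^ 2)

def b3 (d : ℕ) : ℝ :=
  Real.pi * (1 - Real.cos (((d : ℝ) + 3 - Real.pi) / ((d : ℝ) + 3) ^ 2)) *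
      (2 * ((d : ℝ) + 3) * ((d : ℝ) + 1)) /
    ((Real.exp (Real.pi * ((d : ℝ) + 3)) - 1) * (8 * Real.pi ^ 2 + ((d : ℝ) + 3) ^ 2))

def b4 (d : ℕ) : ℝ :=
  8 * Real.pi /
    ((Real.exp (((d : ℝ) + 3) * Real.pi) - 1) *
      ((Real.exp (((d : ℝ) + 3) / 2) - 1) ^ 2 + 4 * Real.exp (((d : ℝ) + 3) / 2)))

def c2 (d : ℕ) : ℝ :=
  min (min (b1 d) (b2 d)) (min (b3 d) (b4 d))

def c4 (d : ℕ) (δ ymax : ℝ) : ℝ :=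
  2 * Real.pi ^ 4 / (3 * ((d : ℝ) + 3)) -
    Real.log (2 * Real.sin (2 * Real.pi / ((d : ℝ) + 3))) * ymax ^ (δ / 2) -
    xi * ymax ^ ((1 + δ) / 2)

def c5 (d : ℕ) (ymax : ℝ) : ℝ :=
  c2 d + ymax * Real.log (2 * Real.sin (2 * Real.pi / ((d : ℝ) + 3))) -
    xi * ymax ^ (3 / 2 : ℝ)

def c3 (d : ℕ) (δ ε ymax : ℝ) : ℝ :=
  min (c4 d δ ymax * ymax ^ (ε - δ / 2)) (c5 d ymax * ymax ^ (ε - 1))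

/-- `c₁₀ = 2π (π² / (3 (d + 3)))^(β - 1)` with `β = 3/2 - δ/4`. -/
def c10 (d : ℕ) (δ : ℝ) : ℝ :=
  2 * Real.pi * (Real.pi ^ 2 / (3 * ((d : ℝ) + 3))) ^ ((3 / 2 - δ / 4) - 1)

def phiMax (d : ℕ) (δ : ℝ) : ℝ :=
  (2 : ℝ) ^ ((22 + 3 * δ) / 8) * Real.pi ^ ((22 - 3 * δ) / 4) /
      (3 * ((d : ℝ) + 3) ^ ((10 - 3 * δ) / 8)) +
    xi * (Real.pi ^ 2 / (2 * ((d : ℝ) + 3))) ^ (1 / 4 : ℝ)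

def c6 (d : ℕ) (δ : ℝ) : ℝ :=
  (Real.exp (phiMax d δ) - 1) / phiMax d δ

def c7 (d : ℕ) (δ : ℝ) : ℝ :=
  c6 d δ * c10 d δ ^ 3 +
    xi * c6 d δ *
      (Real.pi ^ ((4 - 3 * δ) / 4) /
        ((2 : ℝ) ^ (3 * δ / 8) * (3 : ℝ) ^ ((2 - 3 * δ) / 4) *
          ((d : ℝ) + 3) ^ ((4 - 3 * δ) / 8)))

/-- The bound for the error term in terms of `m`: the three summands bound the tail of the
Gaussian integral, the error in the saddle point approximation, and the minor arc. -/
def errorBound (d : ℕ) (δ ε ymax : ℝ) (n : ℕ) : ℝ :=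
  m d n * Real.exp (2 * m d n) / (4 * Real.pi * n * Real.sin (2 * Real.pi / ((d : ℝ) + 3))) *
      (2 / Real.sqrt (m d n) * Real.exp (-(c10 d δ * m d n ^ (δ / 4))) +
        2 * c10 d δ * c7 d δ * m d n ^ (δ - 1)) +
    Real.exp (2 * m d n -
      c3 d δ ε ymax * m d n ^ ε * (Real.pi ^ 2 / (3 * ((d : ℝ) + 3))) ^ (-ε))

/-- A second bound for the error term, written in terms of `n`. -/
def errorBound' (d : ℕ) (δ ε ymax : ℝ) (n : ℕ) : ℝ :=
  (n : ℝ) ^ (-(1 / 4) : ℝ) *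
      (Real.pi ^ (1 / 2 : ℝ) * (3 * ((d : ℝ) + 3)) ^ (-(3 / 4) : ℝ) /
        (2 * Real.sin (2 * Real.pi / ((d : ℝ) + 3)))) *
      Real.exp (2 * Real.pi * Real.sqrt n / Real.sqrt (3 * ((d : ℝ) + 3)) -
        (n : ℝ) ^ (-(δ / 8)) * 2 * Real.pi ^ (2 - δ / 4) *
          (3 * ((d : ℝ) + 3)) ^ (-2 + 3 * δ / 8)) +
    (n : ℝ) ^ (-1 + δ / 2) *
      (c7 d δ * Real.pi ^ (1 + δ / 2) /
        ((3 * ((d : ℝ) + 3)) ^ 2 * Real.sin (2 * Real.pi / ((d : ℝ) + 3)))) *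
      Real.exp (2 * Real.pi * Real.sqrt n / Real.sqrt (3 * ((d : ℝ) + 3))) +
    Real.exp (2 * Real.pi * Real.sqrt n / Real.sqrt (3 * ((d : ℝ) + 3)) -
      c3 d δ ε ymax * (n : ℝ) ^ (ε / 2) *
        (Real.pi ^ 2 / (3 * ((d : ℝ) + 3))) ^ (-(3 * ε / 2)))

end AlderQ

end

/-!
Write `D = d + 3`, `A = π² / (3 D)` (`poleCoeff`), and let `y` be the saddle point, so that
`m = n y = A / y`. The error term is by definition the difference `Q d 2 n - mainTerm d n`.

**Transformation formula.** The generating function of `Q d 2` is the product of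
`1 / ((1 - x q^j) (1 - x⁻¹ q^(j + 1)))` with `q = exp (-D τ)`, `x = exp (-2 τ)` (`tendsto_genQ`). By
the Jacobi triple product (`tendsto_triple_product`) it is a quotient of two theta series, the
numerator being the pentagonal number series in `q` (`genQ_mul_thetaSum`). Poisson summation of both
series (`thetaSum_eq`) shows that it equals `exp (A / τ + κ τ) / (2 sin (2π / D))` up to factors
that are exponentially close to `1` (`genQ_transformation`). No Mellin transform is needed, and of
the constant `xi` only its nonnegativity is used.

**Circle method.** In the coefficient integral on `Re τ = y` the part `|Im τ| ≤ y` is compared with a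
Gaussian integral (`abs_major_sub_le`). The integral is real, so only the real part of the integrand
matters; this removes the cubic term of the phase, and the relative error is `O(1 / m)`
(`abs_saddle_sub_gaussian_le`). Outside this range the generating function is smaller by a factor
`exp (-1 / (D⁴ y))` (`norm_genQ_minor_le`): either `Im τ` is at distance at least `y` from the multiples
of `2π / D`, and then the geometric series over the parts `D j + 2` is smaller in modulus than on the
real axis, or it is close to a nonzero multiple `2π h / D`, and then the arguments of the first terms of
that series stay away from `0` because `D` is odd. Hence the error is at most `500 / m` times the main term
when `y` is small in terms of `D` (`abs_Q_sub_le`), in particular when `y` is below `exp (-22)` and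
`exp (-2 D)` (`abs_Q_sub_mainTerm_le`). The second summand of `errorBound` has relative size at least of
the order of `m ^ (δ - 1 / 2)`, and the first summand of `errorBound'` exceeds the main term, so both
dominate this error (`mainTerm_mul_le_errorBound`, `mainTerm_le_errorBound'`).

**Range of the saddle point.** For `D ≥ 13` one has `2 sin (2π / D) < 1`, so `0 < c5` forces `ymax`
below the exponentially small `exp (-3 D)` (`le_exp_of_c5_pos`), and the previous estimate applies to
every `n` with `saddle d n ≤ ymax`. For `D ≤ 11` there may remain `n` with `y ≥ exp (-22)`. For these
`Q d 2 n` and the main term are both at most `5 exp (2 m)` (`Q_le_of_small`, `mainTerm_le_of_small`), while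
`phiMax` is at least `60`, so that the constant `c7` is at least `exp 55` and the error bounds exceed
`5 exp (2 m)` (`bounds_of_small`).
-/

/-! ### The Jacobi triple product -/

namespace AlderQ

/-- The finite `q`-Pochhammer symbol `(q; q)_n`. -/
noncomputable def qPoch (q : ℂ) (n : ℕ) : ℂ := ∏ j ∈ Finset.range n, (1 - q ^ (j + 1))

/-- `1 / (q; q)_j` for an integer `j`, with the value `0` for `j < 0`; with this convention the
Pascal recursion for Gaussian binomials has no boundary cases. -/
noncomputable def qPochInv (q : ℂ) (j : ℤ) : ℂ := if j < 0 then 0 else (qPoch q j.toNat)⁻¹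

lemma one_sub_pow_ne_zero {q : ℂ} (hq : ‖q‖ < 1) (n : ℕ) : 1 - q ^ (n + 1) ≠ 0 := by
  intro h
  have h1 : ‖q ^ (n + 1)‖ = 1 := by
    rw [← sub_eq_zero.mp h]; simp
  rw [norm_pow] at h1
  exact absurd h1 (pow_lt_one₀ (norm_nonneg _) hq (by omega)).ne

lemma qPoch_ne_zero {q : ℂ} (hq : ‖q‖ < 1) (n : ℕ) : qPoch q n ≠ 0 :=
  Finset.prod_ne_zero_iff.mpr fun _ _ => one_sub_pow_ne_zero hq _

lemma qPoch_succ (q : ℂ) (n : ℕ) : qPoch q (n + 1) = qPoch q n * (1 - q ^ (n + 1)) :=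
  Finset.prod_range_succ _ _

lemma qPochInv_sub_one {q : ℂ} (hq : ‖q‖ < 1) (j : ℤ) :
    qPochInv q (j - 1) = (1 - q ^ j) * qPochInv q j := by
  rcases lt_trichotomy j 0 with h | h | h
  · simp [qPochInv, h, show j - 1 < 0 by omega]
  · simp [qPochInv, h]
  · obtain ⟨n, rfl⟩ : ∃ n : ℕ, j = n + 1 := ⟨(j - 1).toNat, by omega⟩
    have h1 : ¬ ((n : ℤ) + 1 < 0) := by omega
    have h2 : ((n : ℤ) + 1).toNat = n + 1 := by omega
    have h3 : q ^ ((n : ℤ) + 1) = q ^ (n + 1) := by exact_mod_cast zpow_natCast q (n + 1)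
    simp only [qPochInv, add_sub_cancel_right, h1, if_false, h2, Int.toNat_natCast, qPoch_succ, h3]
    have := one_sub_pow_ne_zero hq n
    have := qPoch_ne_zero hq n
    simp only [show ¬ ((n : ℤ) < 0) by omega, if_false]
    field_simp

/-- The general term `(-1)^k q^{k(k-1)/2} x^k` of the theta series is characterised by its ratio
`-x q^k`; it is kept abstract as a function `a` with that ratio. The identity is the finite form of
the triple product. -/
lemma hasSum_finite_triple_product {q x : ℂ} (hq : ‖q‖ < 1) (hq0 : q ≠ 0) (hx : x ≠ 0)
    {a : ℤ → ℂ} (ha0 : a 0 = 1) (ha : ∀ k, a (k + 1) = -x * q ^ k * a k) (n : ℕ) :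
    HasSum (fun k : ℤ => a k * (qPoch q (2 * n) * qPochInv q (n - k) * qPochInv q (n + k)))
      (∏ j ∈ Finset.range n, (1 - x * q ^ j) * (1 - x⁻¹ * q ^ (j + 1))) := by
  induction n with
  | zero =>
    have : ∀ k : ℤ, k ≠ 0 →
        a k * (qPoch q (2 * 0) * qPochInv q ((0 : ℕ) - k) * qPochInv q ((0 : ℕ) + k)) = 0 := by
      intro k hk
      rcases lt_or_gt_of_ne hk with h | h
      · simp [qPochInv, h]
      · simp [qPochInv, h]
    simpa [ha0, qPoch, qPochInv] using hasSum_single (0 : ℤ) this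
  | succ n ih =>
    rw [Finset.prod_range_succ]
    have h1 := ih.mul_left (1 + q ^ (2 * n + 1))
    have h2 := ((Equiv.subRight (1 : ℤ)).hasSum_iff.mpr ih).mul_left (-(x * q ^ n))
    have h3 := ((Equiv.addRight (1 : ℤ)).hasSum_iff.mpr ih).mul_left (-(x⁻¹ * q ^ (n + 1)))
    convert! (h1.add h2).add h3 using 1
    · funext k
      simp only [Function.comp_apply, Equiv.subRight_apply, Equiv.coe_addRight]
      have e1 : a k = -x * q ^ (k - 1) * a (k - 1) := by
        have := ha (k - 1); rwa [sub_add_cancel] at this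
      have hqk : q ^ k ≠ 0 := zpow_ne_zero _ hq0
      have e1' : -(x * q ^ n) * a (k - 1) = q * q ^ n * (q ^ k)⁻¹ * a k := by
        rw [e1, zpow_sub_one₀ hq0]; field_simp
      have e2 : -(x⁻¹ * q ^ (n + 1)) * a (k + 1) = q ^ (n + 1) * q ^ k * a k := by
        rw [ha k]; field_simp
      set A := qPochInv q ((n : ℤ) + 1 - k) with hA
      set B := qPochInv q ((n : ℤ) + 1 + k) with hB
      have i1 : qPochInv q ((n : ℤ) - k) = (1 - q ^ ((n : ℤ) + 1 - k)) * A := by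
        rw [hA, ← qPochInv_sub_one hq]; congr 1; ring
      have i2 : qPochInv q ((n : ℤ) + k) = (1 - q ^ ((n : ℤ) + 1 + k)) * B := by
        rw [hB, ← qPochInv_sub_one hq]; congr 1; ring
      have i3 : qPochInv q ((n : ℤ) - (k - 1)) = A := by rw [hA]; congr 1; ring
      have i4 : qPochInv q ((n : ℤ) + (k - 1)) =
          (1 - q ^ ((n : ℤ) + k)) * ((1 - q ^ ((n : ℤ) + 1 + k)) * B) := by
        rw [← i2, ← qPochInv_sub_one hq]; congr 1; ring
      have i5 : qPochInv q ((n : ℤ) - (k + 1)) =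
          (1 - q ^ ((n : ℤ) - k)) * ((1 - q ^ ((n : ℤ) + 1 - k)) * A) := by
        rw [← i1, ← qPochInv_sub_one hq]; congr 1; ring
      have i6 : qPochInv q ((n : ℤ) + (k + 1)) = B := by rw [hB]; congr 1; ring
      have i7 : qPoch q (2 * (n + 1)) =
          qPoch q (2 * n) * (1 - q ^ (2 * n + 1)) * (1 - q ^ (2 * n + 2)) := by
        rw [show 2 * (n + 1) = 2 * n + 1 + 1 by ring, qPoch_succ, qPoch_succ]
      have z1 : q ^ ((n : ℤ) + 1 - k) = q ^ n * q * (q ^ k)⁻¹ := by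
        rw [zpow_sub₀ hq0, zpow_add_one₀ hq0, zpow_natCast]; rfl
      have z2 : q ^ ((n : ℤ) + 1 + k) = q ^ n * q * q ^ k := by
        rw [zpow_add₀ hq0, zpow_add_one₀ hq0, zpow_natCast]
      have z3 : q ^ ((n : ℤ) + k) = q ^ n * q ^ k := by
        rw [zpow_add₀ hq0, zpow_natCast]
      have z4 : q ^ ((n : ℤ) - k) = q ^ n * (q ^ k)⁻¹ := by
        rw [zpow_sub₀ hq0, zpow_natCast]; rfl
      push_cast
      rw [← hA, ← hB, ← mul_assoc (-(x * q ^ n)), e1', ← mul_assoc (-(x⁻¹ * q ^ (n + 1))), e2,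
        i1, i2, i3, i4, i5, i6, i7, z1, z2, z3, z4]
      generalize q ^ k = u at *
      rw [show q ^ (2 * n + 1) = q ^ n * q ^ n * q by ring,
        show q ^ (2 * n + 2) = q ^ n * q ^ n * q * q by ring, pow_succ q n]
      generalize q ^ n = v at *
      field_simp
      ring
    · field_simp
      ring

lemma tendsto_qPoch {q : ℂ} (hq : ‖q‖ < 1) :
    Tendsto (qPoch q) atTop (𝓝 (∏' j : ℕ, (1 - q ^ (j + 1)))) :=
  (ModularForm.multipliable_one_sub_pow hq).hasProd.tendsto_prod_nat

lemma tprod_one_sub_pow_ne_zero {q : ℂ} (hq : ‖q‖ < 1) : ∏' j : ℕ, (1 - q ^ (j + 1)) ≠ 0 := by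
  have h := tprod_one_add_ne_zero_of_summable (f := fun n : ℕ ↦ -q ^ (n + 1))
    (fun i => by simpa [sub_eq_add_neg] using one_sub_pow_ne_zero hq i)
    (by simpa using (summable_nat_add_iff 1).mpr (summable_geometric_of_lt_one (norm_nonneg _) hq))
  simpa [sub_eq_add_neg] using h

/-- **Jacobi triple product**, for a bilateral sequence `a` of general term
`(-1)^k q^{k(k-1)/2} x^k`. -/
theorem tendsto_triple_product {q x : ℂ} (hq : ‖q‖ < 1) (hq0 : q ≠ 0) (hx : x ≠ 0)
    {a : ℤ → ℂ} (ha0 : a 0 = 1) (ha : ∀ k, a (k + 1) = -x * q ^ k * a k) (hs : Summable a) :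
    Tendsto (fun n => ∏ j ∈ Finset.range n,
      (1 - q ^ (j + 1)) * ((1 - x * q ^ j) * (1 - x⁻¹ * q ^ (j + 1)))) atTop
      (𝓝 (∑' k, a k)) := by
  set P := ∏' j : ℕ, (1 - q ^ (j + 1)) with hP
  have hP0 : P ≠ 0 := tprod_one_sub_pow_ne_zero hq
  have hT := tendsto_qPoch hq
  have hTi : Tendsto (fun n => (qPoch q n)⁻¹) atTop (𝓝 P⁻¹) := hT.inv₀ hP0
  obtain ⟨C₁, hC₁⟩ := hT.norm.bddAbove_range
  obtain ⟨C₂, hC₂⟩ := hTi.norm.bddAbove_range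
  have b1 : ∀ n, ‖qPoch q n‖ ≤ C₁ := fun n => hC₁ ⟨n, rfl⟩
  have b2 : ∀ n, ‖(qPoch q n)⁻¹‖ ≤ C₂ := fun n => hC₂ ⟨n, rfl⟩
  have hC₂0 : 0 ≤ C₂ := (norm_nonneg _).trans (b2 0)
  have hC₁0 : 0 ≤ C₁ := (norm_nonneg _).trans (b1 0)
  have b3 : ∀ j, ‖qPochInv q j‖ ≤ C₂ := by
    intro j
    unfold qPochInv
    split_ifs
    · simpa using hC₂0
    · exact b2 _
  have key : ∀ n, ∏ j ∈ Finset.range n,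
      (1 - q ^ (j + 1)) * ((1 - x * q ^ j) * (1 - x⁻¹ * q ^ (j + 1))) =
      ∑' k : ℤ, qPoch q n *
        (a k * (qPoch q (2 * n) * qPochInv q (n - k) * qPochInv q (n + k))) := by
    intro n
    rw [Finset.prod_mul_distrib]
    exact ((hasSum_finite_triple_product hq hq0 hx ha0 ha n).mul_left _).tsum_eq.symm
  simp_rw [key]
  refine tendsto_tsum_of_dominated_convergence
    (bound := fun k => C₁ * (‖a k‖ * (C₁ * C₂ * C₂))) ?_ ?_ ?_
  · exact (hs.norm.mul_right _).mul_left _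
  · intro k
    have hinv : ∀ f : ℕ → ℤ, Tendsto f atTop atTop →
        Tendsto (fun n => qPochInv q (f n)) atTop (𝓝 P⁻¹) := by
      intro f hf
      have hn : Tendsto (fun n => (f n).toNat) atTop atTop := by
        refine tendsto_atTop.mpr fun b => ?_
        filter_upwards [hf.eventually_ge_atTop (b : ℤ)] with n hn
        omega
      refine (hTi.comp hn).congr' ?_
      filter_upwards [hf.eventually_ge_atTop 0] with n hn
      simp [qPochInv, not_lt.mpr hn]
    have l1 : Tendsto (fun n : ℕ => (n : ℤ) - k) atTop atTop :=
      tendsto_atTop_add_const_right _ (-k) tendsto_natCast_atTop_atTop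
    have l2 : Tendsto (fun n : ℕ => (n : ℤ) + k) atTop atTop :=
      tendsto_atTop_add_const_right _ k tendsto_natCast_atTop_atTop
    have l3 : Tendsto (fun n : ℕ => 2 * n) atTop atTop :=
      tendsto_id.const_mul_atTop' (by norm_num)
    have := hT.mul ((((hT.comp l3).mul (hinv _ l1)).mul (hinv _ l2)).const_mul (a k))
    convert! this using 2
    rw [← hP]
    field_simp
  · refine Eventually.of_forall fun n k => ?_
    rw [norm_mul, norm_mul, norm_mul, norm_mul]
    gcongr
    · exact b1 n
    · exact b1 _
    · exact b3 _
    · exact b3 _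

/-! ### Theta series and their behaviour at the origin -/

/-- The exponent of the general term of `thetaSum`: the exponential of
`thetaExp D a τ k` is `(-1)^k exp (-τ (D k (k - 1) / 2 + a k))`. -/
noncomputable def thetaExp (D a : ℝ) (τ : ℂ) (k : ℤ) : ℂ :=
  -Real.pi * (D * τ / (2 * Real.pi)) * k ^ 2 +
    2 * Real.pi * ((-Complex.I * Real.pi + (D / 2 - a) * τ) / (2 * Real.pi)) * k

/-- The theta series `∑ (-1)^k exp (-τ (D k (k - 1) / 2 + a k))` over the integers, the sum side of
the triple product in `q = exp (-D τ)`, `x = exp (-a τ)`. -/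
noncomputable def thetaSum (D a : ℝ) (τ : ℂ) : ℂ := ∑' k : ℤ, Complex.exp (thetaExp D a τ k)

lemma re_theta_width_pos {D : ℝ} (hD : 0 < D) {τ : ℂ} (hτ : 0 < τ.re) :
    0 < (D * τ / (2 * Real.pi)).re := by
  have : (D * τ / (2 * Real.pi) : ℂ) = ((D / (2 * Real.pi) : ℝ) : ℂ) * τ := by
    push_cast; ring
  rw [this, Complex.re_ofReal_mul]
  have := Real.pi_pos
  positivity

lemma summable_thetaExp {D : ℝ} (hD : 0 < D) (a : ℝ) {τ : ℂ} (hτ : 0 < τ.re) :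
    Summable fun k => Complex.exp (thetaExp D a τ k) := by
  have h := (summable_jacobiTheta₂_term_iff
    (-Complex.I * ((-Complex.I * Real.pi + (D / 2 - a) * τ) / (2 * Real.pi)))
    (Complex.I * (D * τ / (2 * Real.pi)))).mpr (by
      rw [Complex.I_mul_im]; exact re_theta_width_pos hD hτ)
  refine h.congr fun k => ?_
  rw [jacobiTheta₂_term, thetaExp]
  congr 1
  linear_combination (2 * Real.pi * ((-Complex.I * Real.pi + (D / 2 - a) * τ) / (2 * Real.pi)) * k
    - Real.pi * (D * τ / (2 * Real.pi)) * k ^ 2) * (- Complex.I_sq)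

lemma exp_neg_lt_one {D : ℝ} (hD : 0 < D) {τ : ℂ} (hτ : 0 < τ.re) :
    ‖Complex.exp (-D * τ)‖ < 1 := by
  rw [Complex.norm_exp]
  have : (-D * τ).re = -(D * τ.re) := by
    rw [neg_mul, Complex.neg_re, Complex.re_ofReal_mul]
  rw [this]
  exact Real.exp_lt_one_iff.mpr (by have := mul_pos hD hτ; linarith)

/-- The triple product in exponential coordinates. -/
theorem tendsto_thetaSum {D : ℝ} (hD : 0 < D) (a : ℝ) {τ : ℂ} (hτ : 0 < τ.re) :
    Tendsto (fun n => ∏ j ∈ Finset.range n,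
      (1 - Complex.exp (-D * τ) ^ (j + 1)) *
        ((1 - Complex.exp (-a * τ) * Complex.exp (-D * τ) ^ j) *
          (1 - (Complex.exp (-a * τ))⁻¹ * Complex.exp (-D * τ) ^ (j + 1)))) atTop
      (𝓝 (thetaSum D a τ)) := by
  refine tendsto_triple_product (exp_neg_lt_one hD hτ) (Complex.exp_ne_zero _)
    (Complex.exp_ne_zero _) ?_ ?_ (summable_thetaExp hD a hτ)
  · simp [thetaExp]
  · intro k
    have hpi : (Real.pi : ℂ) ≠ 0 := by exact_mod_cast Real.pi_ne_zero
    have e : thetaExp D a τ (k + 1) =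
        -(Real.pi * Complex.I) + -a * τ + k * (-D * τ) + thetaExp D a τ k := by
      simp only [thetaExp]
      push_cast
      field_simp
      ring
    rw [e, Complex.exp_add, Complex.exp_add, Complex.exp_add, Complex.exp_neg, Complex.exp_pi_mul_I,
      Complex.exp_int_mul]
    norm_num

/-- The theta series near `τ = 0`, by Poisson summation: only the two terms `n = 0, -1` of the dual
series matter, and together they give the sine. -/
theorem thetaSum_eq {D : ℝ} (hD : 0 < D) (a : ℝ) {τ : ℂ} (hτ : 0 < τ.re) :
    ∃ E : ℂ,
      ‖E‖ ≤ 2 * Real.exp (-(4 * Real.pi ^ 2 / D * (τ⁻¹).re)) /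
        (1 - Real.exp (-(4 * Real.pi ^ 2 / D * (τ⁻¹).re))) ∧
      thetaSum D a τ = 1 / (D * τ / (2 * Real.pi)) ^ (1 / 2 : ℂ) *
        (Complex.exp ((D / 2 - a) ^ 2 / (2 * D) * τ - Real.pi ^ 2 / (2 * D * τ)) *
          (2 * Real.sin (Real.pi * a / D) + E)) := by
  have hα := re_theta_width_pos hD hτ
  have hpi : (Real.pi : ℂ) ≠ 0 := by exact_mod_cast Real.pi_ne_zero
  have hD' : (D : ℂ) ≠ 0 := by exact_mod_cast hD.ne'
  have hτ0 : τ ≠ 0 := by rintro rfl; simp at hτ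
  have hinv : 0 < (τ⁻¹).re := by
    rw [Complex.inv_re]; exact div_pos hτ (Complex.normSq_pos.mpr hτ0)
  set r := Real.exp (-(4 * Real.pi ^ 2 / D * (τ⁻¹).re)) with hr
  have hr0 : 0 < r := Real.exp_pos _
  have hr1 : r < 1 := by
    have := Real.pi_pos
    exact Real.exp_lt_one_iff.mpr (neg_lt_zero.mpr (by positivity))
  set φ : ℝ := Real.pi * (1 / 2 - a / D) with hφ
  set c : ℂ := 2 * Real.pi ^ 2 / (D * τ) with hc
  set G := Complex.exp ((D / 2 - a) ^ 2 / (2 * D) * τ - Real.pi ^ 2 / (2 * D * τ)) with hG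
  have hα0 : (D * τ / (2 * Real.pi) : ℂ) ≠ 0 := by
    intro h; rw [h] at hα; simp at hα
  -- the terms of the dual series
  set f : ℤ → ℂ := fun n => Complex.exp (-Real.pi / (D * τ / (2 * Real.pi)) *
    (n + Complex.I * ((-Complex.I * Real.pi + (D / 2 - a) * τ) / (2 * Real.pi))) ^ 2) with hf
  have hfe : ∀ n : ℤ, f n = G * (Complex.exp (-c * (n * (n + 1))) *
      Complex.exp (-(φ * (2 * n + 1) * Complex.I))) := by
    intro n
    simp only [hf, hG, hc, hφ]
    rw [← Complex.exp_add, ← Complex.exp_add]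
    congr 1
    have hI : Complex.I * ((-Complex.I * Real.pi + (D / 2 - a) * τ) / (2 * Real.pi)) =
        1 / 2 + Complex.I * ((D / 2 - a) * τ / (2 * Real.pi)) := by
      field_simp
      linear_combination (-2 * Real.pi : ℂ) * Complex.I_sq
    rw [hI]
    push_cast
    field_simp
    ring_nf
    rw [Complex.I_sq]
    ring
  have hpair : ∀ n : ℕ, f n + f (-(n + 1)) = G * (Complex.exp (-c * (n * (n + 1))) *
      (2 * Complex.cos (φ * (2 * n + 1)))) := by
    intro n
    rw [hfe, hfe, Complex.two_cos]
    push_cast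
    rw [show (-c * ((-((n : ℂ) + 1)) * (-((n : ℂ) + 1) + 1))) = -c * (n * (n + 1)) by ring,
      show -((φ : ℂ) * (2 * (-((n : ℂ) + 1)) + 1) * Complex.I) =
        φ * (2 * n + 1) * Complex.I by ring,
      show -((φ : ℂ) * (2 * (n : ℂ) + 1)) * Complex.I = -(φ * (2 * n + 1) * Complex.I) by ring]
    ring
  set g : ℕ → ℂ := fun n => Complex.exp (-c * (n * (n + 1))) *
      (2 * Complex.cos (φ * (2 * n + 1))) with hg
  have hcre : c.re = 2 * Real.pi ^ 2 / D * (τ⁻¹).re := by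
    have : c = ((2 * Real.pi ^ 2 / D : ℝ) : ℂ) * τ⁻¹ := by
      rw [hc]; push_cast; field_simp
    rw [this, Complex.re_ofReal_mul]
  have hgb : ∀ n : ℕ, ‖g (n + 1)‖ ≤ 2 * r * r ^ n := by
    intro n
    have h1 : ‖Complex.exp (-c * (((n + 1 : ℕ) : ℂ) * (((n + 1 : ℕ) : ℂ) + 1)))‖ ≤ r * r ^ n := by
      have e : (-c * (((n + 1 : ℕ) : ℂ) * (((n + 1 : ℕ) : ℂ) + 1))).re =
          -(4 * Real.pi ^ 2 / D * (τ⁻¹).re) * (((n : ℝ) + 1) * ((n : ℝ) + 2) / 2) := by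
        have : (-c * (((n + 1 : ℕ) : ℂ) * (((n + 1 : ℕ) : ℂ) + 1))) =
            ((-(((n : ℝ) + 1) * ((n : ℝ) + 2)) : ℝ) : ℂ) * c := by push_cast; ring
        rw [this, Complex.re_ofReal_mul, hcre]; ring
      rw [Complex.norm_exp, e, ← pow_succ', hr, ← Real.exp_nat_mul]
      apply Real.exp_le_exp.mpr
      push_cast
      have : 0 ≤ 4 * Real.pi ^ 2 / D * (τ⁻¹).re := by positivity
      have hn : ((n : ℝ) + 1) ≤ ((n : ℝ) + 1) * ((n : ℝ) + 2) / 2 := by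
        have : (0 : ℝ) ≤ n := n.cast_nonneg
        nlinarith
      nlinarith
    have h2 : ‖(2 * Complex.cos (φ * (2 * ((n + 1 : ℕ) : ℂ) + 1)))‖ ≤ 2 := by
      have : (φ * (2 * ((n + 1 : ℕ) : ℂ) + 1)) = ((φ * (2 * ((n + 1 : ℕ) : ℝ) + 1) : ℝ) : ℂ) := by
        push_cast; ring
      rw [this, ← Complex.ofReal_cos, norm_mul, Complex.norm_real, Real.norm_eq_abs]
      have := Real.abs_cos_le_one (φ * (2 * ((n + 1 : ℕ) : ℝ) + 1))
      norm_num
      exact_mod_cast this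
    calc ‖g (n + 1)‖ ≤ (r * r ^ n) * 2 := by
          simp only [hg, norm_mul]
          rw [norm_mul] at h2
          gcongr
      _ = _ := by ring
  have hgs' : Summable fun n => g (n + 1) :=
    Summable.of_norm_bounded ((summable_geometric_of_lt_one hr0.le hr1).mul_left _) hgb
  have hgs : Summable g := (summable_nat_add_iff 1).mp hgs'
  have hdual := Complex.tsum_exp_neg_quadratic hα
    ((-Complex.I * Real.pi + (D / 2 - a) * τ) / (2 * Real.pi))
  have hα2 : 0 < ((D * τ / (2 * Real.pi) : ℂ)⁻¹).re := by
    rw [Complex.inv_re]; exact div_pos hα (Complex.normSq_pos.mpr hα0)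
  have hfs : Summable f := by
    have h := (summable_jacobiTheta₂_term_iff
      (Complex.I * (D * τ / (2 * Real.pi))⁻¹ *
        (Complex.I * ((-Complex.I * Real.pi + (D / 2 - a) * τ) / (2 * Real.pi))))
      (Complex.I * (D * τ / (2 * Real.pi))⁻¹)).mpr (by rwa [mul_comm, Complex.mul_I_im])
    refine (h.mul_left (f 0)).congr fun n => ?_
    rw [jacobiTheta₂_term]
    simp only [hf]
    rw [← Complex.exp_add]
    congr 1
    generalize Complex.I * ((-Complex.I * Real.pi + (D / 2 - a) * τ) / (2 * Real.pi)) = b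
    generalize (D * τ / (2 * Real.pi) : ℂ) = w
    rw [div_eq_mul_inv]
    push_cast
    linear_combination (2 * Real.pi * n * w⁻¹ * b + Real.pi * n ^ 2 * w⁻¹) * Complex.I_sq
  have hsplit : ∑' n : ℤ, f n = G * ∑' n : ℕ, g n := by
    have hp : Summable fun n : ℕ => f n := hfs.comp_injective Nat.cast_injective
    have hm : Summable fun n : ℕ => f (-(n + 1)) := by
      refine hfs.comp_injective (i := fun n : ℕ => (-((n : ℤ) + 1))) fun x y h => ?_
      simp only at h; omega
    rw [tsum_of_nat_of_neg_add_one hp hm, ← hp.tsum_add hm, ← tsum_mul_left]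
    exact tsum_congr hpair
  refine ⟨∑' n, g (n + 1), ?_, ?_⟩
  · have := tsum_of_norm_bounded ((hasSum_geometric_of_lt_one hr0.le hr1).mul_left (2 * r)) hgb
    rwa [← div_eq_mul_inv] at this
  · have hg0 : g 0 = 2 * Real.sin (Real.pi * a / D) := by
      simp only [hg]
      have : (φ : ℂ) * (2 * ((0 : ℕ) : ℂ) + 1) = ((Real.pi / 2 - Real.pi * a / D : ℝ) : ℂ) := by
        rw [hφ]; push_cast; ring
      rw [this, ← Complex.ofReal_cos, Real.cos_pi_div_two_sub]
      simp
    rw [← hg0, ← hgs.tsum_eq_zero_add, ← hsplit]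
    exact hdual

/-! ### The generating function of restricted partitions -/

open PowerSeries PowerSeries.WithPiTopology in
/-- The partial product of the generating series of partitions with parts satisfying `p`, with
natural coefficients. -/
noncomputable def partialGen (p : ℕ → Prop) [DecidablePred p] (N : ℕ) : ℕ⟦X⟧ :=
  ∏ i ∈ Finset.range N, if p (i + 1) then ∑' j : ℕ, (X : ℕ⟦X⟧) ^ ((i + 1) * j) else 1

open PowerSeries PowerSeries.WithPiTopology in
lemma hasSum_geometric_X (k : ℕ) :
    HasSum (fun j : ℕ => (X : ℕ⟦X⟧) ^ ((k + 1) * j)) (∑' j : ℕ, (X : ℕ⟦X⟧) ^ ((k + 1) * j)) := by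
  simp_rw [pow_mul]
  exact (summable_pow_of_constantCoeff_eq_zero (by simp)).hasSum

open PowerSeries PowerSeries.WithPiTopology in
lemma hasSum_coeff_geometric_X (k n : ℕ) :
    HasSum (fun j : ℕ => if n = (k + 1) * j then 1 else 0)
      (coeff n (∑' j : ℕ, (X : ℕ⟦X⟧) ^ ((k + 1) * j))) := by
  have := (hasSum_geometric_X k).map (coeff n) (continuous_coeff ℕ n)
  refine this.congr_fun ?_ |> fun h => h
  intro j
  simp [coeff_X_pow]

open PowerSeries PowerSeries.WithPiTopology in
lemma coeff_geometric_X_mul (k j : ℕ) :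
    coeff ((k + 1) * j) (∑' j : ℕ, (X : ℕ⟦X⟧) ^ ((k + 1) * j)) = 1 := by
  refine (hasSum_coeff_geometric_X k _).unique ?_
  convert hasSum_single j (f := fun i : ℕ => if (k + 1) * j = (k + 1) * i then 1 else 0) ?_
  · simp
  · intro i hi
    simp only [ite_eq_right_iff]
    intro h
    exact absurd (Nat.eq_of_mul_eq_mul_left (Nat.succ_pos k) h).symm hi

open PowerSeries PowerSeries.WithPiTopology in
lemma coeff_geometric_X_of_notMem (k n : ℕ) (h : n ∉ Set.range fun j => (k + 1) * j) :
    coeff n (∑' j : ℕ, (X : ℕ⟦X⟧) ^ ((k + 1) * j)) = 0 := by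
  refine (hasSum_coeff_geometric_X k n).unique ?_
  convert! hasSum_zero using 2 with j
  simp only [ite_eq_right_iff]
  intro hj
  exact absurd ⟨j, hj.symm⟩ h

open PowerSeries PowerSeries.WithPiTopology in
lemma hasSum_geometric_X_eval (k : ℕ) {z : ℂ} (hz : ‖z‖ < 1) :
    Summable (fun n => ‖((coeff n (∑' j : ℕ, (X : ℕ⟦X⟧) ^ ((k + 1) * j)) : ℕ) : ℂ) * z ^ n‖) ∧
    HasSum (fun n => ((coeff n (∑' j : ℕ, (X : ℕ⟦X⟧) ^ ((k + 1) * j)) : ℕ) : ℂ) * z ^ n)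
      (1 - z ^ (k + 1))⁻¹ := by
  have hinj : Function.Injective fun j : ℕ => (k + 1) * j :=
    fun a b h => Nat.eq_of_mul_eq_mul_left (Nat.succ_pos k) h
  have hzk : ‖z ^ (k + 1)‖ < 1 := by
    rw [norm_pow]; exact pow_lt_one₀ (norm_nonneg _) hz (by omega)
  constructor
  · rw [← hinj.summable_iff]
    · refine (summable_geometric_of_lt_one (norm_nonneg _) hzk).congr fun j => ?_
      simp only [Function.comp_apply, coeff_geometric_X_mul]
      rw [pow_mul]; simp
    · intro n hn
      rw [coeff_geometric_X_of_notMem k n hn]; simp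
  · rw [← hinj.hasSum_iff]
    · refine (hasSum_geometric_of_norm_lt_one hzk).congr_fun fun j => ?_
      simp only [Function.comp_apply, coeff_geometric_X_mul]
      rw [pow_mul]; simp
    · intro n hn
      rw [coeff_geometric_X_of_notMem k n hn]; simp

open PowerSeries PowerSeries.WithPiTopology in
lemma hasSum_partialGen (p : ℕ → Prop) [DecidablePred p] (N : ℕ) {z : ℂ} (hz : ‖z‖ < 1) :
    Summable (fun n => ‖((coeff n (partialGen p N) : ℕ) : ℂ) * z ^ n‖) ∧
    HasSum (fun n => ((coeff n (partialGen p N) : ℕ) : ℂ) * z ^ n)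
      (∏ i ∈ Finset.range N, if p (i + 1) then (1 - z ^ (i + 1))⁻¹ else 1) := by
  induction N with
  | zero =>
    have h0 : ∀ n, n ≠ 0 → ((coeff n (partialGen p 0) : ℕ) : ℂ) * z ^ n = 0 := by
      intro n hn; simp [partialGen, coeff_one, hn]
    refine ⟨summable_of_ne_finset_zero (s := {0}) fun n hn => ?_, ?_⟩
    · rw [h0 n (by simpa using hn), norm_zero]
    · simpa [partialGen] using hasSum_single 0 h0
  | succ N ih =>
    unfold partialGen at ih ⊢
    rw [Finset.prod_range_succ, Finset.prod_range_succ]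
    by_cases hp : p (N + 1)
    · simp only [hp, if_true]
      obtain ⟨g1, g2⟩ := hasSum_geometric_X_eval N hz
      obtain ⟨i1, i2⟩ := ih
      set P := ∏ i ∈ Finset.range N, if p (i + 1) then ∑' j : ℕ, (X : ℕ⟦X⟧) ^ ((i + 1) * j) else 1
      set g := ∑' j : ℕ, (X : ℕ⟦X⟧) ^ ((N + 1) * j)
      have hc : (fun n => ((coeff n (P * g) : ℕ) : ℂ) * z ^ n) = fun n =>
          ∑ kl ∈ Finset.HasAntidiagonal.antidiagonal n,
            (((coeff kl.1 P : ℕ) : ℂ) * z ^ kl.1) * (((coeff kl.2 g : ℕ) : ℂ) * z ^ kl.2) := by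
        funext n
        rw [coeff_mul]
        push_cast
        rw [Finset.sum_mul]
        refine Finset.sum_congr rfl fun kl hkl => ?_
        rw [← Finset.HasAntidiagonal.mem_antidiagonal.mp hkl, pow_add]
        ring
      have hs := summable_norm_sum_mul_antidiagonal_of_summable_norm i1 g1
      rw [show (fun n => ‖((coeff n (P * g) : ℕ) : ℂ) * z ^ n‖) = fun n => ‖(fun n =>
        ((coeff n (P * g) : ℕ) : ℂ) * z ^ n) n‖ from rfl, hc]
      refine ⟨hs, ?_⟩
      rw [← i2.tsum_eq, ← g2.tsum_eq, tsum_mul_tsum_eq_tsum_sum_antidiagonal_of_summable_norm i1 g1]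
      exact hs.of_norm.hasSum
    · simpa [hp] using ih

open PowerSeries PowerSeries.WithPiTopology in
lemma eventually_coeff_partialGen (p : ℕ → Prop) [DecidablePred p] (n : ℕ) :
    ∀ᶠ N in atTop, coeff n (partialGen p N) = (Nat.Partition.restricted n p).card := by
  have h := (Nat.Partition.hasProd_powerSeriesMk_card_restricted ℕ p).tendsto_prod_nat
  have h2 := ((continuous_coeff ℕ n).tendsto _).comp h
  simp only [coeff_mk, nhds_discrete, tendsto_pure] at h2
  exact h2

open PowerSeries PowerSeries.WithPiTopology in
lemma monotone_coeff_partialGen (p : ℕ → Prop) [DecidablePred p] (n : ℕ) :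
    Monotone fun N => coeff n (partialGen p N) := by
  refine monotone_nat_of_le_succ fun N => ?_
  unfold partialGen
  rw [Finset.prod_range_succ]
  split_ifs with h
  · rw [coeff_mul]
    have h0 := coeff_geometric_X_mul N 0
    rw [mul_zero] at h0
    have := Finset.single_le_sum (s := Finset.HasAntidiagonal.antidiagonal n)
      (f := fun q => coeff q.1 (∏ i ∈ Finset.range N,
        if p (i + 1) then ∑' j : ℕ, (X : ℕ⟦X⟧) ^ ((i + 1) * j) else 1) *
        coeff q.2 (∑' j : ℕ, (X : ℕ⟦X⟧) ^ ((N + 1) * j))) (fun _ _ => Nat.zero_le _)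
      (show (n, 0) ∈ Finset.HasAntidiagonal.antidiagonal n by simp)
    simpa [h0] using this
  · simp

lemma coeff_partialGen_le (p : ℕ → Prop) [DecidablePred p] (n N : ℕ) :
    PowerSeries.coeff n (partialGen p N) ≤ (Nat.Partition.restricted n p).card := by
  obtain ⟨M, hM⟩ := (eventually_coeff_partialGen p n).exists_forall_of_atTop
  rw [← hM (max M N) (le_max_left _ _)]
  exact monotone_coeff_partialGen p n (le_max_right _ _)

/-- A bound for the partial products of the generating function, uniform in the number of
factors. -/
lemma exists_partialGen_bound (p : ℕ → Prop) [DecidablePred p] {r : ℝ} (hr0 : 0 ≤ r) (hr : r < 1) :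
    ∃ C : ℝ, ∀ N, ‖∏ i ∈ Finset.range N, if p (i + 1) then (1 - (r : ℂ) ^ (i + 1))⁻¹ else 1‖ ≤ C := by
  have hr' : ‖(r : ℂ)‖ < 1 := by simpa [abs_of_nonneg hr0] using hr
  obtain ⟨C, hC⟩ :=
    ((tendsto_qPoch hr').inv₀ (tprod_one_sub_pow_ne_zero hr')).norm.bddAbove_range
  refine ⟨C, fun N => le_trans ?_ (hC ⟨N, rfl⟩)⟩
  simp only [qPoch]
  rw [← Finset.prod_inv_distrib, norm_prod, norm_prod]
  refine Finset.prod_le_prod (fun _ _ => norm_nonneg _) fun i _ => ?_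
  split_ifs
  · exact le_rfl
  · have h1 : (1 - (r : ℂ) ^ (i + 1))⁻¹ = ((1 - r ^ (i + 1))⁻¹ : ℝ) := by push_cast; rfl
    have h2 : r ^ (i + 1) < 1 := pow_lt_one₀ hr0 hr (by omega)
    have h3 : 0 ≤ r ^ (i + 1) := by positivity
    rw [h1, norm_one, Complex.norm_real, Real.norm_eq_abs, abs_of_pos (by
      rw [inv_pos]; linarith)]
    exact (one_le_inv₀ (by linarith)).mpr (by linarith)

lemma summable_card_restricted (p : ℕ → Prop) [DecidablePred p] {z : ℂ} (hz : ‖z‖ < 1) :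
    Summable fun n => ‖((Nat.Partition.restricted n p).card : ℂ) * z ^ n‖ := by
  obtain ⟨C, hC⟩ := exists_partialGen_bound p (norm_nonneg z) hz
  have hz' : ‖((‖z‖ : ℝ) : ℂ)‖ < 1 := by simpa using hz
  refine summable_of_sum_range_le (c := C) (fun _ => norm_nonneg _) fun M => ?_
  obtain ⟨N, hN⟩ := (((Finset.range M).eventually_all (l := atTop)).mpr
    fun n _ => eventually_coeff_partialGen p n).exists
  obtain ⟨s1, s2⟩ := hasSum_partialGen p N hz'
  calc ∑ n ∈ Finset.range M, ‖((Nat.Partition.restricted n p).card : ℂ) * z ^ n‖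
      = ∑ n ∈ Finset.range M,
          ((PowerSeries.coeff n (partialGen p N) : ℕ) : ℝ) * ‖z‖ ^ n := by
        refine Finset.sum_congr rfl fun n hn => ?_
        rw [hN n hn]; simp
    _ ≤ ∑' n, ((PowerSeries.coeff n (partialGen p N) : ℕ) : ℝ) * ‖z‖ ^ n := by
        refine Summable.sum_le_tsum _ (fun _ _ => by positivity) ?_
        simpa using s1
    _ = ‖∏ i ∈ Finset.range N, if p (i + 1) then (1 - ((‖z‖ : ℝ) : ℂ) ^ (i + 1))⁻¹ else 1‖ := by
        rw [← s2.tsum_eq, ← Complex.norm_of_nonneg (tsum_nonneg fun n => by positivity)]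
        push_cast
        rfl
    _ ≤ C := hC N

/-- The generating function of partitions with parts satisfying `p` is the limit of its partial
products inside the unit disc. -/
theorem tendsto_prod_card_restricted (p : ℕ → Prop) [DecidablePred p] {z : ℂ} (hz : ‖z‖ < 1) :
    Tendsto (fun N => ∏ i ∈ Finset.range N, if p (i + 1) then (1 - z ^ (i + 1))⁻¹ else 1) atTop
      (𝓝 (∑' n, ((Nat.Partition.restricted n p).card : ℂ) * z ^ n)) := by
  simp_rw [fun N => (hasSum_partialGen p N hz).2.tsum_eq.symm]
  refine tendsto_tsum_of_dominated_convergence (summable_card_restricted p hz) ?_ ?_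
  · intro n
    refine tendsto_const_nhds.congr' ?_
    filter_upwards [eventually_coeff_partialGen p n] with N hN
    rw [hN]
  · refine Eventually.of_forall fun N n => ?_
    rw [norm_mul, norm_mul]
    gcongr
    simpa using coeff_partialGen_le p n N

/-- The generating function of `Q d 2` in the variable `exp (-τ)`. -/
noncomputable def genQ (d : ℕ) (τ : ℂ) : ℂ := ∑' n, (Q d 2 n : ℂ) * Complex.exp (-τ) ^ n

lemma norm_exp_neg_lt_one {τ : ℂ} (hτ : 0 < τ.re) : ‖Complex.exp (-τ)‖ < 1 := by
  rw [Complex.norm_exp]; simpa using hτ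

lemma summable_genQ (d : ℕ) {τ : ℂ} (hτ : 0 < τ.re) :
    Summable fun n => ‖(Q d 2 n : ℂ) * Complex.exp (-τ) ^ n‖ :=
  summable_card_restricted _ (norm_exp_neg_lt_one hτ)

lemma prod_range_block {d : ℕ} (hd : 4 ≤ d) (f : ℕ → ℂ) (N : ℕ) :
    (∏ i ∈ Finset.range ((d + 3) * N),
      if ((i + 1 : ℕ) : ℤ) ≡ ((2 : ℕ) : ℤ) [ZMOD ((d : ℤ) + 3)] ∨
        ((i + 1 : ℕ) : ℤ) ≡ -((2 : ℕ) : ℤ) [ZMOD ((d : ℤ) + 3)] then f (i + 1) else 1) =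
      ∏ j ∈ Finset.range N, f ((d + 3) * j + 2) * f ((d + 3) * j + d + 1) := by
  induction N with
  | zero => simp
  | succ N ih =>
    rw [Finset.prod_range_succ, ← ih, mul_add, mul_one, Finset.prod_range_add]
    congr 1
    have hcond : ∀ i ∈ Finset.range (d + 3),
        ((((d + 3) * N + i + 1 : ℕ) : ℤ) ≡ ((2 : ℕ) : ℤ) [ZMOD ((d : ℤ) + 3)] ∨
        (((d + 3) * N + i + 1 : ℕ) : ℤ) ≡ -((2 : ℕ) : ℤ) [ZMOD ((d : ℤ) + 3)]) ↔
        (i = 1 ∨ i = d) := by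
      intro i hi
      rw [Finset.mem_range] at hi
      have e : (((d + 3) * N + i + 1 : ℕ) : ℤ) ≡ (i : ℤ) + 1 [ZMOD ((d : ℤ) + 3)] := by
        push_cast
        refine (Int.modEq_iff_dvd.mpr ⟨-N, by ring⟩)
      have hdz : (i : ℤ) < d + 3 := by exact_mod_cast hi
      constructor
      · rintro (h | h)
        · left
          have h2 := (e.symm.trans h).dvd
          have : (2 : ℤ) - (i + 1) = 0 := by
            refine Int.eq_zero_of_abs_lt_dvd h2 ?_
            rw [abs_lt]; constructor <;> omega
          omega
        · right
          have h2 := (e.symm.trans h).dvd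
          have h3 : ((d : ℤ) + 3) ∣ ((d : ℤ) - i) := by
            have := dvd_add h2 (dvd_refl ((d : ℤ) + 3))
            convert! this using 1
            push_cast; ring
          have : (d : ℤ) - i = 0 := by
            refine Int.eq_zero_of_abs_lt_dvd h3 ?_
            rw [abs_lt]; constructor <;> omega
          omega
      · rintro (rfl | rfl)
        · left; exact e
        · right
          refine e.trans (Int.modEq_iff_dvd.mpr ⟨-1, by push_cast; ring⟩)
    rw [Finset.prod_congr rfl (g := fun i => if i = 1 ∨ i = d then f ((d + 3) * N + i + 1) else 1)]
    · rw [← Finset.prod_filter]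
      have : Finset.filter (fun i => i = 1 ∨ i = d) (Finset.range (d + 3)) = {1, d} := by
        ext i; simp only [Finset.mem_filter, Finset.mem_range, Finset.mem_insert,
          Finset.mem_singleton]; omega
      rw [this, Finset.prod_pair (by omega)]
    · intro i hi
      simp only [hcond i hi]

/-- The generating function as a limit of products over the parts `D j + 2`, `D j + D - 2`. -/
theorem tendsto_genQ {d : ℕ} (hd : 4 ≤ d) {τ : ℂ} (hτ : 0 < τ.re) :
    Tendsto (fun N => ∏ j ∈ Finset.range N,
      ((1 - Complex.exp (-τ) ^ ((d + 3) * j + 2))⁻¹ *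
        (1 - Complex.exp (-τ) ^ ((d + 3) * j + d + 1))⁻¹)) atTop (𝓝 (genQ d τ)) := by
  have h := (tendsto_prod_card_restricted (fun i : ℕ => (i : ℤ) ≡ ((2 : ℕ) : ℤ) [ZMOD ((d : ℤ) + 3)] ∨
      (i : ℤ) ≡ -((2 : ℕ) : ℤ) [ZMOD ((d : ℤ) + 3)]) (norm_exp_neg_lt_one hτ)).comp
      (show Tendsto (fun N => (d + 3) * N) atTop atTop from
        tendsto_id.const_mul_atTop' (by omega))
  refine h.congr fun N => ?_
  exact prod_range_block hd (fun i => (1 - Complex.exp (-τ) ^ i)⁻¹) N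

/-! ### The transformation formula of the generating function -/

lemma tendsto_thetaSum_three {w : ℂ} (hw : 0 < w.re) :
    thetaSum 3 1 w = ∏' j : ℕ, (1 - Complex.exp (-w) ^ (j + 1)) := by
  have h1 := tendsto_thetaSum (D := 3) (by norm_num) 1 hw
  have h2 := (tendsto_qPoch (norm_exp_neg_lt_one hw)).comp
    (show Tendsto (fun N => 3 * N) atTop atTop from tendsto_id.const_mul_atTop' (by omega))
  refine tendsto_nhds_unique h1 (h2.congr fun N => ?_)
  have e1 : Complex.exp (-((3 : ℝ) : ℂ) * w) = Complex.exp (-w) ^ 3 := by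
    rw [← Complex.exp_nat_mul]; congr 1; push_cast; ring
  have e2 : Complex.exp (-((1 : ℝ) : ℂ) * w) = Complex.exp (-w) := by
    congr 1; push_cast; ring
  have e0 := Complex.exp_ne_zero (-w)
  rw [e1, e2]
  simp only [Function.comp_apply, qPoch]
  generalize Complex.exp (-w) = e at *
  induction N with
  | zero => simp
  | succ N ih =>
    rw [Finset.prod_range_succ, ← ih, show 3 * (N + 1) = 3 * N + 1 + 1 + 1 by ring,
      Finset.prod_range_succ, Finset.prod_range_succ, Finset.prod_range_succ]
    have : e⁻¹ * (e ^ 3) ^ (N + 1) = e ^ (3 * N + 1 + 1) := by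
      field_simp; ring
    rw [this]
    ring

lemma genQ_mul_thetaSum {d : ℕ} (hd : 4 ≤ d) {τ : ℂ} (hτ : 0 < τ.re) :
    genQ d τ * thetaSum ((d : ℝ) + 3) 2 τ = thetaSum 3 1 ((d + 3) * τ) := by
  have hD : (0 : ℝ) < (d : ℝ) + 3 := by positivity
  have hw : 0 < (((d : ℂ) + 3) * τ).re := by
    have : (((d : ℂ) + 3) * τ) = (((d : ℝ) + 3 : ℝ) : ℂ) * τ := by push_cast; ring
    rw [this, Complex.re_ofReal_mul]; positivity
  rw [tendsto_thetaSum_three hw]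
  have h := (tendsto_genQ hd hτ).mul (tendsto_thetaSum hD 2 hτ)
  refine tendsto_nhds_unique h ((tendsto_qPoch (norm_exp_neg_lt_one hw)).congr fun N => ?_)
  have e0 := Complex.exp_ne_zero (-τ)
  have hlt := norm_exp_neg_lt_one hτ
  have e1 : Complex.exp (-(((d : ℝ) + 3 : ℝ) : ℂ) * τ) = Complex.exp (-τ) ^ (d + 3) := by
    rw [← Complex.exp_nat_mul]; congr 1; push_cast; ring
  have e2 : Complex.exp (-((2 : ℝ) : ℂ) * τ) = Complex.exp (-τ) ^ 2 := by
    rw [← Complex.exp_nat_mul]; congr 1; push_cast; ring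
  have e3 : Complex.exp (-(((d : ℂ) + 3) * τ)) = Complex.exp (-τ) ^ (d + 3) := by
    rw [← Complex.exp_nat_mul]; congr 1; push_cast; ring
  rw [e1, e2, e3, qPoch, ← Finset.prod_mul_distrib]
  refine Finset.prod_congr rfl fun j _ => ?_
  generalize Complex.exp (-τ) = e at *
  have x1 : e ^ 2 * (e ^ (d + 3)) ^ j = e ^ ((d + 3) * j + 2) := by rw [← pow_mul]; ring
  have x2 : (e ^ 2)⁻¹ * (e ^ (d + 3)) ^ (j + 1) = e ^ ((d + 3) * j + d + 1) := by
    rw [← pow_mul]; field_simp; ring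
  rw [x1, x2]
  have n1 := one_sub_pow_ne_zero hlt ((d + 3) * j + 1)
  have n2 := one_sub_pow_ne_zero hlt ((d + 3) * j + d)
  rw [show (d + 3) * j + 1 + 1 = (d + 3) * j + 2 by ring] at n1
  field_simp

/-- The coefficient of `τ` in the exponent of the transformed generating function. -/
noncomputable def kap (d : ℕ) : ℝ :=
  ((d : ℝ) + 3) / 24 - ((d : ℝ) - 1) ^ 2 / (8 * ((d : ℝ) + 3))

/-- The coefficient of `1 / τ` in the exponent of the transformed generating function. -/
noncomputable def poleCoeff (d : ℕ) : ℝ := Real.pi ^ 2 / (3 * ((d : ℝ) + 3))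

/-- The transformation formula: up to terms exponentially small in `1 / τ`, the generating function
is `exp (A / τ + κ τ) / (2 sin (2π / D))`. -/
theorem genQ_transformation {d : ℕ} (hd : 4 ≤ d) {τ : ℂ} (hτ : 0 < τ.re) :
    ∃ E₁ E₂ : ℂ,
      ‖E₁‖ ≤ 2 * Real.exp (-(4 * poleCoeff d * (τ⁻¹).re)) /
        (1 - Real.exp (-(4 * poleCoeff d * (τ⁻¹).re))) ∧
      ‖E₂‖ ≤ 2 * Real.exp (-(12 * poleCoeff d * (τ⁻¹).re)) /
        (1 - Real.exp (-(12 * poleCoeff d * (τ⁻¹).re))) ∧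
      genQ d τ * (2 * Real.sin (2 * Real.pi / ((d : ℝ) + 3)) + E₂) =
        Complex.exp (poleCoeff d * τ⁻¹ + kap d * τ) * (1 + E₁ / Real.sqrt 3) := by
  have hD : (0 : ℝ) < (d : ℝ) + 3 := by positivity
  have hwe : (((d : ℂ) + 3) * τ) = (((d : ℝ) + 3 : ℝ) : ℂ) * τ := by push_cast; ring
  have hw : 0 < (((d : ℂ) + 3) * τ).re := by
    rw [hwe, Complex.re_ofReal_mul]; positivity
  have hτ0 : τ ≠ 0 := by rintro rfl; simp at hτ
  obtain ⟨E₂, hE₂, h2⟩ := thetaSum_eq hD 2 hτ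
  obtain ⟨E₁, hE₁, h1⟩ := thetaSum_eq (D := 3) (by norm_num) 1 hw
  have hF := genQ_mul_thetaSum hd hτ
  rw [h1, h2] at hF
  have hinv : ((((d : ℂ) + 3) * τ)⁻¹).re = (τ⁻¹).re / ((d : ℝ) + 3) := by
    have : (((d : ℂ) + 3) * τ)⁻¹ = (((((d : ℝ) + 3)⁻¹ : ℝ)) : ℂ) * τ⁻¹ := by
      push_cast; rw [mul_inv]
    rw [this, Complex.re_ofReal_mul]; field_simp
  refine ⟨E₁, E₂, ?_, ?_, ?_⟩
  · have : 4 * Real.pi ^ 2 / 3 * ((((d : ℂ) + 3) * τ)⁻¹).re = 4 * poleCoeff d * (τ⁻¹).re := by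
      rw [hinv, poleCoeff]; field_simp
    rwa [this] at hE₁
  · have : 4 * Real.pi ^ 2 / ((d : ℝ) + 3) * (τ⁻¹).re = 12 * poleCoeff d * (τ⁻¹).re := by
      rw [poleCoeff]; field_simp; ring
    rwa [this] at hE₂
  · set α : ℂ := ((((d : ℝ) + 3 : ℝ) : ℂ) * τ / (2 * Real.pi)) with hα
    have hα' := re_theta_width_pos hD hτ
    rw [← hα] at hα'
    have hα0 : α ≠ 0 := by intro h; rw [h] at hα'; simp at hα'
    have e3 : (((3 : ℝ) : ℂ) * (((d : ℂ) + 3) * τ) / (2 * Real.pi)) = ((3 : ℝ) : ℂ) * α := by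
      rw [hα]; push_cast; ring
    have hpow : (((3 : ℝ) : ℂ) * α) ^ (1 / 2 : ℂ) = Real.sqrt 3 * α ^ (1 / 2 : ℂ) := by
      rw [Complex.cpow_def_of_ne_zero (by simp [hα0]), Complex.log_ofReal_mul (by norm_num) hα0,
        add_mul, Complex.exp_add, Complex.cpow_def_of_ne_zero hα0, Real.sqrt_eq_rpow,
        Complex.ofReal_cpow (by norm_num), Complex.cpow_def_of_ne_zero (by norm_num),
        Complex.ofReal_log (by norm_num)]
      norm_num
    have hsα : α ^ (1 / 2 : ℂ) ≠ 0 := by simp [Complex.cpow_eq_zero_iff, hα0]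
    have hs3 : ((Real.sqrt 3 : ℝ) : ℂ) ≠ 0 := by
      exact_mod_cast (Real.sqrt_pos.mpr (by norm_num : (0 : ℝ) < 3)).ne'
    have hsin : (2 : ℂ) * Real.sin (Real.pi * 1 / 3) = Real.sqrt 3 := by
      rw [mul_one, Real.sin_pi_div_three]; push_cast; ring
    rw [e3, hpow, hsin] at hF
    have hexp : Complex.exp (poleCoeff d * τ⁻¹ + kap d * τ) *
        Complex.exp ((((((d : ℝ) + 3 : ℝ) : ℂ)) / 2 - ((2 : ℝ) : ℂ)) ^ 2 /
          (2 * ((((d : ℝ) + 3 : ℝ) : ℂ))) * τ -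
          Real.pi ^ 2 / (2 * ((((d : ℝ) + 3 : ℝ) : ℂ)) * τ)) =
        Complex.exp ((((3 : ℝ) : ℂ) / 2 - ((1 : ℝ) : ℂ)) ^ 2 / (2 * ((3 : ℝ) : ℂ)) *
          (((d : ℂ) + 3) * τ) - Real.pi ^ 2 / (2 * ((3 : ℝ) : ℂ) * (((d : ℂ) + 3) * τ))) := by
      rw [← Complex.exp_add]
      congr 1
      have : (d : ℂ) + 3 ≠ 0 := by exact_mod_cast hD.ne'
      simp only [poleCoeff, kap]
      push_cast
      field_simp
      ring
    rw [← hexp] at hF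
    set G := Complex.exp ((((((d : ℝ) + 3 : ℝ) : ℂ)) / 2 - ((2 : ℝ) : ℂ)) ^ 2 /
          (2 * ((((d : ℝ) + 3 : ℝ) : ℂ))) * τ -
          Real.pi ^ 2 / (2 * ((((d : ℝ) + 3 : ℝ) : ℂ)) * τ)) with hG
    have hG0 : G ≠ 0 := Complex.exp_ne_zero _
    rw [show Real.pi * 2 / ((d : ℝ) + 3) = 2 * Real.pi / ((d : ℝ) + 3) by ring] at hF
    generalize Complex.exp (poleCoeff d * τ⁻¹ + kap d * τ) = X at *
    have key : (genQ d τ * (2 * Real.sin (2 * Real.pi / ((d : ℝ) + 3)) + E₂)) *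
        (G * (α ^ (1 / 2 : ℂ))⁻¹) = (X * (1 + E₁ / Real.sqrt 3)) * (G * (α ^ (1 / 2 : ℂ))⁻¹) := by
      rw [one_div, one_div] at hF
      field_simp at hF ⊢
      linear_combination hF
    exact mul_right_cancel₀ (mul_ne_zero hG0 (inv_ne_zero hsα)) key

/-! ### The generating function near the positive real axis -/

lemma poleCoeff_pos (d : ℕ) : 0 < poleCoeff d := by
  have := Real.pi_pos
  unfold poleCoeff; positivity

lemma abs_kap_le {d : ℕ} (hd : 4 ≤ d) : |kap d| ≤ ((d : ℝ) + 3) / 12 := by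
  have hd' : (4 : ℝ) ≤ d := by exact_mod_cast hd
  have hD : (0 : ℝ) < (d : ℝ) + 3 := by positivity
  have : kap d = -((((d : ℝ) + 3) ^ 2 - 12 * ((d : ℝ) + 3) + 24) / (12 * ((d : ℝ) + 3))) := by
    unfold kap; field_simp; ring
  rw [this, abs_neg, abs_div, abs_of_pos (by positivity : 0 < 12 * ((d : ℝ) + 3)),
    div_le_div_iff₀ (by positivity) (by norm_num)]
  have : |((d : ℝ) + 3) ^ 2 - 12 * ((d : ℝ) + 3) + 24| ≤ ((d : ℝ) + 3) ^ 2 := by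
    rw [abs_le]; constructor <;> nlinarith
  nlinarith

lemma two_sin_lower {d : ℕ} (hd : 4 ≤ d) :
    8 / ((d : ℝ) + 3) ≤ 2 * Real.sin (2 * Real.pi / ((d : ℝ) + 3)) := by
  have hd' : (4 : ℝ) ≤ d := by exact_mod_cast hd
  have hD : (0 : ℝ) < (d : ℝ) + 3 := by positivity
  have hpi := Real.pi_pos
  have h := Real.mul_le_sin (x := 2 * Real.pi / ((d : ℝ) + 3)) (by positivity) (by
    rw [div_le_div_iff₀ hD (by norm_num)]; nlinarith)
  have e : 2 / Real.pi * (2 * Real.pi / ((d : ℝ) + 3)) = 4 / ((d : ℝ) + 3) := by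
    field_simp; norm_num
  rw [e] at h
  have : 8 / ((d : ℝ) + 3) = 2 * (4 / ((d : ℝ) + 3)) := by ring
  linarith

lemma sin_pos_two_pi_div {d : ℕ} (hd : 4 ≤ d) :
    0 < Real.sin (2 * Real.pi / ((d : ℝ) + 3)) := by
  have := two_sin_lower hd
  have h2 : 0 < 8 / ((d : ℝ) + 3) := by positivity
  linarith

/-- `‖(1 + a)(1 + b)/(1 + c) - 1‖` for small `a`, `b`, `c`, in the cleared form in which it is
used. -/
lemma norm_sub_le_of_mul_one_add {G X a b c : ℂ} {t : ℝ} (ht : t ≤ 1 / 100)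
    (ha : ‖a‖ ≤ t) (hb : ‖b‖ ≤ t) (hc : ‖c‖ ≤ t) (h : G * (1 + c) = X * (1 + a) * (1 + b)) :
    ‖G - X‖ ≤ 4 * t * ‖X‖ := by
  have ht0 : 0 ≤ t := (norm_nonneg a).trans ha
  have e : (G - X) * (1 + c) = X * (a + b + a * b - c) := by linear_combination h
  have h1 : 1 - t ≤ ‖1 + c‖ := by
    have := norm_sub_norm_le (1 : ℂ) (-c)
    rw [norm_neg, norm_one, sub_neg_eq_add] at this
    linarith
  have h2 : ‖a + b + a * b - c‖ ≤ 3 * t + t * t := by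
    calc ‖a + b + a * b - c‖ ≤ ‖a‖ + ‖b‖ + ‖a * b‖ + ‖c‖ :=
          (norm_sub_le _ _).trans (add_le_add_left (norm_add₃_le) _)
      _ ≤ t + t + t * t + t := by rw [norm_mul]; gcongr
      _ = _ := by ring
  have h3 : ‖G - X‖ * ‖1 + c‖ = ‖X‖ * ‖a + b + a * b - c‖ := by
    rw [← norm_mul, e, norm_mul]
  have hX := norm_nonneg X
  have h4 : ‖G - X‖ * (1 - t) ≤ ‖X‖ * (3 * t + t * t) := by
    calc ‖G - X‖ * (1 - t) ≤ ‖G - X‖ * ‖1 + c‖ := by gcongr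
      _ = _ := h3
      _ ≤ _ := by gcongr
  have h5 : 3 * t + t * t ≤ 4 * t * (1 - t) := by nlinarith
  have h6 : ‖X‖ * (3 * t + t * t) ≤ (4 * t * ‖X‖) * (1 - t) := by
    calc ‖X‖ * (3 * t + t * t) ≤ ‖X‖ * (4 * t * (1 - t)) := by gcongr
      _ = _ := by ring
  exact le_of_mul_le_mul_right (h4.trans h6) (by linarith)

lemma two_mul_exp_neg_div_le {s : ℝ} (hs : 1 ≤ s) :
    2 * Real.exp (-s) / (1 - Real.exp (-s)) ≤ 4 * Real.exp (-s) := by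
  have h : Real.exp (-s) ≤ 1 / 2 := by
    rw [Real.exp_neg, one_div]
    apply inv_anti₀ (by norm_num)
    have := Real.add_one_le_exp s
    linarith
  have h0 := Real.exp_pos (-s)
  rw [div_le_iff₀ (by linarith)]
  nlinarith

lemma inv_re_eq {y : ℝ} (hy : 0 < y) (u : ℝ) :
    (((y : ℂ) * (1 + u * Complex.I))⁻¹).re = 1 / (y * (1 + u ^ 2)) := by
  rw [Complex.inv_re, Complex.normSq_apply]
  simp only [Complex.mul_re, Complex.mul_im, Complex.ofReal_re, Complex.ofReal_im, Complex.add_re,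
    Complex.add_im, Complex.one_re, Complex.one_im, Complex.I_re, Complex.I_im]
  rw [div_eq_div_iff (by nlinarith [mul_pos hy hy, sq_nonneg (y * u)]) (by positivity)]
  ring

/-- In the sector `|Im τ| ≤ Re τ` the generating function is
`exp (A / τ) / (2 sin (2π / D))` up to a relative error `4 y / A`. -/
theorem norm_genQ_sub_le {d : ℕ} (hd : 4 ≤ d) {y : ℝ} (hy : 0 < y)
    (hm : 100 ≤ poleCoeff d / y) (hDm : (d : ℝ) + 3 ≤ poleCoeff d / y) {u : ℝ} (hu : |u| ≤ 1) :
    ‖genQ d (y * (1 + u * Complex.I)) * (2 * Real.sin (2 * Real.pi / ((d : ℝ) + 3))) -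
      Complex.exp (poleCoeff d * (y * (1 + u * Complex.I))⁻¹)‖ ≤
    4 * (poleCoeff d / y)⁻¹ * ‖Complex.exp (poleCoeff d * (y * (1 + u * Complex.I))⁻¹)‖ := by
  have hA := poleCoeff_pos d
  have hD : (0 : ℝ) < (d : ℝ) + 3 := by positivity
  set τ : ℂ := (y : ℂ) * (1 + u * Complex.I) with hτdef
  set m := poleCoeff d / y with hmdef
  have hm0 : 0 < m := by positivity
  have hτ : 0 < τ.re := by simp [hτdef, hy]
  have hre : τ⁻¹.re = 1 / (y * (1 + u ^ 2)) := inv_re_eq hy u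
  have hu2 : u ^ 2 ≤ 1 := by rwa [sq_le_one_iff_abs_le_one]
  have hre2 : m / 2 ≤ poleCoeff d * τ⁻¹.re := by
    rw [hre, hmdef, div_div, mul_one_div]
    gcongr
    linarith
  obtain ⟨E₁, E₂, h1, h2, h⟩ := genQ_transformation hd hτ
  have hs := two_sin_lower hd
  set S : ℝ := 2 * Real.sin (2 * Real.pi / ((d : ℝ) + 3)) with hS
  have hS0 : 0 < S := lt_of_lt_of_le (by positivity) hs
  have hScast : (2 * (Real.sin (2 * Real.pi / ((d : ℝ) + 3)) : ℂ)) = (S : ℂ) := by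
    rw [hS]; push_cast; rfl
  rw [hScast] at h ⊢
  have hSc : (S : ℂ) ≠ 0 := by exact_mod_cast hS0.ne'
  have hexp : ∀ k : ℝ, 1 ≤ k → Real.exp (-(k * m)) ≤ (k * m)⁻¹ := by
    intro k hk
    rw [Real.exp_neg]
    apply inv_anti₀ (by positivity)
    have := Real.add_one_le_exp (k * m)
    linarith
  -- the three relative errors
  have hE1 : ‖E₁ / Real.sqrt 3‖ ≤ m⁻¹ := by
    have b1 : ‖E₁‖ ≤ 4 * Real.exp (-(2 * m)) := by
      refine (h1.trans (two_mul_exp_neg_div_le ?_)).trans ?_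
      · linarith
      · exact mul_le_mul_of_nonneg_left (Real.exp_le_exp.mpr (by linarith)) (by norm_num)
    have b2 : (4 : ℝ) * Real.exp (-(2 * m)) ≤ m⁻¹ := by
      have : Real.exp (-(2 * m)) = Real.exp (-(1 * m)) * Real.exp (-(1 * m)) := by
        rw [← Real.exp_add]; ring_nf
      have h1 := hexp 1 le_rfl
      rw [one_mul] at h1
      have h3 : m⁻¹ ≤ 1 / 100 := by
        rw [one_div]; exact inv_anti₀ (by norm_num) hm
      rw [this, one_mul]
      have h0 := Real.exp_pos (-m)
      nlinarith
    have hs3 : 1 ≤ Real.sqrt 3 := Real.one_le_sqrt.mpr (by norm_num)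
    rw [norm_div, Complex.norm_real, Real.norm_of_nonneg (by positivity)]
    exact (div_le_self (norm_nonneg _) hs3).trans (b1.trans b2)
  have hE2 : ‖E₂ / S‖ ≤ m⁻¹ := by
    have b1 : ‖E₂‖ ≤ 4 * Real.exp (-(6 * m)) := by
      refine (h2.trans (two_mul_exp_neg_div_le ?_)).trans ?_
      · linarith
      · exact mul_le_mul_of_nonneg_left (Real.exp_le_exp.mpr (by linarith)) (by norm_num)
    rw [norm_div, Complex.norm_real, Real.norm_of_nonneg hS0.le, div_le_iff₀ hS0]
    have h3 : Real.exp (-(6 * m)) ≤ m⁻¹ * m⁻¹ := by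
      have : Real.exp (-(6 * m)) ≤ Real.exp (-(1 * m)) * Real.exp (-(1 * m)) := by
        rw [← Real.exp_add]; apply Real.exp_le_exp.mpr; linarith
      refine this.trans ?_
      have h1 := hexp 1 le_rfl
      rw [one_mul] at h1 ⊢
      exact mul_le_mul h1 h1 (Real.exp_pos _).le (by positivity)
    have h4 : m⁻¹ ≤ ((d : ℝ) + 3)⁻¹ := inv_anti₀ hD hDm
    calc ‖E₂‖ ≤ 4 * (m⁻¹ * m⁻¹) := b1.trans (by gcongr)
      _ = m⁻¹ * (4 * m⁻¹) := by ring
      _ ≤ m⁻¹ * (8 * ((d : ℝ) + 3)⁻¹) := by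
          have : 0 < m⁻¹ := by positivity
          gcongr ?_ * ?_
          linarith
      _ ≤ m⁻¹ * S := by
          rw [← div_eq_mul_inv]; gcongr
  have hK : ‖Complex.exp (kap d * τ) - 1‖ ≤ m⁻¹ := by
    have hτn : ‖τ‖ ≤ y * (3 / 2) := by
      rw [hτdef, norm_mul, Complex.norm_real, Real.norm_of_nonneg hy.le]
      gcongr
      have : ‖(1 : ℂ) + u * Complex.I‖ ^ 2 ≤ (3 / 2) ^ 2 := by
        rw [Complex.sq_norm, Complex.normSq_apply]
        simp
        nlinarith
      exact le_of_sq_le_sq this (by norm_num)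
    have hDy : ((d : ℝ) + 3) * y = Real.pi ^ 2 / 3 * m⁻¹ := by
      rw [hmdef, poleCoeff]
      have := Real.pi_pos
      field_simp
    have hpi2 : Real.pi ^ 2 ≤ 10 := by
      have := Real.pi_lt_d2; have := Real.pi_pos; nlinarith
    have hk : ‖(kap d : ℂ) * τ‖ ≤ m⁻¹ / 2 := by
      rw [norm_mul, Complex.norm_real, Real.norm_eq_abs]
      calc |kap d| * ‖τ‖ ≤ (((d : ℝ) + 3) / 12) * (y * (3 / 2)) := by
            gcongr; exact abs_kap_le hd
        _ = (((d : ℝ) + 3) * y) / 8 := by ring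
        _ = Real.pi ^ 2 / 24 * m⁻¹ := by rw [hDy]; ring
        _ ≤ 1 / 2 * m⁻¹ := by
            exact mul_le_mul_of_nonneg_right (by linarith) (by positivity)
        _ = _ := by ring
    have h1 : m⁻¹ ≤ 1 / 100 := by
      rw [one_div]; exact inv_anti₀ (by norm_num) hm
    refine (Complex.norm_exp_sub_one_le (by linarith)).trans ?_
    linarith
  refine norm_sub_le_of_mul_one_add (t := m⁻¹)
    (a := Complex.exp (kap d * τ) - 1) (b := E₁ / Real.sqrt 3) (c := E₂ / S) ?_ hK hE1 hE2 ?_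
  · rw [one_div]; exact inv_anti₀ (by norm_num) hm
  · rw [Complex.exp_add] at h
    have : genQ d τ * S * (1 + E₂ / S) = genQ d τ * (S + E₂) := by
      field_simp
    rw [this, h]
    ring

/-! ### The generating function away from the positive real axis -/

/-- Comparing the logarithmic series of `1 - z` and `1 - ‖z‖` termwise and keeping only the first
term. -/
lemma norm_one_sub_inv_le {z : ℂ} (hz : ‖z‖ < 1) :
    ‖(1 - z)⁻¹‖ ≤ (1 - ‖z‖)⁻¹ * Real.exp (-(‖z‖ - z.re)) := by
  have h1 := Complex.hasSum_re (Complex.hasSum_taylorSeries_neg_log hz)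
  have hr : ‖((‖z‖ : ℝ) : ℂ)‖ < 1 := by simpa using hz
  have h2 := Complex.hasSum_re (Complex.hasSum_taylorSeries_neg_log hr)
  have h3 := h2.sub h1
  have hnn : ∀ n : ℕ, 0 ≤ (((‖z‖ : ℝ) : ℂ) ^ n / n).re - (z ^ n / n).re := by
    intro n
    have e1 : (((‖z‖ : ℝ) : ℂ) ^ n / n).re = ‖z ^ n / n‖ := by
      rw [norm_div, norm_pow, Complex.norm_natCast]
      norm_cast
    rw [e1]
    linarith [Complex.re_le_norm (z ^ n / n)]
  have h4 := le_hasSum h3 1 fun n _ => hnn n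
  simp only [pow_one, Nat.cast_one, div_one, Complex.ofReal_re, Complex.neg_re, Complex.log_re] at h4
  have h5 : ‖1 - ((‖z‖ : ℝ) : ℂ)‖ = 1 - ‖z‖ := by
    rw [← Complex.ofReal_one, ← Complex.ofReal_sub, Complex.norm_of_nonneg (by linarith)]
  rw [h5] at h4
  have hz1 : 0 < ‖1 - z‖ := by
    rw [norm_pos_iff, sub_ne_zero]
    rintro rfl
    simp at hz
  have hpos : 0 < 1 - ‖z‖ := by linarith
  rw [norm_inv, Real.exp_neg, ← mul_inv]
  apply inv_anti₀ (by positivity)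
  have := Real.exp_le_exp.mpr (show Real.log (1 - ‖z‖) + (‖z‖ - z.re) ≤ Real.log ‖1 - z‖ by linarith)
  rwa [Real.exp_add, Real.exp_log hpos, Real.exp_log hz1] at this

/-- The decay of the generating function off the real axis is governed by the parts congruent to `2`:
with `z = exp (-τ)`, the factors of the parts `k = D j + 2` alone give the exponent
`L = ∑ (|z|^k - Re z^k)`, the loss. -/
lemma norm_genQ_le {d : ℕ} (hd : 4 ≤ d) {τ : ℂ} (hτ : 0 < τ.re) {L : ℝ}
    (hL : HasSum (fun j : ℕ => ‖Complex.exp (-τ)‖ ^ ((d + 3) * j + 2) -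
      (Complex.exp (-τ) ^ ((d + 3) * j + 2)).re) L) :
    ‖genQ d τ‖ ≤ ‖genQ d τ.re‖ * Real.exp (-L) := by
  have h1 := (tendsto_genQ hd hτ).norm
  have h2 := (tendsto_genQ hd (τ := (τ.re : ℂ)) (by simpa using hτ)).norm
  have h3 := h2.mul ((Real.continuous_exp.tendsto _).comp hL.tendsto_sum_nat.neg)
  refine le_of_tendsto_of_tendsto' h1 h3 fun N => ?_
  have hlt := norm_exp_neg_lt_one hτ
  have hre : Complex.exp (-(τ.re : ℂ)) = ((‖Complex.exp (-τ)‖ : ℝ) : ℂ) := by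
    rw [Complex.norm_exp]; push_cast; simp
  simp only [Function.comp_apply]
  rw [hre, ← Finset.sum_neg_distrib, Real.exp_sum, norm_prod, norm_prod, ← Finset.prod_mul_distrib]
  refine Finset.prod_le_prod (fun _ _ => norm_nonneg _) fun j _ => ?_
  generalize Complex.exp (-τ) = e at *
  have key : ∀ k : ℕ, ‖(1 - ((‖e‖ : ℝ) : ℂ) ^ (k + 1))⁻¹‖ = (1 - ‖e ^ (k + 1)‖)⁻¹ := by
    intro k
    have h : ‖e‖ ^ (k + 1) < 1 := pow_lt_one₀ (norm_nonneg _) hlt (by omega)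
    rw [norm_inv, norm_pow e, ← Complex.ofReal_pow, ← Complex.ofReal_one, ← Complex.ofReal_sub,
      Complex.norm_of_nonneg (by linarith)]
  have hk : ∀ k : ℕ, ‖e ^ (k + 1)‖ < 1 := fun k => by
    rw [norm_pow]; exact pow_lt_one₀ (norm_nonneg _) hlt (by omega)
  have b1 := norm_one_sub_inv_le (hk ((d + 3) * j + 1))
  have b2 := norm_one_sub_inv_le (hk ((d + 3) * j + d))
  have b3 : Real.exp (-(‖e ^ ((d + 3) * j + d + 1)‖ - (e ^ ((d + 3) * j + d + 1)).re)) ≤ 1 := by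
    rw [Real.exp_le_one_iff]
    linarith [Complex.re_le_norm (e ^ ((d + 3) * j + d + 1))]
  have p2 : 0 < 1 - ‖e ^ ((d + 3) * j + d + 1)‖ := by linarith [hk ((d + 3) * j + d)]
  have p1 : 0 < 1 - ‖e ^ ((d + 3) * j + 1 + 1)‖ := by linarith [hk ((d + 3) * j + 1)]
  have k1 := key ((d + 3) * j + 1)
  rw [show (d + 3) * j + 1 + 1 = (d + 3) * j + 2 by ring] at b1 p1 k1
  rw [norm_mul, norm_mul, k1, key]
  calc _ ≤ ((1 - ‖e ^ ((d + 3) * j + 2)‖)⁻¹ *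
        Real.exp (-(‖e ^ ((d + 3) * j + 2)‖ - (e ^ ((d + 3) * j + 2)).re))) *
        ((1 - ‖e ^ ((d + 3) * j + d + 1)‖)⁻¹ * 1) := by
        refine mul_le_mul b1 (b2.trans ?_) (norm_nonneg _) (by positivity)
        gcongr
    _ = _ := by rw [norm_pow e ((d + 3) * j + 2)]; ring

lemma hasSum_loss (d : ℕ) {τ : ℂ} (hτ : 0 < τ.re) :
    HasSum (fun j : ℕ => ‖Complex.exp (-τ)‖ ^ ((d + 3) * j + 2) -
      (Complex.exp (-τ) ^ ((d + 3) * j + 2)).re)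
      (‖Complex.exp (-τ)‖ ^ 2 / (1 - ‖Complex.exp (-τ)‖ ^ (d + 3)) -
        (Complex.exp (-τ) ^ 2 / (1 - Complex.exp (-τ) ^ (d + 3))).re) := by
  have hlt := norm_exp_neg_lt_one hτ
  generalize Complex.exp (-τ) = e at *
  have h1 : ‖e‖ ^ (d + 3) < 1 := pow_lt_one₀ (norm_nonneg _) hlt (by omega)
  have h2 : ‖e ^ (d + 3)‖ < 1 := by rwa [norm_pow]
  have s1 := (hasSum_geometric_of_lt_one (by positivity) h1).mul_left (‖e‖ ^ 2)
  have s2 := Complex.hasSum_re ((hasSum_geometric_of_norm_lt_one h2).mul_left (e ^ 2))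
  simp only [div_eq_mul_inv]
  refine (s1.sub s2).congr_fun fun j => ?_
  have : ∀ w : ℂ, w ^ ((d + 3) * j + 2) = w ^ 2 * (w ^ (d + 3)) ^ j := fun w => by
    rw [← pow_mul]; ring
  have h3 : ‖e‖ ^ ((d + 3) * j + 2) = ‖e‖ ^ 2 * (‖e‖ ^ (d + 3)) ^ j := by
    rw [← pow_mul]; ring
  rw [this, h3]

lemma cos_le_cos_of_mem {a x : ℝ} (ha : 0 ≤ a) (h1 : a ≤ x) (h2 : x ≤ 2 * Real.pi - a) :
    Real.cos x ≤ Real.cos a := by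
  rcases le_total x Real.pi with h | h
  · exact Real.cos_le_cos_of_nonneg_of_le_pi ha h h1
  · rw [← Real.cos_two_pi_sub x]
    exact Real.cos_le_cos_of_nonneg_of_le_pi ha (by linarith) (by linarith)

/-- If `θ` is close to a nonzero fraction `2π h / D`, the first parts `D j + 2` all have arguments
bounded away from `0`, since `D` is odd and does not divide `2 h`. -/
lemma cos_part_le {d : ℕ} (hd_even : Even d) {h : ℤ} (h0 : h ≠ 0)
    (hh : 2 * |h| < (d : ℤ) + 4) (j : ℕ) {η : ℝ}
    (hη : (((d : ℝ) + 3) * j + 2) * |η| ≤ Real.pi / ((d : ℝ) + 3)) :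
    Real.cos ((((d : ℝ) + 3) * j + 2) * (2 * Real.pi * h / ((d : ℝ) + 3) + η)) ≤
      Real.cos (Real.pi / ((d : ℝ) + 3)) := by
  have hD : (0 : ℝ) < (d : ℝ) + 3 := by positivity
  have hpi := Real.pi_pos
  set ε := (((d : ℝ) + 3) * j + 2) * η with hε
  have hε' : |ε| ≤ Real.pi / ((d : ℝ) + 3) := by
    rw [hε, abs_mul, abs_of_nonneg (by positivity)]; exact hη
  have e1 : (((d : ℝ) + 3) * j + 2) * (2 * Real.pi * h / ((d : ℝ) + 3) + η) =
      (4 * Real.pi * h / ((d : ℝ) + 3) + ε) + ((h * j : ℤ) : ℝ) * (2 * Real.pi) := by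
    rw [hε]; push_cast; field_simp; ring
  rw [e1, Real.cos_add_int_mul_two_pi]
  obtain ⟨s, hs⟩ : ∃ s : ℤ, (d : ℤ) = s + s := by
    obtain ⟨s, hs⟩ := hd_even; exact ⟨s, by exact_mod_cast hs⟩
  have key : ∀ (k : ℤ) (δ : ℝ), 1 ≤ k → 2 * k < (d : ℤ) + 4 → |δ| ≤ Real.pi / ((d : ℝ) + 3) →
      Real.cos (4 * Real.pi * k / ((d : ℝ) + 3) + δ) ≤ Real.cos (Real.pi / ((d : ℝ) + 3)) := by
    intro k δ hk1 hk2 hδ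
    have hk2' : 2 * k ≤ (d : ℤ) + 2 := by omega
    have hk1r : (1 : ℝ) ≤ k := by exact_mod_cast hk1
    have hk2r : (2 : ℝ) * k ≤ d + 2 := by exact_mod_cast hk2'
    obtain ⟨l1, l2⟩ := abs_le.mp hδ
    have f : 4 * Real.pi * k / ((d : ℝ) + 3) = (4 * k) * (Real.pi / ((d : ℝ) + 3)) := by ring
    have f2 : 2 * Real.pi = (2 * ((d : ℝ) + 3)) * (Real.pi / ((d : ℝ) + 3)) := by field_simp
    have hq : 0 < Real.pi / ((d : ℝ) + 3) := by positivity
    apply cos_le_cos_of_mem hq.le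
    · rw [f]; nlinarith
    · rw [f, f2]; nlinarith
  rcases lt_or_gt_of_ne h0 with hneg | hpos
  · rw [← Real.cos_neg]
    have := key (-h) (-ε) (by omega) (by rw [abs_of_neg hneg] at hh; omega) (by rwa [abs_neg])
    push_cast at this
    convert! this using 2
    ring
  · exact key h ε (by omega) (by rw [abs_of_pos hpos] at hh; omega) hε'

lemma norm_exp_neg_add (y θ : ℝ) :
    ‖Complex.exp (-((y : ℂ) + θ * Complex.I))‖ = Real.exp (-y) := by
  rw [Complex.norm_exp]; simp

lemma exp_neg_add_pow (y θ : ℝ) (k : ℕ) :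
    Complex.exp (-((y : ℂ) + θ * Complex.I)) ^ k =
      ((Real.exp (-(k * y)) : ℝ) : ℂ) * Complex.exp ((-(k * θ) : ℝ) * Complex.I) := by
  rw [← Complex.exp_nat_mul, Complex.ofReal_exp, ← Complex.exp_add]
  congr 1; push_cast; ring

lemma exp_neg_add_pow_re (y θ : ℝ) (k : ℕ) :
    (Complex.exp (-((y : ℂ) + θ * Complex.I)) ^ k).re =
      Real.exp (-(k * y)) * Real.cos (k * θ) := by
  rw [exp_neg_add_pow, Complex.re_ofReal_mul, Complex.exp_ofReal_mul_I_re, Real.cos_neg]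

/-- The loss off the real axis when `θ` is at distance at least `y` from the multiples of `2π / D`:
there the modulus of the geometric series itself drops by a constant factor. -/
lemma loss_lower_of_far {d : ℕ} (hd : 4 ≤ d) {y θ η : ℝ} {h : ℤ} (hy : 0 < y)
    (hDy : ((d : ℝ) + 3) * y ≤ 1 / 100) (hη : η = θ - 2 * Real.pi * h / ((d : ℝ) + 3))
    (hDη : ((d : ℝ) + 3) * |η| ≤ Real.pi) (hc : y ≤ |η|) {L : ℝ}
    (hL : HasSum (fun j : ℕ => ‖Complex.exp (-(y + θ * Complex.I))‖ ^ ((d + 3) * j + 2) -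
      (Complex.exp (-(y + θ * Complex.I)) ^ ((d + 3) * j + 2)).re) L) :
    1 / (((d : ℝ) + 3) ^ 4 * y) ≤ L := by
  have hd' : (4 : ℝ) ≤ d := by exact_mod_cast hd
  have hD : (0 : ℝ) < (d : ℝ) + 3 := by positivity
  have hpi := Real.pi_pos
  have hpi3 := Real.pi_gt_three
  have hτ : 0 < ((y : ℂ) + θ * Complex.I).re := by simpa using hy
  have hnorm := norm_exp_neg_add y θ
  have hpow := exp_neg_add_pow y θ
  rw [← (hasSum_loss d hτ).unique hL]
  set x := Real.exp (-(((d : ℝ) + 3) * y)) with hx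
  have hx1 : 1 - ((d : ℝ) + 3) * y ≤ x := by
    have := Real.add_one_le_exp (-(((d : ℝ) + 3) * y)); linarith
  have hxlt : x < 1 := by
    rw [hx, Real.exp_lt_one_iff]; have := mul_pos hD hy; linarith
  have hx0 : 0 < x := Real.exp_pos _
  have en : ‖Complex.exp (-((y : ℂ) + θ * Complex.I))‖ ^ (d + 3) = x := by
    rw [hnorm, ← Real.exp_nat_mul, hx]; congr 1; push_cast; ring
  have ecos : Real.cos (((d : ℝ) + 3) * θ) = Real.cos (((d : ℝ) + 3) * η) := by
    have : ((d : ℝ) + 3) * θ = ((d : ℝ) + 3) * η + (h : ℝ) * (2 * Real.pi) := by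
      rw [hη]; field_simp; ring
    rw [this, Real.cos_add_int_mul_two_pi]
  have hcos := Real.cos_le_one_sub_mul_cos_sq (x := ((d : ℝ) + 3) * η) (by
    rw [abs_mul, abs_of_pos hD]; exact hDη)
  have hsq : ‖1 - Complex.exp (-((y : ℂ) + θ * Complex.I)) ^ (d + 3)‖ ^ 2 =
      (1 - x) ^ 2 + 2 * x * (1 - Real.cos (((d : ℝ) + 3) * η)) := by
    have e0 : Complex.exp (-((y : ℂ) + θ * Complex.I)) ^ (d + 3) =
        ((x * Real.cos (((d : ℝ) + 3) * θ) : ℝ) : ℂ) +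
          ((-(x * Real.sin (((d : ℝ) + 3) * θ)) : ℝ) : ℂ) * Complex.I := by
      rw [hpow, hx, Complex.exp_mul_I]
      push_cast
      rw [Complex.cos_neg, Complex.sin_neg]
      ring
    rw [e0, Complex.sq_norm, Complex.normSq_apply]
    simp only [Complex.sub_re, Complex.sub_im, Complex.add_re, Complex.add_im, Complex.one_re,
      Complex.one_im, Complex.ofReal_re, Complex.ofReal_im, Complex.mul_re, Complex.mul_im,
      Complex.I_re, Complex.I_im]
    rw [← ecos]
    have := Real.sin_sq_add_cos_sq (((d : ℝ) + 3) * θ)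
    linear_combination x ^ 2 * this
  have hlow : (11 / 10 * (1 - x)) ^ 2 ≤
      ‖1 - Complex.exp (-((y : ℂ) + θ * Complex.I)) ^ (d + 3)‖ ^ 2 := by
    rw [hsq]
    have b1 : 1 - x ≤ ((d : ℝ) + 3) * y := by linarith
    have b2 : (1 - x) ^ 2 ≤ (((d : ℝ) + 3) * η) ^ 2 := by
      rw [mul_pow, ← sq_abs η, ← mul_pow]
      have : ((d : ℝ) + 3) * y ≤ ((d : ℝ) + 3) * |η| := by gcongr
      exact pow_le_pow_left₀ (by linarith) (by linarith) 2
    have b3 : 1 / 5 * (((d : ℝ) + 3) * η) ^ 2 ≤ 1 - Real.cos (((d : ℝ) + 3) * η) := by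
      have : (1 : ℝ) / 5 ≤ 2 / Real.pi ^ 2 := by
        rw [div_le_div_iff₀ (by norm_num) (by positivity)]
        have := Real.pi_lt_d2; nlinarith
      have := mul_le_mul_of_nonneg_right this (sq_nonneg (((d : ℝ) + 3) * η))
      linarith
    have b4 : 1 / 5 * (1 - x) ^ 2 ≤ 1 - Real.cos (((d : ℝ) + 3) * η) := by linarith
    have hx9 : (9 : ℝ) / 10 ≤ x := by linarith
    nlinarith [sq_nonneg (1 - x)]
  have hlow' : 11 / 10 * (1 - x) ≤ ‖1 - Complex.exp (-((y : ℂ) + θ * Complex.I)) ^ (d + 3)‖ :=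
    le_of_sq_le_sq hlow (norm_nonneg _)
  have hre : (Complex.exp (-((y : ℂ) + θ * Complex.I)) ^ 2 /
      (1 - Complex.exp (-((y : ℂ) + θ * Complex.I)) ^ (d + 3))).re ≤
      Real.exp (-y) ^ 2 / (11 / 10 * (1 - x)) := by
    refine (Complex.re_le_norm _).trans ?_
    rw [norm_div, norm_pow, hnorm]
    have : 0 < 1 - x := by linarith
    gcongr
  rw [en, hnorm]
  have hx' : 0 < 1 - x := by linarith
  have e2 : Real.exp (-y) ^ 2 / (11 / 10 * (1 - x)) =
      10 / 11 * (Real.exp (-y) ^ 2 / (1 - x)) := by field_simp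
  have b5 : 9 / 10 / (((d : ℝ) + 3) * y) ≤ Real.exp (-y) ^ 2 / (1 - x) := by
    have : 9 / 10 ≤ Real.exp (-y) ^ 2 := by
      rw [← Real.exp_nat_mul]
      have := Real.add_one_le_exp (((2 : ℕ) : ℝ) * -y)
      push_cast at this ⊢
      nlinarith
    gcongr
    linarith
  have b6 : 1 / (((d : ℝ) + 3) ^ 4 * y) ≤ 1 / 11 * (9 / 10 / (((d : ℝ) + 3) * y)) := by
    rw [← div_div]
    have e3 : 1 / 11 * (9 / 10 / (((d : ℝ) + 3) * y)) = (9 / 110 / ((d : ℝ) + 3)) / y := by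
      field_simp; norm_num
    rw [e3]
    refine div_le_div_of_nonneg_right ?_ hy.le
    rw [div_le_div_iff₀ (by positivity) hD]
    have : (343 : ℝ) ≤ ((d : ℝ) + 3) ^ 3 := by
      have := pow_le_pow_left₀ (by norm_num) (show (7 : ℝ) ≤ (d : ℝ) + 3 by linarith) 3
      linarith
    have : ((d : ℝ) + 3) ^ 4 = ((d : ℝ) + 3) ^ 3 * ((d : ℝ) + 3) := by ring
    nlinarith
  linarith

/-- A single term of the loss when `θ` is close to `2π h / D`, `h ≠ 0`. -/
lemma loss_term_lower {d : ℕ} (hd : 4 ≤ d) (hd_even : Even d) {y θ η : ℝ} {h : ℤ} (hy : 0 < y)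
    (hθ : θ = 2 * Real.pi * h / ((d : ℝ) + 3) + η) (h0 : h ≠ 0) (hh2 : 2 * |h| < (d : ℤ) + 4)
    (hc : |η| < y) {j : ℕ} (hj : (j : ℝ) + 1 ≤ 3 / (((d : ℝ) + 3) ^ 2 * y)) :
    1 / 3 * (2 / ((d : ℝ) + 3) ^ 2) ≤
      ‖Complex.exp (-((y : ℂ) + θ * Complex.I))‖ ^ ((d + 3) * j + 2) -
        (Complex.exp (-((y : ℂ) + θ * Complex.I)) ^ ((d + 3) * j + 2)).re := by
  have hd' : (4 : ℝ) ≤ d := by exact_mod_cast hd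
  have hD : (0 : ℝ) < (d : ℝ) + 3 := by positivity
  have hpi := Real.pi_pos
  have hpi3 := Real.pi_gt_three
  have hlam : (((d : ℝ) + 3) * j + 2) * y ≤ 3 / ((d : ℝ) + 3) := by
    have c1 : ((d : ℝ) + 3) * j + 2 ≤ ((d : ℝ) + 3) * (j + 1) := by linarith
    have c2 : (j : ℝ) + 1 ≤ 3 / (((d : ℝ) + 3) ^ 2 * y) := hj
    calc (((d : ℝ) + 3) * j + 2) * y ≤
        (((d : ℝ) + 3) * (3 / (((d : ℝ) + 3) ^ 2 * y))) * y := by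
          gcongr; exact c1.trans (by gcongr)
      _ = _ := by field_simp
  have hcosle := cos_part_le hd_even h0 hh2 j (η := η) (by
    calc (((d : ℝ) + 3) * j + 2) * |η| ≤ (((d : ℝ) + 3) * j + 2) * y := by gcongr
      _ ≤ 3 / ((d : ℝ) + 3) := hlam
      _ ≤ _ := by gcongr)
  rw [← hθ] at hcosle
  have hcosD := Real.cos_le_one_sub_mul_cos_sq (x := Real.pi / ((d : ℝ) + 3)) (by
    rw [abs_of_pos (by positivity)]
    exact div_le_self hpi.le (by linarith))
  have e4 : 2 / Real.pi ^ 2 * (Real.pi / ((d : ℝ) + 3)) ^ 2 = 2 / ((d : ℝ) + 3) ^ 2 := by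
    field_simp
  rw [e4] at hcosD
  rw [exp_neg_add_pow_re, norm_exp_neg_add, ← Real.exp_nat_mul]
  have e5 : (((d + 3) * j + 2 : ℕ) : ℝ) = ((d : ℝ) + 3) * j + 2 := by push_cast; ring
  rw [e5, mul_neg]
  have hexp : 1 / 3 ≤ Real.exp (-((((d : ℝ) + 3) * j + 2) * y)) := by
    have c3 : 3 / ((d : ℝ) + 3) ≤ 3 / 7 := by gcongr; linarith
    have := Real.add_one_le_exp (-((((d : ℝ) + 3) * j + 2) * y))
    linarith
  have e6 : Real.exp (-((((d : ℝ) + 3) * j + 2) * y)) -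
      Real.exp (-((((d : ℝ) + 3) * j + 2) * y)) * Real.cos ((((d : ℝ) + 3) * j + 2) * θ) =
      Real.exp (-((((d : ℝ) + 3) * j + 2) * y)) *
        (1 - Real.cos ((((d : ℝ) + 3) * j + 2) * θ)) := by ring
  rw [e6]
  exact mul_le_mul hexp (by linarith) (by positivity) (Real.exp_pos _).le

/-- The loss off the real axis when `θ` is close to `2π h / D`. Necessarily `h ≠ 0`, and the terms
with `D j y` at most `3 / D` suffice. -/
lemma loss_lower_of_near {d : ℕ} (hd : 4 ≤ d) (hd_even : Even d) {y θ η : ℝ} {h : ℤ} (hy : 0 < y)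
    (hDy : ((d : ℝ) + 3) * y ≤ 1 / 100) (hD2y : ((d : ℝ) + 3) ^ 2 * y ≤ 1)
    (hη : η = θ - 2 * Real.pi * h / ((d : ℝ) + 3))
    (h1 : y ≤ |θ|) (h2 : |θ| ≤ Real.pi) (hc : |η| < y) {L : ℝ}
    (hL : HasSum (fun j : ℕ => ‖Complex.exp (-(y + θ * Complex.I))‖ ^ ((d + 3) * j + 2) -
      (Complex.exp (-(y + θ * Complex.I)) ^ ((d + 3) * j + 2)).re) L) :
    1 / (((d : ℝ) + 3) ^ 4 * y) ≤ L := by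
  have hd' : (4 : ℝ) ≤ d := by exact_mod_cast hd
  have hD : (0 : ℝ) < (d : ℝ) + 3 := by positivity
  have hpi := Real.pi_pos
  have hpi3 := Real.pi_gt_three
  have hθ : θ = 2 * Real.pi * h / ((d : ℝ) + 3) + η := by rw [hη]; ring
  have h0 : h ≠ 0 := by
    intro hz
    rw [hz] at hθ
    simp only [Int.cast_zero, mul_zero, zero_div, zero_add] at hθ
    rw [hθ] at h1
    linarith
  have hh2 : 2 * |h| < (d : ℤ) + 4 := by
    have b1 : |2 * Real.pi * h / ((d : ℝ) + 3)| ≤ Real.pi + y := by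
      have : 2 * Real.pi * h / ((d : ℝ) + 3) = θ - η := by rw [hη]; ring
      rw [this]
      exact (abs_sub _ _).trans (by linarith)
    rw [abs_div, abs_mul, abs_of_pos hD, abs_of_pos (by positivity : 0 < 2 * Real.pi),
      div_le_iff₀ hD] at b1
    have b2 : (2 : ℝ) * |(h : ℝ)| < d + 4 := by
      have : Real.pi * (2 * |(h : ℝ)|) < Real.pi * (d + 4) := by nlinarith
      exact lt_of_mul_lt_mul_left this hpi.le
    exact_mod_cast b2
  set J := ⌊3 / (((d : ℝ) + 3) ^ 2 * y)⌋₊ with hJ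
  have hq : 0 < ((d : ℝ) + 3) ^ 2 * y := by positivity
  have hJ1 : (J : ℝ) ≤ 3 / (((d : ℝ) + 3) ^ 2 * y) := Nat.floor_le (by positivity)
  have hJ2 : 2 / (((d : ℝ) + 3) ^ 2 * y) ≤ J := by
    have a1 := Nat.lt_floor_add_one (3 / (((d : ℝ) + 3) ^ 2 * y))
    rw [← hJ] at a1
    have a2 : 1 ≤ 1 / (((d : ℝ) + 3) ^ 2 * y) := by rw [le_div_iff₀ hq]; linarith
    have a3 : 3 / (((d : ℝ) + 3) ^ 2 * y) = 2 / (((d : ℝ) + 3) ^ 2 * y) +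
      1 / (((d : ℝ) + 3) ^ 2 * y) := by ring
    linarith
  have hterm : ∀ j ∈ Finset.range J, 1 / 3 * (2 / ((d : ℝ) + 3) ^ 2) ≤
      ‖Complex.exp (-((y : ℂ) + θ * Complex.I))‖ ^ ((d + 3) * j + 2) -
      (Complex.exp (-((y : ℂ) + θ * Complex.I)) ^ ((d + 3) * j + 2)).re := by
    intro j hj
    rw [Finset.mem_range] at hj
    have hjr : (j : ℝ) + 1 ≤ J := by exact_mod_cast hj
    exact loss_term_lower hd hd_even hy hθ h0 hh2 hc (hjr.trans hJ1)
  have hsum := sum_le_hasSum (Finset.range J) (fun j _ => by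
    rw [← norm_pow]; linarith [Complex.re_le_norm
      (Complex.exp (-((y : ℂ) + θ * Complex.I)) ^ ((d + 3) * j + 2))]) hL
  have hsum2 := Finset.card_nsmul_le_sum _ _ _ hterm
  rw [Finset.card_range, nsmul_eq_mul] at hsum2
  have : 1 / (((d : ℝ) + 3) ^ 4 * y) ≤ J * (1 / 3 * (2 / ((d : ℝ) + 3) ^ 2)) := by
    calc 1 / (((d : ℝ) + 3) ^ 4 * y) ≤ 4 / 3 * (1 / (((d : ℝ) + 3) ^ 4 * y)) := by
          have : 0 < 1 / (((d : ℝ) + 3) ^ 4 * y) := by positivity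
          linarith
      _ = 2 / (((d : ℝ) + 3) ^ 2 * y) * (1 / 3 * (2 / ((d : ℝ) + 3) ^ 2)) := by
          field_simp; norm_num
      _ ≤ _ := by gcongr
  linarith

/-- A lower bound for the loss off the real axis, on the whole circle outside the sector
`|θ| < y`. -/
lemma loss_lower {d : ℕ} (hd : 4 ≤ d) (hd_even : Even d) {y θ : ℝ} (hy : 0 < y)
    (hDy : ((d : ℝ) + 3) * y ≤ 1 / 100) (hD2y : ((d : ℝ) + 3) ^ 2 * y ≤ 1)
    (h1 : y ≤ |θ|) (h2 : |θ| ≤ Real.pi) {L : ℝ}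
    (hL : HasSum (fun j : ℕ => ‖Complex.exp (-(y + θ * Complex.I))‖ ^ ((d + 3) * j + 2) -
      (Complex.exp (-(y + θ * Complex.I)) ^ ((d + 3) * j + 2)).re) L) :
    1 / (((d : ℝ) + 3) ^ 4 * y) ≤ L := by
  have hD : (0 : ℝ) < (d : ℝ) + 3 := by positivity
  have hpi := Real.pi_pos
  set h : ℤ := round (((d : ℝ) + 3) * θ / (2 * Real.pi)) with hh
  have hDη : ((d : ℝ) + 3) * |θ - 2 * Real.pi * h / ((d : ℝ) + 3)| ≤ Real.pi := by
    have := abs_sub_round (((d : ℝ) + 3) * θ / (2 * Real.pi))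
    rw [← hh] at this
    have e : ((d : ℝ) + 3) * (θ - 2 * Real.pi * h / ((d : ℝ) + 3)) =
        (2 * Real.pi) * (((d : ℝ) + 3) * θ / (2 * Real.pi) - h) := by
      field_simp
    rw [← abs_of_pos hD, ← abs_mul, abs_of_pos hD, e, abs_mul,
      abs_of_pos (by positivity : 0 < 2 * Real.pi)]
    nlinarith
  rcases le_or_gt y |θ - 2 * Real.pi * h / ((d : ℝ) + 3)| with hc | hc
  · exact loss_lower_of_far hd hy hDy rfl hDη hc hL
  · exact loss_lower_of_near hd hd_even hy hDy hD2y rfl h1 h2 hc hL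

/-- Outside the sector `|Im τ| < Re τ` the generating function is exponentially smaller than on the
real axis. -/
theorem norm_genQ_minor_le {d : ℕ} (hd : 4 ≤ d) (hd_even : Even d) {y θ : ℝ} (hy : 0 < y)
    (hDy : ((d : ℝ) + 3) * y ≤ 1 / 100) (hD2y : ((d : ℝ) + 3) ^ 2 * y ≤ 1)
    (h1 : y ≤ |θ|) (h2 : |θ| ≤ Real.pi) :
    ‖genQ d (y + θ * Complex.I)‖ ≤
      ‖genQ d y‖ * Real.exp (-(1 / (((d : ℝ) + 3) ^ 4 * y))) := by
  have hτ : 0 < ((y : ℂ) + θ * Complex.I).re := by simpa using hy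
  have hL := hasSum_loss d hτ
  have := norm_genQ_le hd hτ hL
  have hre : (((y : ℂ) + θ * Complex.I).re) = y := by simp
  rw [hre] at this
  refine this.trans ?_
  gcongr
  exact loss_lower hd hd_even hy hDy hD2y h1 h2 hL

/-! ### The saddle point integral -/

lemma norm_genQ_term (d : ℕ) (y θ : ℝ) (k : ℕ) :
    ‖(Q d 2 k : ℂ) * Complex.exp (-((y : ℂ) + θ * Complex.I)) ^ k‖ =
      Q d 2 k * Real.exp (-y) ^ k := by
  rw [norm_mul, norm_pow, norm_exp_neg_add, Complex.norm_natCast]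

lemma summable_Q (d : ℕ) {y : ℝ} (hy : 0 < y) :
    Summable fun k => (Q d 2 k : ℝ) * Real.exp (-y) ^ k := by
  refine (summable_genQ d (τ := (y : ℂ) + (0 : ℝ) * Complex.I) (by simpa using hy)).congr fun k => ?_
  exact norm_genQ_term d y 0 k

lemma continuous_genQ (d : ℕ) {y : ℝ} (hy : 0 < y) :
    Continuous fun θ : ℝ => genQ d (y + θ * Complex.I) := by
  unfold genQ
  refine continuous_tsum (fun k => by fun_prop) (summable_Q d hy) fun k θ => ?_
  rw [norm_genQ_term]

lemma integral_exp_int_mul (j : ℤ) :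
    ∫ θ in (-Real.pi)..Real.pi, Complex.exp (((j : ℂ) * Complex.I) * θ) =
      if j = 0 then 2 * (Real.pi : ℂ) else 0 := by
  split_ifs with h
  · subst h; simp; ring
  · have hc : (j : ℂ) * Complex.I ≠ 0 := mul_ne_zero (by exact_mod_cast h) Complex.I_ne_zero
    rw [integral_exp_mul_complex hc, div_eq_zero_iff]
    left
    have e : (j : ℂ) * Complex.I * (Real.pi : ℝ) =
        (j : ℂ) * Complex.I * ((-Real.pi : ℝ) : ℂ) + j * (2 * Real.pi * Complex.I) := by
      push_cast; ring
    rw [e, Complex.exp_add, Complex.exp_int_mul_two_pi_mul_I]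
    ring

/-- Cauchy's formula for the coefficients of the generating function. -/
theorem integral_genQ (d n : ℕ) {y : ℝ} (hy : 0 < y) :
    ∫ θ in (-Real.pi)..Real.pi,
      genQ d (y + θ * Complex.I) * Complex.exp (n * (y + θ * Complex.I)) =
      2 * Real.pi * Q d 2 n := by
  have h := intervalIntegral.hasSum_integral_of_dominated_convergence
    (μ := MeasureTheory.volume) (a := -Real.pi) (b := Real.pi)
    (F := fun k θ => (Q d 2 k : ℂ) * Complex.exp (-((y : ℂ) + θ * Complex.I)) ^ k *
      Complex.exp (n * (y + θ * Complex.I)))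
    (f := fun θ => genQ d (y + θ * Complex.I) * Complex.exp (n * (y + θ * Complex.I)))
    (fun k _ => (Q d 2 k : ℝ) * Real.exp (-y) ^ k * Real.exp (n * y))
    (fun k => by
      apply Continuous.aestronglyMeasurable
      fun_prop)
    (fun k => Eventually.of_forall fun θ _ => by
      rw [norm_mul, norm_genQ_term, Complex.norm_exp]
      simp)
    (Eventually.of_forall fun θ _ => (summable_Q d hy).mul_right _)
    (by simp)
    (Eventually.of_forall fun θ _ =>
      (summable_genQ d (τ := (y : ℂ) + θ * Complex.I) (by simpa using hy)).of_norm.hasSum.mul_right _)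
  refine h.unique ?_
  have hterm : ∀ k : ℕ, ∫ θ in (-Real.pi)..Real.pi,
      (Q d 2 k : ℂ) * Complex.exp (-((y : ℂ) + θ * Complex.I)) ^ k *
        Complex.exp (n * (y + θ * Complex.I)) =
      if k = n then 2 * Real.pi * (Q d 2 n : ℂ) else 0 := by
    intro k
    have e : ∀ θ : ℝ, (Q d 2 k : ℂ) * Complex.exp (-((y : ℂ) + θ * Complex.I)) ^ k *
        Complex.exp (n * (y + θ * Complex.I)) =
        ((Q d 2 k : ℂ) * Complex.exp (((n : ℂ) - k) * y)) *
          Complex.exp (((((n : ℤ) - k : ℤ) : ℂ) * Complex.I) * θ) := by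
      intro θ
      rw [← Complex.exp_nat_mul, mul_assoc, mul_assoc, ← Complex.exp_add, ← Complex.exp_add]
      congr 2; push_cast; ring
    simp_rw [e]
    rw [intervalIntegral.integral_const_mul, integral_exp_int_mul]
    rcases eq_or_ne k n with rfl | hk
    · simp; ring
    · rw [if_neg (by omega), if_neg hk, mul_zero]
  simp_rw [hterm]
  simpa using hasSum_ite_eq n (2 * Real.pi * (Q d 2 n : ℂ))

lemma cube_sq_le_exp {s : ℝ} (hs : 0 ≤ s) : s ^ 3 / 2 + s ^ 2 ≤ 224 * Real.exp (s / 4) := by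
  have h3 := Real.pow_div_factorial_le_exp (s / 4) (by positivity) 3
  have h2 := Real.pow_div_factorial_le_exp (s / 4) (by positivity) 2
  norm_num [Nat.factorial] at h3 h2
  nlinarith

/-- The real part of the integrand at the saddle point, compared with the Gaussian. Taking real
parts removes the cubic term of the phase, so that the error is of relative size `1 / m`. -/
lemma abs_saddle_sub_gaussian_le {m u : ℝ} (hm : 0 < m) (hu : |u| ≤ 1) :
    |Real.exp (-(m * u ^ 2 / (1 + u ^ 2))) * Real.cos (m * u ^ 3 / (1 + u ^ 2)) -
      Real.exp (-(m * u ^ 2))| ≤ 224 / m * Real.exp (-(m * u ^ 2 / 4)) := by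
  have hu2 : u ^ 2 ≤ 1 := by rwa [sq_le_one_iff_abs_le_one]
  have hden : 0 < 1 + u ^ 2 := by positivity
  set s := m * u ^ 2 with hs
  have hs0 : 0 ≤ s := by positivity
  set a := s / (1 + u ^ 2) with ha
  set b := m * u ^ 3 / (1 + u ^ 2) with hb
  have ha2 : s / 2 ≤ a := by rw [ha]; gcongr; linarith
  have has : s - a ≤ m * u ^ 4 := by
    have : s - a = m * u ^ 4 / (1 + u ^ 2) := by rw [ha, hs]; field_simp; ring
    rw [this]; exact div_le_self (by positivity) (by nlinarith [sq_nonneg u])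
  have hb2 : b ^ 2 ≤ m ^ 2 * u ^ 6 := by
    have : b ^ 2 = m ^ 2 * u ^ 6 / (1 + u ^ 2) ^ 2 := by rw [hb, div_pow]; ring
    rw [this]
    exact div_le_self (by positivity) (one_le_pow₀ (by nlinarith [sq_nonneg u]))
  have hcos : |Real.cos b - 1| ≤ m ^ 2 * u ^ 6 / 2 := by
    have h1 := Real.one_sub_sq_div_two_le_cos (x := b)
    have h2 := Real.cos_le_one b
    rw [abs_of_nonpos (by linarith)]; linarith
  have hexp : |Real.exp (-a) - Real.exp (-s)| ≤ Real.exp (-a) * (m * u ^ 4) := by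
    have e : Real.exp (-s) = Real.exp (-a) * Real.exp (-(s - a)) := by
      rw [← Real.exp_add]; ring_nf
    have h1 := Real.add_one_le_exp (-(s - a))
    have h0 : 0 ≤ s - a := by
      rw [ha, sub_nonneg]; exact div_le_self hs0 (by nlinarith [sq_nonneg u])
    have h2 : Real.exp (-(s - a)) ≤ 1 := Real.exp_le_one_iff.mpr (by linarith)
    have h3 := Real.exp_pos (-a)
    rw [e, abs_of_nonneg (by nlinarith)]
    nlinarith
  have hE := Real.exp_pos (-a)
  calc |Real.exp (-a) * Real.cos b - Real.exp (-s)|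
      = |Real.exp (-a) * (Real.cos b - 1) + (Real.exp (-a) - Real.exp (-s))| := by ring_nf
    _ ≤ |Real.exp (-a) * (Real.cos b - 1)| + |Real.exp (-a) - Real.exp (-s)| := abs_add_le _ _
    _ ≤ Real.exp (-a) * (m ^ 2 * u ^ 6 / 2) + Real.exp (-a) * (m * u ^ 4) := by
        rw [abs_mul, abs_of_pos hE]; gcongr
    _ = Real.exp (-a) * ((s ^ 3 / 2 + s ^ 2) / m) := by rw [hs]; field_simp
    _ ≤ Real.exp (-(s / 2)) * ((224 * Real.exp (s / 4)) / m) := by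
        gcongr
        exact cube_sq_le_exp hs0
    _ = 224 / m * (Real.exp (-(s / 2)) * Real.exp (s / 4)) := by ring
    _ = _ := by rw [← Real.exp_add]; ring_nf

/-- Real part and modulus of the saddle point integrand `exp (m / (1 + i u) + m (1 + i u))`. -/
lemma saddle_integrand_eq {d : ℕ} {y m : ℝ} (hy : 0 < y) (hm : m = poleCoeff d / y) (u : ℝ) :
    Complex.exp (poleCoeff d * ((y : ℂ) * (1 + u * Complex.I))⁻¹) *
      Complex.exp (m * (1 + u * Complex.I)) =
    ((Real.exp (2 * m) * Real.exp (-(m * u ^ 2 / (1 + u ^ 2))) : ℝ) : ℂ) *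
      Complex.exp ((m * u ^ 3 / (1 + u ^ 2) : ℝ) * Complex.I) := by
  rw [← Complex.exp_add, ← Real.exp_add, Complex.ofReal_exp, ← Complex.exp_add]
  congr 1
  have h1 : (1 : ℂ) + u * Complex.I ≠ 0 := by
    intro h
    have := congrArg Complex.re h
    simp at this
  have h2 : (1 : ℂ) + u ^ 2 ≠ 0 := by
    have : (0 : ℝ) < 1 + u ^ 2 := by positivity
    exact_mod_cast this.ne'
  have h3 : ((1 : ℂ) + u * Complex.I)⁻¹ = (1 - u * Complex.I) / (1 + u ^ 2) := by
    rw [inv_eq_iff_eq_inv, inv_div, eq_div_iff (by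
      intro h
      have := congrArg Complex.re h
      simp at this)]
    linear_combination (-(u : ℂ) ^ 2) * Complex.I_sq
  have h4 : (y : ℂ) ≠ 0 := by exact_mod_cast hy.ne'
  rw [mul_inv, h3, hm]
  push_cast
  field_simp
  ring

lemma integrable_gaussian_div_four {m : ℝ} (hm : 0 < m) :
    MeasureTheory.Integrable fun u : ℝ => Real.exp (-(m * u ^ 2 / 4)) := by
  refine (integrable_exp_neg_mul_sq (b := m / 4) (by positivity)).congr ?_
  exact Eventually.of_forall fun u => by simp only; congr 1; ring

lemma integral_gaussian_div_four {m : ℝ} (hm : 0 < m) :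
    ∫ u : ℝ, Real.exp (-(m * u ^ 2 / 4)) = 2 * Real.sqrt (Real.pi / m) := by
  have : (fun u : ℝ => Real.exp (-(m * u ^ 2 / 4))) = fun u => Real.exp (-(m / 4) * u ^ 2) := by
    funext u; congr 1; ring
  rw [this, integral_gaussian]
  have : Real.pi / (m / 4) = 2 ^ 2 * (Real.pi / m) := by field_simp; norm_num
  rw [this, Real.sqrt_mul (by norm_num), Real.sqrt_sq (by norm_num)]

/-- A function on `[-1, 1]` that is pointwise close to `exp (2 m - m u²)` has integral close to the
complete Gaussian integral. -/
lemma abs_integral_sub_gaussian_le {m : ℝ} (hm : 1 ≤ m) {h : ℝ → ℝ} (hc : Continuous h)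
    (hh : ∀ u, |u| ≤ 1 → |h u - Real.exp (2 * m) * Real.exp (-(m * u ^ 2))| ≤
      Real.exp (2 * m) * (228 / m * Real.exp (-(m * u ^ 2 / 4)))) :
    |(∫ u in (-1 : ℝ)..1, h u) - Real.exp (2 * m) * Real.sqrt (Real.pi / m)| ≤
      456 / m * (Real.exp (2 * m) * Real.sqrt (Real.pi / m)) := by
  have hm0 : 0 < m := by linarith
  set h' : ℝ → ℝ := Set.indicator (Set.Ioc (-1) 1) h with hh'
  have hi' : MeasureTheory.Integrable h' :=
    (MeasureTheory.integrable_indicator_iff measurableSet_Ioc).mpr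
      (hc.integrableOn_Icc.mono_set Set.Ioc_subset_Icc_self)
  have hg : MeasureTheory.Integrable fun u : ℝ => Real.exp (2 * m) * Real.exp (-(m * u ^ 2)) := by
    have := (integrable_exp_neg_mul_sq hm0).const_mul (Real.exp (2 * m))
    simpa [neg_mul] using this
  have e1 : (∫ u in (-1 : ℝ)..1, h u) = ∫ u, h' u := by
    rw [intervalIntegral.integral_of_le (by norm_num), hh',
      MeasureTheory.integral_indicator measurableSet_Ioc]
  have e2 : Real.exp (2 * m) * Real.sqrt (Real.pi / m) =
      ∫ u : ℝ, Real.exp (2 * m) * Real.exp (-(m * u ^ 2)) := by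
    rw [MeasureTheory.integral_const_mul, ← integral_gaussian]
    simp only [neg_mul]
  have e3 : 456 / m * (Real.exp (2 * m) * Real.sqrt (Real.pi / m)) =
      ∫ u : ℝ, Real.exp (2 * m) * (228 / m * Real.exp (-(m * u ^ 2 / 4))) := by
    rw [MeasureTheory.integral_const_mul, MeasureTheory.integral_const_mul,
      integral_gaussian_div_four hm0]
    ring
  rw [e3, e1, e2, ← MeasureTheory.integral_sub hi' hg, ← Real.norm_eq_abs]
  refine MeasureTheory.norm_integral_le_of_norm_le
    (((integrable_gaussian_div_four hm0).const_mul _).const_mul _) (Eventually.of_forall fun u => ?_)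
  rw [Real.norm_eq_abs]
  by_cases hu : u ∈ Set.Ioc (-1 : ℝ) 1
  · rw [hh', Set.indicator_of_mem hu]
    exact hh u (abs_le.mpr ⟨hu.1.le, hu.2⟩)
  · rw [hh', Set.indicator_of_notMem hu, zero_sub, abs_neg, abs_of_pos (by positivity)]
    gcongr
    have hu1 : 1 ≤ u ^ 2 := by
      rw [Set.mem_Ioc, not_and_or] at hu
      rcases hu with h | h
      · nlinarith
      · nlinarith
    have e4 : Real.exp (-(m * u ^ 2)) =
        Real.exp (-(3 / 4 * (m * u ^ 2))) * Real.exp (-(m * u ^ 2 / 4)) := by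
      rw [← Real.exp_add]; ring_nf
    rw [e4]
    gcongr
    have h1 : Real.exp (-(3 / 4 * (m * u ^ 2))) ≤ Real.exp (-(3 / 4 * m)) := by
      apply Real.exp_le_exp.mpr; nlinarith
    have h2 : Real.exp (-(3 / 4 * m)) ≤ (3 / 4 * m)⁻¹ := by
      rw [Real.exp_neg]
      apply inv_anti₀ (by positivity)
      have := Real.add_one_le_exp (3 / 4 * m)
      linarith
    refine (h1.trans h2).trans ?_
    rw [inv_eq_one_div, div_le_div_iff₀ (by positivity) hm0]
    linarith

/-- The contribution of the sector `|θ| ≤ y`. -/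
lemma abs_major_sub_le {d n : ℕ} (hd : 4 ≤ d) {y m : ℝ} (hy : 0 < y)
    (hmy : m = poleCoeff d / y) (hny : n * y = m) (hm : 100 ≤ m) (hDm : (d : ℝ) + 3 ≤ m) :
    |(∫ θ in (-y)..y, 2 * Real.sin (2 * Real.pi / ((d : ℝ) + 3)) *
      (genQ d (y + θ * Complex.I) * Complex.exp (n * (y + θ * Complex.I))).re) -
      y * (Real.exp (2 * m) * Real.sqrt (Real.pi / m))| ≤
      y * (456 / m * (Real.exp (2 * m) * Real.sqrt (Real.pi / m))) := by
  set S := 2 * Real.sin (2 * Real.pi / ((d : ℝ) + 3)) with hS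
  have hm0 : 0 < m := by linarith
  set f : ℝ → ℝ := fun θ =>
    S * (genQ d (y + θ * Complex.I) * Complex.exp (n * (y + θ * Complex.I))).re with hf
  have hfc : Continuous f := by
    have := continuous_genQ d hy
    have h2 : Continuous fun θ : ℝ =>
        genQ d (y + θ * Complex.I) * Complex.exp (n * (y + θ * Complex.I)) :=
      this.mul (by fun_prop)
    exact continuous_const.mul (Complex.continuous_re.comp h2)
  have hsub : ∫ θ in (-y)..y, f θ = y * ∫ u in (-1 : ℝ)..1, f (y * u) := by
    have := intervalIntegral.mul_integral_comp_mul_left (f := f) (a := -1) (b := 1) y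
    rw [this]; simp
  have key := abs_integral_sub_gaussian_le (m := m) (by linarith)
    (h := fun u => f (y * u)) (by fun_prop) (fun u hu => ?_)
  · rw [hsub, ← mul_sub, abs_mul, abs_of_pos hy]
    gcongr
  · have hgen := norm_genQ_sub_le hd hy (by rw [← hmy]; exact hm) (by rw [← hmy]; exact hDm) hu
    set τ : ℂ := (y : ℂ) * (1 + u * Complex.I) with hτ
    have eτ : (y : ℂ) + ((y * u : ℝ) : ℂ) * Complex.I = τ := by rw [hτ]; push_cast; ring
    have enτ : (n : ℂ) * τ = m * (1 + u * Complex.I) := by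
      rw [hτ, ← hny]; push_cast; ring
    set X := Complex.exp (poleCoeff d * τ⁻¹) with hX
    set Y := Complex.exp (m * (1 + u * Complex.I)) with hY
    have hXY := saddle_integrand_eq hy hmy u
    rw [← hX, ← hY] at hXY
    have hnXY : ‖X‖ * ‖Y‖ = Real.exp (2 * m) * Real.exp (-(m * u ^ 2 / (1 + u ^ 2))) := by
      rw [← norm_mul, hXY, norm_mul, Complex.norm_exp_ofReal_mul_I, mul_one,
        Complex.norm_of_nonneg (by positivity)]
    have hreXY : (X * Y).re = Real.exp (2 * m) * (Real.exp (-(m * u ^ 2 / (1 + u ^ 2))) *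
        Real.cos (m * u ^ 3 / (1 + u ^ 2))) := by
      rw [hXY, Complex.re_ofReal_mul, Complex.exp_ofReal_mul_I_re, mul_assoc]
    have hfu : f (y * u) - (X * Y).re = ((genQ d τ * (S : ℂ) - X) * Y).re := by
      simp only [hf]
      rw [eτ, enτ, ← hY, ← Complex.re_ofReal_mul, ← Complex.sub_re]
      congr 1
      ring
    have hScast : (2 * (Real.sin (2 * Real.pi / ((d : ℝ) + 3)) : ℂ)) = (S : ℂ) := by
      rw [hS]; push_cast; rfl
    rw [hScast] at hgen
    have hdecay : Real.exp (-(m * u ^ 2 / (1 + u ^ 2))) ≤ Real.exp (-(m * u ^ 2 / 4)) := by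
      have hu2 : u ^ 2 ≤ 1 := by rwa [sq_le_one_iff_abs_le_one]
      apply Real.exp_le_exp.mpr
      apply neg_le_neg
      gcongr
      linarith
    have h1 : |f (y * u) - (X * Y).re| ≤
        Real.exp (2 * m) * (4 / m * Real.exp (-(m * u ^ 2 / 4))) := by
      rw [hfu]
      refine (Complex.abs_re_le_norm _).trans ?_
      rw [norm_mul]
      calc ‖genQ d τ * (S : ℂ) - X‖ * ‖Y‖ ≤ (4 * (poleCoeff d / y)⁻¹ * ‖X‖) * ‖Y‖ := by gcongr
        _ = 4 / m * (‖X‖ * ‖Y‖) := by rw [← hmy]; ring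
        _ = Real.exp (2 * m) * (4 / m * Real.exp (-(m * u ^ 2 / (1 + u ^ 2)))) := by
            rw [hnXY]; ring
        _ ≤ _ := by gcongr
    have h2 : |(X * Y).re - Real.exp (2 * m) * Real.exp (-(m * u ^ 2))| ≤
        Real.exp (2 * m) * (224 / m * Real.exp (-(m * u ^ 2 / 4))) := by
      rw [hreXY, ← mul_sub, abs_mul, abs_of_pos (Real.exp_pos _)]
      gcongr
      exact abs_saddle_sub_gaussian_le hm0 hu
    calc |f (y * u) - Real.exp (2 * m) * Real.exp (-(m * u ^ 2))|
        ≤ |f (y * u) - (X * Y).re| + |(X * Y).re - Real.exp (2 * m) * Real.exp (-(m * u ^ 2))| :=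
          abs_sub_le _ _ _
      _ ≤ _ := add_le_add h1 h2
      _ = _ := by ring

/-- A crude bound for the generating function on the positive axis. -/
lemma norm_genQ_real_le {d : ℕ} (hd : 4 ≤ d) {y m : ℝ} (hy : 0 < y)
    (hmy : m = poleCoeff d / y) (hm : 100 ≤ m) (hDm : (d : ℝ) + 3 ≤ m) :
    ‖genQ d y‖ * (2 * Real.sin (2 * Real.pi / ((d : ℝ) + 3))) ≤ 2 * Real.exp m := by
  have hgen := norm_genQ_sub_le hd hy (by rw [← hmy]; exact hm) (by rw [← hmy]; exact hDm)
    (u := 0) (by simp)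
  have hS := sin_pos_two_pi_div hd
  simp only [Complex.ofReal_zero, zero_mul, add_zero, mul_one] at hgen
  have e1 : (poleCoeff d : ℂ) * (y : ℂ)⁻¹ = (m : ℝ) := by rw [hmy]; push_cast; ring
  have e2 : ‖Complex.exp ((m : ℝ) : ℂ)‖ = Real.exp m := by rw [Complex.norm_exp]; simp
  rw [e1, e2, ← hmy] at hgen
  have h1 := norm_le_norm_add_norm_sub' (genQ d y * (2 * Real.sin (2 * Real.pi / ((d : ℝ) + 3)) : ℂ))
    (Complex.exp ((m : ℝ) : ℂ))
  rw [e2, norm_mul, norm_mul, Complex.norm_two, Complex.norm_real, Real.norm_of_nonneg hS.le] at h1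
  have h2 : 4 * m⁻¹ * Real.exp m ≤ Real.exp m := by
    have : m⁻¹ ≤ 1 / 100 := by rw [one_div]; exact inv_anti₀ (by norm_num) hm
    have := Real.exp_pos m
    nlinarith
  linarith

/-- The contribution of `y ≤ |θ| ≤ π`. -/
lemma norm_minor_le {d n : ℕ} (hd : 4 ≤ d) (hd_even : Even d) {y m : ℝ} (hy : 0 < y)
    (hmy : m = poleCoeff d / y) (hny : n * y = m) (hm : 100 ≤ m) (hDm : (d : ℝ) + 3 ≤ m)
    (hDy : ((d : ℝ) + 3) * y ≤ 1 / 100) (hD2y : ((d : ℝ) + 3) ^ 2 * y ≤ 1)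
    {θ : ℝ} (h1 : y ≤ |θ|) (h2 : |θ| ≤ Real.pi) :
    ‖2 * Real.sin (2 * Real.pi / ((d : ℝ) + 3)) *
      (genQ d (y + θ * Complex.I) * Complex.exp (n * (y + θ * Complex.I))).re‖ ≤
      2 * Real.exp (2 * m) * Real.exp (-(1 / (((d : ℝ) + 3) ^ 4 * y))) := by
  have hS := sin_pos_two_pi_div hd
  have h3 := norm_genQ_minor_le hd hd_even hy hDy hD2y h1 h2
  have h4 := norm_genQ_real_le hd hy hmy hm hDm
  have e1 : ‖Complex.exp (n * (y + θ * Complex.I))‖ = Real.exp m := by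
    rw [Complex.norm_exp, ← hny]; simp
  rw [norm_mul, Real.norm_of_nonneg (by positivity), Real.norm_eq_abs]
  calc 2 * Real.sin (2 * Real.pi / ((d : ℝ) + 3)) *
      |(genQ d (y + θ * Complex.I) * Complex.exp (n * (y + θ * Complex.I))).re|
      ≤ 2 * Real.sin (2 * Real.pi / ((d : ℝ) + 3)) *
        ((‖genQ d y‖ * Real.exp (-(1 / (((d : ℝ) + 3) ^ 4 * y)))) * Real.exp m) := by
        gcongr
        refine (Complex.abs_re_le_norm _).trans ?_
        rw [norm_mul, e1]
        gcongr
    _ = (‖genQ d y‖ * (2 * Real.sin (2 * Real.pi / ((d : ℝ) + 3)))) *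
        (Real.exp (-(1 / (((d : ℝ) + 3) ^ 4 * y))) * Real.exp m) := by ring
    _ ≤ (2 * Real.exp m) * (Real.exp (-(1 / (((d : ℝ) + 3) ^ 4 * y))) * Real.exp m) := by gcongr
    _ = _ := by
        have : Real.exp (2 * m) = Real.exp m * Real.exp m := by rw [← Real.exp_add]; ring_nf
        rw [this]; ring

/-- The asymptotic formula with an explicit error, once `y` is small enough in terms of `d`. -/
theorem abs_Q_sub_le {d n : ℕ} (hd : 4 ≤ d) (hd_even : Even d) {y m : ℝ} (hy : 0 < y)
    (hmy : m = poleCoeff d / y) (hny : n * y = m) (hm : 100 ≤ m) (hDm : (d : ℝ) + 3 ≤ m)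
    (hDy : ((d : ℝ) + 3) * y ≤ 1 / 100) (hD2y : ((d : ℝ) + 3) ^ 2 * y ≤ 1)
    (hmin : Real.exp (-(1 / (((d : ℝ) + 3) ^ 4 * y))) ≤ y ^ 3) :
    |2 * Real.pi * Q d 2 n * (2 * Real.sin (2 * Real.pi / ((d : ℝ) + 3))) -
      y * (Real.exp (2 * m) * Real.sqrt (Real.pi / m))| ≤
      500 / m * (y * (Real.exp (2 * m) * Real.sqrt (Real.pi / m))) := by
  have hpi := Real.pi_pos
  have hpi3 := Real.pi_gt_three
  have hD : (7 : ℝ) ≤ (d : ℝ) + 3 := by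
    have : (4 : ℝ) ≤ d := by exact_mod_cast hd
    linarith
  have hm0 : 0 < m := by linarith
  have hy1 : y ≤ 1 := by nlinarith
  set S := 2 * Real.sin (2 * Real.pi / ((d : ℝ) + 3)) with hS
  set f : ℝ → ℝ := fun θ =>
    S * (genQ d (y + θ * Complex.I) * Complex.exp (n * (y + θ * Complex.I))).re with hf
  have hgc : Continuous fun θ : ℝ =>
      genQ d (y + θ * Complex.I) * Complex.exp (n * (y + θ * Complex.I)) :=
    (continuous_genQ d hy).mul (by fun_prop)
  have hfc : Continuous f := continuous_const.mul (Complex.continuous_re.comp hgc)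
  have hfi : ∀ a b, IntervalIntegrable f MeasureTheory.volume a b :=
    fun a b => hfc.intervalIntegrable a b
  have htot : ∫ θ in (-Real.pi)..Real.pi, f θ = 2 * Real.pi * Q d 2 n * S := by
    have h := congrArg Complex.re (integral_genQ d n hy)
    rw [← Complex.reCLM_apply, ← ContinuousLinearMap.intervalIntegral_comp_comm _
      (hgc.intervalIntegrable _ _)] at h
    simp only [hf]
    rw [intervalIntegral.integral_const_mul]
    simp only [Complex.reCLM_apply] at h
    rw [h]
    have : (2 * (Real.pi : ℂ) * (Q d 2 n : ℂ)) = ((2 * Real.pi * Q d 2 n : ℝ) : ℂ) := by push_cast; rfl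
    rw [this, Complex.ofReal_re]; ring
  have hsplit : ∫ θ in (-Real.pi)..Real.pi, f θ = (∫ θ in (-Real.pi)..(-y), f θ) +
      (∫ θ in (-y)..y, f θ) + ∫ θ in y..Real.pi, f θ := by
    rw [intervalIntegral.integral_add_adjacent_intervals (hfi _ _) (hfi _ _),
      intervalIntegral.integral_add_adjacent_intervals (hfi _ _) (hfi _ _)]
  set M := 2 * Real.exp (2 * m) * Real.exp (-(1 / (((d : ℝ) + 3) ^ 4 * y))) with hM
  have hM0 : 0 < M := by positivity
  have hyp : y ≤ Real.pi := by linarith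
  have hl : |∫ θ in (-Real.pi)..(-y), f θ| ≤ M * Real.pi := by
    have := intervalIntegral.norm_integral_le_of_norm_le_const (f := f) (a := -Real.pi) (b := -y)
      (C := M) (fun θ hθ => by
        rw [Set.uIoc_of_le (by linarith)] at hθ
        refine norm_minor_le hd hd_even hy hmy hny hm hDm hDy hD2y ?_ ?_
        · rw [abs_of_nonpos (by linarith [hθ.2])]; linarith [hθ.2]
        · rw [abs_of_nonpos (by linarith [hθ.2])]; linarith [hθ.1])
    rw [Real.norm_eq_abs, abs_of_nonneg (by linarith : 0 ≤ -y - -Real.pi)] at this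
    exact this.trans (by gcongr; linarith)
  have hr : |∫ θ in y..Real.pi, f θ| ≤ M * Real.pi := by
    have := intervalIntegral.norm_integral_le_of_norm_le_const (f := f) (a := y) (b := Real.pi)
      (C := M) (fun θ hθ => by
        rw [Set.uIoc_of_le (by linarith)] at hθ
        refine norm_minor_le hd hd_even hy hmy hny hm hDm hDy hD2y ?_ ?_
        · rw [abs_of_nonneg (by linarith [hθ.1])]; linarith [hθ.1]
        · rw [abs_of_nonneg (by linarith [hθ.1])]; linarith [hθ.2])
    rw [Real.norm_eq_abs, abs_of_nonneg (by linarith : 0 ≤ Real.pi - y)] at this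
    exact this.trans (by gcongr; linarith)
  have hmaj := abs_major_sub_le hd hy hmy hny hm hDm
  rw [← hS] at hmaj
  -- the minor arcs are negligible because `m ≤ 1 / y`
  have hmy1 : m ≤ y⁻¹ := by
    rw [hmy, div_eq_mul_inv]
    have : poleCoeff d ≤ 1 := by
      unfold poleCoeff
      rw [div_le_one (by positivity)]
      have := Real.pi_lt_d2; nlinarith
    have hyi : 0 < y⁻¹ := by positivity
    nlinarith
  have hsq : y ≤ Real.sqrt (Real.pi / m) := by
    apply Real.le_sqrt_of_sq_le
    rw [le_div_iff₀ hm0]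
    have h1 : y * m ≤ 1 := by
      calc y * m ≤ y * y⁻¹ := by gcongr
        _ = 1 := by field_simp
    nlinarith
  have hym : y * m ≤ 1 := by
    calc y * m ≤ y * y⁻¹ := by gcongr
      _ = 1 := by field_simp
  have hminor : 2 * (M * Real.pi) ≤ y * (44 / m * (Real.exp (2 * m) * Real.sqrt (Real.pi / m))) := by
    have hE := Real.exp_pos (2 * m)
    have h1 : y ^ 3 ≤ y * (1 / m) * Real.sqrt (Real.pi / m) := by
      have h2 : y ≤ 1 / m := by rw [le_div_iff₀ hm0]; exact hym
      calc y ^ 3 = y * y * y := by ring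
        _ ≤ y * (1 / m) * Real.sqrt (Real.pi / m) := by gcongr
    have hpi4 := Real.pi_lt_four
    calc 2 * (M * Real.pi) = 4 * Real.pi * Real.exp (2 * m) *
          Real.exp (-(1 / (((d : ℝ) + 3) ^ 4 * y))) := by rw [hM]; ring
      _ ≤ 44 * Real.exp (2 * m) * y ^ 3 := by
          gcongr; linarith
      _ ≤ 44 * Real.exp (2 * m) * (y * (1 / m) * Real.sqrt (Real.pi / m)) := by gcongr
      _ = _ := by ring
  rw [← htot, hsplit]
  have e : ((∫ θ in (-Real.pi)..(-y), f θ) + (∫ θ in (-y)..y, f θ) + ∫ θ in y..Real.pi, f θ) -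
      y * (Real.exp (2 * m) * Real.sqrt (Real.pi / m)) =
      ((∫ θ in (-y)..y, f θ) - y * (Real.exp (2 * m) * Real.sqrt (Real.pi / m))) +
      (∫ θ in (-Real.pi)..(-y), f θ) + ∫ θ in y..Real.pi, f θ := by ring
  rw [e]
  refine (abs_add_three _ _ _).trans ?_
  have e2 : 500 / m * (y * (Real.exp (2 * m) * Real.sqrt (Real.pi / m))) =
      y * (456 / m * (Real.exp (2 * m) * Real.sqrt (Real.pi / m))) +
      y * (44 / m * (Real.exp (2 * m) * Real.sqrt (Real.pi / m))) := by ring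
  rw [e2]
  linarith

/-! ### The constants of the error bounds -/

lemma xi_nonneg : 0 ≤ xi := by
  unfold xi
  have := Real.pi_pos
  exact mul_nonneg (by positivity) (MeasureTheory.integral_nonneg fun _ => norm_nonneg _)

lemma poleCoeff_le_one {d : ℕ} (hd : 4 ≤ d) : poleCoeff d ≤ 1 := by
  have hd' : (4 : ℝ) ≤ d := by exact_mod_cast hd
  have := Real.pi_pos
  unfold poleCoeff
  rw [div_le_one (by positivity)]
  have := Real.pi_lt_d2; nlinarith

lemma c10_lower {d : ℕ} (hd : 4 ≤ d) {δ : ℝ} (hδ : 0 < δ) :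
    2 * Real.pi * Real.sqrt (poleCoeff d) ≤ c10 d δ := by
  have := Real.pi_pos
  have h := Real.rpow_le_rpow_of_exponent_ge (poleCoeff_pos d) (poleCoeff_le_one hd)
    (show (3 / 2 - δ / 4) - 1 ≤ 1 / 2 by linarith)
  rw [← Real.sqrt_eq_rpow] at h
  unfold c10
  rw [← poleCoeff]
  gcongr

lemma c10_pos (d : ℕ) (δ : ℝ) : 0 < c10 d δ := by
  have := Real.pi_pos
  unfold c10; positivity

lemma c10_pow_lower {d : ℕ} (hd : 4 ≤ d) {δ : ℝ} (hδ : 0 < δ) :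
    16000 / ((d : ℝ) + 3) ^ 2 ≤ c10 d δ ^ 4 := by
  have hpi := Real.pi_pos
  have h := pow_le_pow_left₀ (by positivity) (c10_lower hd hδ) 4
  refine le_trans ?_ h
  have e : (2 * Real.pi * Real.sqrt (poleCoeff d)) ^ 4 =
      (16 / 9 * Real.pi ^ 8) / ((d : ℝ) + 3) ^ 2 := by
    have h2 : Real.sqrt (poleCoeff d) ^ 4 = poleCoeff d ^ 2 := by
      rw [show 4 = 2 * 2 by norm_num, pow_mul, Real.sq_sqrt (poleCoeff_pos d).le]
    rw [mul_pow, h2, poleCoeff]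
    field_simp; norm_num
  rw [e]
  gcongr
  have := pow_le_pow_left₀ (by norm_num) Real.pi_gt_d2.le 8
  norm_num at this ⊢
  linarith

lemma phiMax_pos (d : ℕ) (δ : ℝ) : 0 < phiMax d δ := by
  have := Real.pi_pos
  have := xi_nonneg
  unfold phiMax; positivity

lemma one_le_c6 (d : ℕ) (δ : ℝ) : 1 ≤ c6 d δ := by
  unfold c6
  rw [one_le_div (phiMax_pos d δ)]
  linarith [Real.add_one_le_exp (phiMax d δ)]

lemma c7_lower (d : ℕ) (δ : ℝ) : c6 d δ * c10 d δ ^ 3 ≤ c7 d δ := by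
  have := Real.pi_pos
  have := xi_nonneg
  have := one_le_c6 d δ
  unfold c7
  have : 0 ≤ xi * c6 d δ * (Real.pi ^ ((4 - 3 * δ) / 4) /
        ((2 : ℝ) ^ (3 * δ / 8) * (3 : ℝ) ^ ((2 - 3 * δ) / 4) *
          ((d : ℝ) + 3) ^ ((4 - 3 * δ) / 8))) := by positivity
  linarith

lemma c7_pos (d : ℕ) (δ : ℝ) : 0 < c7 d δ := by
  have := one_le_c6 d δ
  have := c10_pos d δ
  exact lt_of_lt_of_le (by positivity) (c7_lower d δ)

lemma sixty_le_phiMax {d : ℕ} (hd : 4 ≤ d) (hd8 : d ≤ 8) {δ : ℝ} (hδ : 0 < δ) :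
    60 ≤ phiMax d δ := by
  have hpi := Real.pi_pos
  have hd' : (4 : ℝ) ≤ d := by exact_mod_cast hd
  have hd8' : (d : ℝ) ≤ 8 := by exact_mod_cast hd8
  set D : ℝ := (d : ℝ) + 3 with hD
  have hD0 : 0 < D := by rw [hD]; positivity
  have hD11 : D ≤ 11 := by linarith
  have hx := xi_nonneg
  have h2 : 0 ≤ xi * (Real.pi ^ 2 / (2 * D)) ^ (1 / 4 : ℝ) := by positivity
  suffices 60 ≤ (2 : ℝ) ^ ((22 + 3 * δ) / 8) * Real.pi ^ ((22 - 3 * δ) / 4) /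
      (3 * D ^ ((10 - 3 * δ) / 8)) by
    unfold phiMax; rw [← hD]; linarith
  -- the expression is increasing in `δ` because `2 D ≥ π²`
  have e : (2 : ℝ) ^ ((22 + 3 * δ) / 8) * Real.pi ^ ((22 - 3 * δ) / 4) /
      (3 * D ^ ((10 - 3 * δ) / 8)) =
      ((2 : ℝ) ^ (11 / 4 : ℝ) * Real.pi ^ (11 / 2 : ℝ) / (3 * D ^ (5 / 4 : ℝ))) *
        (2 * D / Real.pi ^ 2) ^ (3 * δ / 8) := by
    rw [Real.div_rpow (by positivity) (by positivity), Real.mul_rpow (by norm_num) hD0.le,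
      ← Real.rpow_natCast_mul hpi.le,
      show (22 + 3 * δ) / 8 = 11 / 4 + 3 * δ / 8 by ring,
      show (22 - 3 * δ) / 4 = 11 / 2 - ((2 : ℕ) : ℝ) * (3 * δ / 8) by push_cast; ring,
      show (10 - 3 * δ) / 8 = 5 / 4 - 3 * δ / 8 by ring,
      Real.rpow_add (by norm_num), Real.rpow_sub hpi, Real.rpow_sub hD0]
    field_simp
  have h3 : 1 ≤ (2 * D / Real.pi ^ 2) ^ (3 * δ / 8) := by
    apply Real.one_le_rpow
    · rw [one_le_div (by positivity)]
      have := Real.pi_lt_d2; nlinarith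
    · positivity
  have h4 : 60 ≤ (2 : ℝ) ^ (11 / 4 : ℝ) * Real.pi ^ (11 / 2 : ℝ) / (3 * D ^ (5 / 4 : ℝ)) := by
    rw [le_div_iff₀ (by positivity)]
    have h5 : (60 * (3 * D ^ (5 / 4 : ℝ))) ^ 4 ≤
        ((2 : ℝ) ^ (11 / 4 : ℝ) * Real.pi ^ (11 / 2 : ℝ)) ^ 4 := by
      have p1 : (D ^ (5 / 4 : ℝ)) ^ 4 = D ^ 5 := by
        rw [← Real.rpow_mul_natCast hD0.le, ← Real.rpow_natCast]; norm_num
      have p2 : ((2 : ℝ) ^ (11 / 4 : ℝ)) ^ 4 = 2 ^ 11 := by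
        rw [← Real.rpow_mul_natCast (by norm_num), ← Real.rpow_natCast]; norm_num
      have p3 : (Real.pi ^ (11 / 2 : ℝ)) ^ 4 = Real.pi ^ 22 := by
        rw [← Real.rpow_mul_natCast hpi.le, ← Real.rpow_natCast]; norm_num
      rw [mul_pow, mul_pow, mul_pow, p1, p2, p3]
      have q1 : D ^ 5 ≤ 11 ^ 5 := pow_le_pow_left₀ hD0.le hD11 5
      have q2 : (3.1415 : ℝ) ^ 22 ≤ Real.pi ^ 22 :=
        pow_le_pow_left₀ (by norm_num) Real.pi_gt_d4.le 22
      calc (60 : ℝ) ^ 4 * (3 ^ 4 * D ^ 5) ≤ 60 ^ 4 * (3 ^ 4 * 11 ^ 5) := by gcongr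
        _ ≤ 2 ^ 11 * 3.1415 ^ 22 := by norm_num
        _ ≤ _ := by gcongr
    exact le_of_pow_le_pow_left₀ (by norm_num) (by positivity) h5
  rw [e]
  nlinarith

lemma exp_le_c6 {d : ℕ} (hd : 4 ≤ d) (hd8 : d ≤ 8) {δ : ℝ} (hδ : 0 < δ) :
    Real.exp 55 ≤ c6 d δ := by
  have h := sixty_le_phiMax hd hd8 hδ
  unfold c6
  generalize phiMax d δ = x at *
  rw [le_div_iff₀ (by linarith)]
  -- write `exp x = exp 55 * exp 5 * exp (x - 60)` and compare with a linear function
  have h1 : Real.exp x = Real.exp 55 * (Real.exp 5 * Real.exp (x - 60)) := by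
    rw [← Real.exp_add, ← Real.exp_add]; ring_nf
  have h2 : (64 : ℝ) ≤ Real.exp 5 := by
    have : Real.exp 5 = Real.exp 1 ^ 5 := by rw [← Real.exp_nat_mul]; norm_num
    rw [this]
    have := pow_le_pow_left₀ (by norm_num) Real.exp_one_gt_d9.le 5
    norm_num at this ⊢
    linarith
  have h3 := Real.add_one_le_exp (x - 60)
  have h4 := Real.one_le_exp (show (0 : ℝ) ≤ 55 by norm_num)
  have h5 : 64 * (x - 59) ≤ Real.exp 5 * Real.exp (x - 60) := by
    have : 0 ≤ x - 59 := by linarith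
    have h6 : x - 59 ≤ Real.exp (x - 60) := by linarith
    exact mul_le_mul h2 h6 this (Real.exp_pos _).le
  rw [h1]
  nlinarith

lemma one_sub_cos_pos {x : ℝ} (h0 : 0 < x) (h1 : x ≤ Real.pi) : 0 < 1 - Real.cos x := by
  have := Real.cos_lt_cos_of_nonneg_of_le_pi le_rfl h1 h0
  rw [Real.cos_zero] at this
  linarith

lemma c2_pos {d : ℕ} (hd : 4 ≤ d) : 0 < c2 d := by
  have hd' : (4 : ℝ) ≤ d := by exact_mod_cast hd
  have hpi := Real.pi_pos
  have hpi4 := Real.pi_lt_four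
  have hE : 1 < Real.exp (((d : ℝ) + 3) * Real.pi) := Real.one_lt_exp_iff.mpr (by positivity)
  have hE0 : 0 < Real.exp (((d : ℝ) + 3) * Real.pi) - 1 := by linarith
  have hc : 0 < 1 - Real.cos (2 * Real.pi / ((d : ℝ) + 5)) := by
    apply one_sub_cos_pos (by positivity)
    rw [div_le_iff₀ (by positivity)]
    nlinarith
  have h1 : 0 < b1 d := by unfold b1; positivity
  have h2 : 0 < b2 d := by
    have e1 : Real.exp ((3 * (d : ℝ) + 7) * Real.pi) =
        Real.exp ((2 * (d : ℝ) + 4) * Real.pi) * Real.exp (((d : ℝ) + 3) * Real.pi) := by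
      rw [← Real.exp_add]; ring_nf
    have e2 : Real.exp (((d : ℝ) + 5) * Real.pi) =
        Real.exp (2 * Real.pi) * Real.exp (((d : ℝ) + 3) * Real.pi) := by
      rw [← Real.exp_add]; ring_nf
    have e3 : Real.exp (2 * Real.pi) < Real.exp ((2 * (d : ℝ) + 4) * Real.pi) :=
      Real.exp_lt_exp.mpr (by nlinarith)
    have : 0 < Real.exp ((3 * (d : ℝ) + 7) * Real.pi) + Real.exp (2 * Real.pi) -
        Real.exp ((2 * (d : ℝ) + 4) * Real.pi) - Real.exp (((d : ℝ) + 5) * Real.pi) := by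
      rw [e1, e2]; nlinarith
    unfold b2; positivity
  have h3 : 0 < b3 d := by
    have : 0 < 1 - Real.cos (((d : ℝ) + 3 - Real.pi) / ((d : ℝ) + 3) ^ 2) := by
      apply one_sub_cos_pos
      · have : 0 < (d : ℝ) + 3 - Real.pi := by linarith
        positivity
      · rw [div_le_iff₀ (by positivity)]
        have a := Real.pi_gt_three
        have b : (d : ℝ) + 3 ≤ ((d : ℝ) + 3) ^ 2 := by nlinarith
        nlinarith [sq_nonneg ((d : ℝ) + 3)]
    have hE' : 0 < Real.exp (Real.pi * ((d : ℝ) + 3)) - 1 := by rwa [mul_comm]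
    unfold b3; positivity
  have h4 : 0 < b4 d := by unfold b4; positivity
  exact lt_min (lt_min h1 h2) (lt_min h3 h4)

/-- For small `ymax` the constants `c4` and `c5` are positive: they tend to `2π⁴ / (3D)` and
`c2`. -/
lemma eventually_c4_c5_pos {d : ℕ} (hd : 4 ≤ d) {δ : ℝ} (hδ : 0 < δ) :
    ∀ᶠ ymax in 𝓝[>] (0 : ℝ), 0 < c4 d δ ymax ∧ 0 < c5 d ymax := by
  have hpi := Real.pi_pos
  have hp : ∀ s : ℝ, 0 < s → Tendsto (fun x : ℝ => x ^ s) (𝓝 0) (𝓝 0) := fun s hs => by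
    have := (Real.continuousAt_rpow_const 0 s (Or.inr hs.le)).tendsto
    rwa [Real.zero_rpow hs.ne'] at this
  have h4 : Tendsto (fun x => c4 d δ x) (𝓝 0) (𝓝 (2 * Real.pi ^ 4 / (3 * ((d : ℝ) + 3)))) := by
    have := (tendsto_const_nhds (x := 2 * Real.pi ^ 4 / (3 * ((d : ℝ) + 3)))).sub
      ((hp (δ / 2) (by linarith)).const_mul
        (Real.log (2 * Real.sin (2 * Real.pi / ((d : ℝ) + 3)))))
    have := this.sub ((hp ((1 + δ) / 2) (by linarith)).const_mul xi)
    simpa [c4] using this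
  have h5 : Tendsto (fun x => c5 d x) (𝓝 0) (𝓝 (c2 d)) := by
    have := (tendsto_const_nhds (x := c2 d)).add
      ((tendsto_id (α := ℝ) (x := 𝓝 0)).mul_const
        (Real.log (2 * Real.sin (2 * Real.pi / ((d : ℝ) + 3)))))
    have := this.sub ((hp (3 / 2) (by norm_num)).const_mul xi)
    simpa [c5] using this
  have e4 := h4.eventually (lt_mem_nhds
    (show 0 < 2 * Real.pi ^ 4 / (3 * ((d : ℝ) + 3)) by positivity))
  have e5 := h5.eventually (lt_mem_nhds (c2_pos hd))
  exact nhdsWithin_le_nhds (e4.and e5)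

lemma b4_le {d : ℕ} (hd : 10 ≤ d) : b4 d ≤ 26 * Real.exp (-(4 * ((d : ℝ) + 3))) := by
  have hd' : (10 : ℝ) ≤ d := by exact_mod_cast hd
  have hpi := Real.pi_gt_d2
  set D : ℝ := (d : ℝ) + 3 with hD
  have h1 : Real.exp (3 * D) ≤ Real.exp (D * Real.pi) - 1 := by
    have e : Real.exp (D * Real.pi) = Real.exp (3 * D) * Real.exp (D * (Real.pi - 3)) := by
      rw [← Real.exp_add]; ring_nf
    have a := Real.add_one_le_exp (D * (Real.pi - 3))
    have b : 2 ≤ Real.exp (D * (Real.pi - 3)) := by nlinarith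
    have c := Real.one_le_exp (show 0 ≤ 3 * D by linarith)
    rw [e]; nlinarith
  have h2 : Real.exp D ≤ (Real.exp (D / 2) - 1) ^ 2 + 4 * Real.exp (D / 2) := by
    have e : Real.exp D = Real.exp (D / 2) ^ 2 := by rw [← Real.exp_nat_mul]; congr 1; push_cast; ring
    rw [e]
    nlinarith [Real.exp_pos (D / 2)]
  unfold b4
  rw [← hD, Real.exp_neg, ← div_eq_mul_inv]
  have e : Real.exp (4 * D) = Real.exp (3 * D) * Real.exp D := by rw [← Real.exp_add]; ring_nf
  rw [e]
  have := Real.pi_lt_d2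
  have h3 : Real.exp (3 * D) * Real.exp D ≤ (Real.exp (D * Real.pi) - 1) *
      ((Real.exp (D / 2) - 1) ^ 2 + 4 * Real.exp (D / 2)) :=
    mul_le_mul h1 h2 (Real.exp_pos _).le ((Real.exp_pos _).le.trans h1)
  exact div_le_div₀ (by norm_num) (by linarith) (by positivity) h3

/-- For `D ≥ 13` the number `log (2 sin (2π / D))` is negative, so that positivity of `c5` forces
`ymax` to be exponentially small. -/
lemma le_exp_of_c5_pos {d : ℕ} (hd : 10 ≤ d) {y : ℝ} (hy : 0 < y) (h5 : 0 < c5 d y) :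
    y ≤ Real.exp (-(3 * ((d : ℝ) + 3))) := by
  have hd' : (10 : ℝ) ≤ d := by exact_mod_cast hd
  have hpi := Real.pi_pos
  have hpi2 := Real.pi_lt_d2
  have hb := b4_le hd
  have hS0 := sin_pos_two_pi_div (show 4 ≤ d by omega)
  have hS : Real.sin (2 * Real.pi / ((d : ℝ) + 3)) ≤ 2 * Real.pi / ((d : ℝ) + 3) :=
    Real.sin_le (by positivity)
  have hS2 : 2 * Real.pi / ((d : ℝ) + 3) ≤ 97 / 200 := by
    rw [div_le_div_iff₀ (by positivity) (by norm_num)]; nlinarith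
  have hlog := Real.log_le_sub_one_of_pos (show 0 < 2 * Real.sin (2 * Real.pi / ((d : ℝ) + 3)) by
    positivity)
  have hc : c2 d ≤ b4 d := (min_le_right _ _).trans (min_le_right _ _)
  have hx : 0 ≤ xi * y ^ (3 / 2 : ℝ) := mul_nonneg xi_nonneg (by positivity)
  unfold c5 at h5
  have h1 : 3 / 100 * y ≤ 26 * Real.exp (-(4 * ((d : ℝ) + 3))) := by nlinarith
  have e : Real.exp (-(3 * ((d : ℝ) + 3))) =
      Real.exp ((d : ℝ) + 3) * Real.exp (-(4 * ((d : ℝ) + 3))) := by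
    rw [← Real.exp_add]; ring_nf
  have h2 : (1000 : ℝ) ≤ Real.exp ((d : ℝ) + 3) := by
    have h3 : Real.exp 10 ≤ Real.exp ((d : ℝ) + 3) := Real.exp_le_exp.mpr (by linarith)
    have h4 : Real.exp 10 = Real.exp 1 ^ 10 := by rw [← Real.exp_nat_mul]; norm_num
    have h5 := pow_le_pow_left₀ (by norm_num) Real.exp_one_gt_d9.le 10
    norm_num at h5
    linarith
  rw [e]
  have := Real.exp_pos (-(4 * ((d : ℝ) + 3)))
  nlinarith

/-! ### Comparison with the error bounds -/

lemma saddle_pos (d : ℕ) {n : ℕ} (hn : 1 ≤ n) : 0 < saddle d n := by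
  have : (1 : ℝ) ≤ n := by exact_mod_cast hn
  have := Real.pi_pos
  unfold saddle; positivity

lemma saddle_sq (d : ℕ) {n : ℕ} (hn : 1 ≤ n) : saddle d n ^ 2 = poleCoeff d / n := by
  have : (1 : ℝ) ≤ n := by exact_mod_cast hn
  unfold saddle poleCoeff
  rw [div_pow, Real.sq_sqrt (by positivity), div_div]

lemma m_eq_div (d : ℕ) {n : ℕ} (hn : 1 ≤ n) : m d n = poleCoeff d / saddle d n := by
  have h0 := saddle_pos d hn
  have hn' : (1 : ℝ) ≤ n := by exact_mod_cast hn
  have h := saddle_sq d hn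
  rw [eq_div_iff h0.ne', m, mul_assoc, ← sq, h]
  field_simp

lemma m_pos (d : ℕ) {n : ℕ} (hn : 1 ≤ n) : 0 < m d n := by
  have : (1 : ℝ) ≤ n := by exact_mod_cast hn
  exact mul_pos (by linarith) (saddle_pos d hn)

lemma m_sq (d : ℕ) {n : ℕ} (hn : 1 ≤ n) : m d n ^ 2 = poleCoeff d * n := by
  have hn' : (1 : ℝ) ≤ n := by exact_mod_cast hn
  rw [m, mul_pow, saddle_sq d hn]; field_simp

lemma m_eq (d n : ℕ) :
    m d n = Real.pi * Real.sqrt n / Real.sqrt (3 * ((d : ℝ) + 3)) := by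
  rw [m, saddle, Real.sqrt_mul (by positivity)]
  rcases eq_or_ne n 0 with rfl | hn
  · simp
  · have hn' : (0 : ℝ) < n := by exact_mod_cast Nat.pos_of_ne_zero hn
    have h1 : 0 < Real.sqrt n := Real.sqrt_pos.mpr hn'
    have h2 : 0 < Real.sqrt (3 * ((d : ℝ) + 3)) := Real.sqrt_pos.mpr (by positivity)
    rw [mul_div_assoc', div_eq_div_iff (by positivity) (by positivity)]
    nth_rewrite 1 [← Real.sq_sqrt hn'.le]
    ring

lemma two_m_eq (d n : ℕ) :
    2 * Real.pi * Real.sqrt n / Real.sqrt (3 * ((d : ℝ) + 3)) = 2 * m d n := by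
  rw [m_eq]; ring

/-- Up to the factor `2π · 2 sin (2π / D)`, the main term is the Gaussian integral at the saddle
point. -/
lemma mainTerm_eq {d n : ℕ} (hd : 4 ≤ d) (hn : 1 ≤ n) :
    2 * Real.pi * mainTerm d n * (2 * Real.sin (2 * Real.pi / ((d : ℝ) + 3))) =
      saddle d n * (Real.exp (2 * m d n) * Real.sqrt (Real.pi / m d n)) := by
  have hn' : (0 : ℝ) < n := by exact_mod_cast hn
  have hpi := Real.pi_pos
  have hS := sin_pos_two_pi_div hd
  have hE : (0 : ℝ) < 3 * ((d : ℝ) + 3) := by positivity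
  have hsq : Real.sqrt (Real.pi / m d n) =
      (3 * ((d : ℝ) + 3)) ^ (1 / 4 : ℝ) * (n : ℝ) ^ (-(1 / 4) : ℝ) := by
    have e : Real.pi / m d n =
        ((3 * ((d : ℝ) + 3)) ^ (1 / 4 : ℝ) * (n : ℝ) ^ (-(1 / 4) : ℝ)) ^ 2 := by
      rw [m_eq, mul_pow, ← Real.rpow_mul_natCast hE.le, ← Real.rpow_mul_natCast hn'.le,
        Real.sqrt_eq_rpow, Real.sqrt_eq_rpow,
        show (1 / 4 : ℝ) * ((2 : ℕ) : ℝ) = 1 / 2 by norm_num,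
        show (-(1 / 4) : ℝ) * ((2 : ℕ) : ℝ) = -(1 / 2) by norm_num, Real.rpow_neg hn'.le]
      field_simp
    rw [e, Real.sqrt_sq (by positivity)]
  have hsad : saddle d n = Real.pi * ((3 * ((d : ℝ) + 3)) ^ (-(1 / 2) : ℝ) *
      (n : ℝ) ^ (-(1 / 2) : ℝ)) := by
    rw [saddle, Real.sqrt_mul hE.le, Real.sqrt_eq_rpow, Real.sqrt_eq_rpow, Real.rpow_neg hn'.le,
      Real.rpow_neg hE.le]
    field_simp
  rw [hsq, hsad, mainTerm, two_m_eq]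
  have e1 : (n : ℝ) ^ (-(3 / 4) : ℝ) = (n : ℝ) ^ (-(1 / 2) : ℝ) * (n : ℝ) ^ (-(1 / 4) : ℝ) := by
    rw [← Real.rpow_add hn']; norm_num
  have e2 : (3 * ((d : ℝ) + 3)) ^ (-(1 / 2) : ℝ) * (3 * ((d : ℝ) + 3)) ^ (1 / 4 : ℝ) =
      ((3 * ((d : ℝ) + 3)) ^ (1 / 4 : ℝ))⁻¹ := by
    rw [← Real.rpow_add hE, ← Real.rpow_neg hE.le]; norm_num
  calc _ = Real.pi * ((3 * ((d : ℝ) + 3)) ^ (1 / 4 : ℝ))⁻¹ * (n : ℝ) ^ (-(3 / 4) : ℝ) *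
        Real.exp (2 * m d n) := by field_simp; norm_num
    _ = _ := by rw [e1, ← e2]; ring

lemma mainTerm_pos {d n : ℕ} (hd : 4 ≤ d) (hn : 1 ≤ n) : 0 < mainTerm d n := by
  have hn' : (0 : ℝ) < n := by exact_mod_cast hn
  have hS := sin_pos_two_pi_div hd
  unfold mainTerm; positivity

/-- The second summand of `errorBound` alone is a lower bound, the other two being nonnegative
whatever the sign of `c3`. -/
lemma errorBound_ge {d n : ℕ} (hd : 4 ≤ d) (hn : 1 ≤ n) (δ ε ymax : ℝ) :
    m d n * Real.exp (2 * m d n) / (4 * Real.pi * n * Real.sin (2 * Real.pi / ((d : ℝ) + 3))) *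
      (2 * c10 d δ * c7 d δ * m d n ^ (δ - 1)) ≤ errorBound d δ ε ymax n := by
  have hn' : (0 : ℝ) < n := by exact_mod_cast hn
  have hpi := Real.pi_pos
  have hS := sin_pos_two_pi_div hd
  have hm := m_pos d hn
  unfold errorBound
  rw [mul_add]
  have h1 : 0 ≤ m d n * Real.exp (2 * m d n) /
      (4 * Real.pi * n * Real.sin (2 * Real.pi / ((d : ℝ) + 3))) *
      (2 / Real.sqrt (m d n) * Real.exp (-(c10 d δ * m d n ^ (δ / 4)))) := by positivity
  have h2 := Real.exp_pos (2 * m d n -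
      c3 d δ ε ymax * m d n ^ ε * (Real.pi ^ 2 / (3 * ((d : ℝ) + 3))) ^ (-ε))
  linarith

/-- The main term times `500 / m` is below `errorBound` as soon as `m` exceeds `D ^ 4 / 1000`: then
`500 √(π / m)` is at most `2 c10⁴`, which is at most `2 c10 c7`. -/
lemma mainTerm_mul_le_errorBound {d n : ℕ} (hd : 4 ≤ d) (hn : 1 ≤ n) {δ : ℝ} (hδ : 0 < δ)
    (ε ymax : ℝ) (hm1 : 1 ≤ m d n) (hm : ((d : ℝ) + 3) ^ 4 / 1000 ≤ m d n) :
    500 / m d n * mainTerm d n ≤ errorBound d δ ε ymax n := by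
  refine le_trans ?_ (errorBound_ge hd hn δ ε ymax)
  have hn' : (0 : ℝ) < n := by exact_mod_cast hn
  have hpi := Real.pi_pos
  have hS := sin_pos_two_pi_div hd
  have hm0 := m_pos d hn
  have hD : (0 : ℝ) < (d : ℝ) + 3 := by positivity
  have hmain := mainTerm_eq hd hn
  have hy : saddle d n = m d n / n := by rw [m]; field_simp
  have hmδ : 1 ≤ m d n ^ δ := Real.one_le_rpow hm1 hδ.le
  have hc : 16000 / ((d : ℝ) + 3) ^ 2 ≤ c10 d δ * c7 d δ := by
    have h10 := c10_pos d δ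
    calc 16000 / ((d : ℝ) + 3) ^ 2 ≤ c10 d δ ^ 4 := c10_pow_lower hd hδ
      _ = c10 d δ * (1 * c10 d δ ^ 3) := by ring
      _ ≤ c10 d δ * (c6 d δ * c10 d δ ^ 3) := by gcongr; exact one_le_c6 d δ
      _ ≤ _ := by gcongr; exact c7_lower d δ
  set S := Real.sin (2 * Real.pi / ((d : ℝ) + 3)) with hSdef
  set M := m d n with hM
  have e1 : mainTerm d n =
      M * Real.exp (2 * M) / (4 * Real.pi * n * S) * Real.sqrt (Real.pi / M) := by
    rw [hy] at hmain
    field_simp at hmain ⊢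
    linear_combination hmain
  have e2 : M ^ (δ - 1) = M ^ δ / M := by rw [Real.rpow_sub hm0, Real.rpow_one]
  have hsq : 500 * Real.sqrt (Real.pi / M) ≤ 32000 / ((d : ℝ) + 3) ^ 2 := by
    have h1 : Real.sqrt (Real.pi / M) ≤ 64 / ((d : ℝ) + 3) ^ 2 := by
      apply Real.sqrt_le_iff.mpr
      refine ⟨by positivity, ?_⟩
      rw [div_pow, div_le_div_iff₀ hm0 (by positivity)]
      have := Real.pi_lt_four
      have e3 : (((d : ℝ) + 3) ^ 2) ^ 2 = ((d : ℝ) + 3) ^ 4 := by ring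
      rw [e3]
      have h4 : 0 < ((d : ℝ) + 3) ^ 4 := by positivity
      nlinarith
    have : 32000 / ((d : ℝ) + 3) ^ 2 = 500 * (64 / ((d : ℝ) + 3) ^ 2) := by ring
    rw [this]; gcongr
  have e4 : 500 / M * mainTerm d n = M * Real.exp (2 * M) / (4 * Real.pi * n * S) *
      ((500 * Real.sqrt (Real.pi / M)) / M) := by rw [e1]; ring
  have h10 := c10_pos d δ
  have h7 := c7_pos d δ
  have hfin : 500 * Real.sqrt (Real.pi / M) ≤ 2 * c10 d δ * c7 d δ * M ^ δ := by
    have e5 : 32000 / ((d : ℝ) + 3) ^ 2 = 2 * (16000 / ((d : ℝ) + 3) ^ 2) := by ring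
    have h0 : 0 < 16000 / ((d : ℝ) + 3) ^ 2 := by positivity
    have h1 : c10 d δ * c7 d δ * 1 ≤ c10 d δ * c7 d δ * M ^ δ := by gcongr
    linarith
  have e6 : 2 * c10 d δ * c7 d δ * (M ^ δ / M) = 2 * c10 d δ * c7 d δ * M ^ δ / M := by ring
  rw [e4, e2, e6]
  exact mul_le_mul_of_nonneg_left (div_le_div_of_nonneg_right hfin hm0.le) (by positivity)

/-- The first summand of `errorBound'` exceeds the main term once `m ≥ 3`. -/
lemma mainTerm_le_errorBound' {d n : ℕ} (hd : 4 ≤ d) (hn : 1 ≤ n) {δ : ℝ} (hδ : 0 < δ)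
    (hδ' : δ < 2 / 3) (ε ymax : ℝ) (hm3 : 3 ≤ m d n) :
    mainTerm d n ≤ errorBound' d δ ε ymax n := by
  have hd' : (4 : ℝ) ≤ d := by exact_mod_cast hd
  have hn1 : (1 : ℝ) ≤ n := by exact_mod_cast hn
  have hn' : (0 : ℝ) < n := by linarith
  have hpi := Real.pi_pos
  have hpi1 : 1 ≤ Real.pi := by linarith [Real.pi_gt_three]
  have hS := sin_pos_two_pi_div hd
  have hm0 := m_pos d hn
  have hE : (0 : ℝ) < 3 * ((d : ℝ) + 3) := by positivity
  have hc7 := c7_pos d δ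
  set S := Real.sin (2 * Real.pi / ((d : ℝ) + 3)) with hSdef
  unfold errorBound'
  rw [← hSdef, two_m_eq]
  set t := (n : ℝ) ^ (-(δ / 8)) * 2 * Real.pi ^ (2 - δ / 4) *
          (3 * ((d : ℝ) + 3)) ^ (-2 + 3 * δ / 8) with ht
  have ht1 : t ≤ 1 := by
    have h1 : (n : ℝ) ^ (-(δ / 8)) ≤ 1 := Real.rpow_le_one_of_one_le_of_nonpos hn1 (by linarith)
    have h2 : Real.pi ^ (2 - δ / 4) ≤ 10 := by
      have : Real.pi ^ (2 - δ / 4) ≤ Real.pi ^ (2 : ℝ) :=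
        Real.rpow_le_rpow_of_exponent_le hpi1 (by linarith)
      rw [Real.rpow_two] at this
      have := Real.pi_lt_d2
      nlinarith
    have h3 : (3 * ((d : ℝ) + 3)) ^ (-2 + 3 * δ / 8) ≤ 1 / 21 := by
      have : (3 * ((d : ℝ) + 3)) ^ (-2 + 3 * δ / 8) ≤ (3 * ((d : ℝ) + 3)) ^ (-1 : ℝ) :=
        Real.rpow_le_rpow_of_exponent_le (by linarith) (by linarith)
      rw [Real.rpow_neg_one] at this
      refine this.trans ?_
      rw [one_div]
      exact inv_anti₀ (by norm_num) (by linarith)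
    calc t ≤ 1 * 2 * 10 * (1 / 21) := by rw [ht]; gcongr
      _ ≤ 1 := by norm_num
  set P := (n : ℝ) ^ (-(3 / 4) : ℝ) * (3 * ((d : ℝ) + 3)) ^ (-(1 / 4) : ℝ) with hP
  have hP0 : 0 < P := by positivity
  have e1 : mainTerm d n = P / (4 * S) * Real.exp (2 * m d n) := by
    rw [mainTerm, two_m_eq, hP, Real.rpow_neg hE.le, ← hSdef]
    field_simp
  have e2 : (n : ℝ) ^ (-(1 / 4) : ℝ) * (Real.pi ^ (1 / 2 : ℝ) *
      (3 * ((d : ℝ) + 3)) ^ (-(3 / 4) : ℝ) / (2 * S)) = P * m d n * (Real.pi ^ (1 / 2 : ℝ) /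
        Real.pi) / (2 * S) := by
    have a1 : (n : ℝ) ^ (-(1 / 4) : ℝ) = (n : ℝ) ^ (-(3 / 4) : ℝ) * Real.sqrt n := by
      rw [Real.sqrt_eq_rpow, ← Real.rpow_add hn']; norm_num
    have a2 : (3 * ((d : ℝ) + 3)) ^ (-(3 / 4) : ℝ) =
        (3 * ((d : ℝ) + 3)) ^ (-(1 / 4) : ℝ) / Real.sqrt (3 * ((d : ℝ) + 3)) := by
      rw [Real.sqrt_eq_rpow, ← Real.rpow_sub hE]; norm_num
    rw [a1, a2, hP, m_eq]
    field_simp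
  have h1 : P / (4 * S) ≤ (n : ℝ) ^ (-(1 / 4) : ℝ) * (Real.pi ^ (1 / 2 : ℝ) *
      (3 * ((d : ℝ) + 3)) ^ (-(3 / 4) : ℝ) / (2 * S)) * (1 / 3) := by
    rw [e2]
    have a3 : 1 / 2 ≤ Real.pi ^ (1 / 2 : ℝ) / Real.pi := by
      rw [← Real.sqrt_eq_rpow, Real.sqrt_div_self', div_le_div_iff₀ (by norm_num)
        (Real.sqrt_pos.mpr hpi), one_mul, one_mul]
      exact Real.sqrt_le_iff.mpr ⟨by norm_num, by linarith [Real.pi_lt_four]⟩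
    calc P / (4 * S) = P * 3 * (1 / 2) / (2 * S) * (1 / 3) := by field_simp; norm_num
      _ ≤ _ := by gcongr
  have h2 : Real.exp (2 * m d n) * (1 / 3) ≤ Real.exp (2 * m d n - t) := by
    rw [sub_eq_add_neg, Real.exp_add]
    gcongr
    have a4 : Real.exp (-1) ≤ Real.exp (-t) := Real.exp_le_exp.mpr (by linarith)
    have a5 : 1 / 3 ≤ Real.exp (-1) := by
      rw [Real.exp_neg, one_div]
      exact inv_anti₀ (Real.exp_pos _) (by linarith [Real.exp_one_lt_d9])
    linarith
  have h3 : mainTerm d n ≤ (n : ℝ) ^ (-(1 / 4) : ℝ) * (Real.pi ^ (1 / 2 : ℝ) *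
      (3 * ((d : ℝ) + 3)) ^ (-(3 / 4) : ℝ) / (2 * S)) * Real.exp (2 * m d n - t) := by
    rw [e1]
    calc P / (4 * S) * Real.exp (2 * m d n)
        ≤ ((n : ℝ) ^ (-(1 / 4) : ℝ) * (Real.pi ^ (1 / 2 : ℝ) *
          (3 * ((d : ℝ) + 3)) ^ (-(3 / 4) : ℝ) / (2 * S)) * (1 / 3)) * Real.exp (2 * m d n) := by
          gcongr
      _ = (n : ℝ) ^ (-(1 / 4) : ℝ) * (Real.pi ^ (1 / 2 : ℝ) *
          (3 * ((d : ℝ) + 3)) ^ (-(3 / 4) : ℝ) / (2 * S)) * (Real.exp (2 * m d n) * (1 / 3)) := by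
          ring
      _ ≤ _ := by gcongr
  have h4 : 0 ≤ (n : ℝ) ^ (-1 + δ / 2) * (c7 d δ * Real.pi ^ (1 + δ / 2) /
        ((3 * ((d : ℝ) + 3)) ^ 2 * S)) * Real.exp (2 * m d n) := by positivity
  have h5 := Real.exp_pos (2 * m d n -
      c3 d δ ε ymax * (n : ℝ) ^ (ε / 2) *
        (Real.pi ^ 2 / (3 * ((d : ℝ) + 3))) ^ (-(3 * ε / 2)))
  linarith

/-! ### Small `D` and moderate `n` -/

/-- A coefficient of the generating function is at most its value times `exp (n y)`. -/
lemma Q_le_norm_genQ (d n : ℕ) {y : ℝ} (hy : 0 < y) :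
    (Q d 2 n : ℝ) ≤ ‖genQ d y‖ * Real.exp (n * y) := by
  have hs := summable_Q d hy
  have h1 : genQ d y = ((∑' k, (Q d 2 k : ℝ) * Real.exp (-y) ^ k : ℝ) : ℂ) := by
    unfold genQ; push_cast; rfl
  have h2 : (Q d 2 n : ℝ) * Real.exp (-y) ^ n ≤ ‖genQ d y‖ := by
    rw [h1, Complex.norm_of_nonneg (tsum_nonneg fun k => by positivity)]
    exact hs.le_tsum n fun k _ => by positivity
  have e : (Q d 2 n : ℝ) = (Q d 2 n * Real.exp (-y) ^ n) * Real.exp (n * y) := by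
    rw [← Real.exp_nat_mul, mul_assoc, ← Real.exp_add]; simp
  rw [e]
  gcongr

/-- For `D ≤ 11` the transformation formula bounds `Q d 2 n` for every `n ≥ 1`. -/
lemma Q_le_of_small {d n : ℕ} (hd : 4 ≤ d) (hd8 : d ≤ 8) (hn : 1 ≤ n) :
    (Q d 2 n : ℝ) ≤ 5 * Real.exp (2 * m d n) := by
  have hd' : (4 : ℝ) ≤ d := by exact_mod_cast hd
  have hd8' : (d : ℝ) ≤ 8 := by exact_mod_cast hd8
  have hn1 : (1 : ℝ) ≤ n := by exact_mod_cast hn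
  have hpi := Real.pi_pos
  have hpi3 := Real.pi_gt_three
  have hy := saddle_pos d hn
  have hmy := m_eq_div d hn
  have hm0 := m_pos d hn
  have hA := poleCoeff_pos d
  have hA1 : 1 / 4 ≤ poleCoeff d := by
    unfold poleCoeff
    rw [div_le_div_iff₀ (by norm_num) (by positivity)]
    nlinarith
  have hm : 1 / 2 ≤ m d n := by
    have := m_sq d hn
    nlinarith
  have hy1 : saddle d n ≤ 1 := by
    have h1 := saddle_sq d hn
    have h2 : poleCoeff d / n ≤ 1 := (div_le_one (by linarith)).mpr
      ((poleCoeff_le_one hd).trans hn1)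
    nlinarith
  have hQ := Q_le_norm_genQ d n hy
  have hny : (n : ℝ) * saddle d n = m d n := rfl
  rw [hny] at hQ
  have hτ : 0 < ((saddle d n : ℝ) : ℂ).re := by simpa using hy
  obtain ⟨E₁, E₂, h1, h2, h⟩ := genQ_transformation hd hτ
  have hre : poleCoeff d * (((saddle d n : ℝ) : ℂ)⁻¹).re = m d n := by
    rw [← Complex.ofReal_inv, Complex.ofReal_re, hmy, div_eq_mul_inv]
  have hE1 : ‖E₁‖ ≤ 4 * Real.exp (-2) := by
    refine (h1.trans (two_mul_exp_neg_div_le (by nlinarith))).trans ?_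
    exact mul_le_mul_of_nonneg_left (Real.exp_le_exp.mpr (by nlinarith)) (by norm_num)
  have hE2 : ‖E₂‖ ≤ 4 * Real.exp (-6) := by
    refine (h2.trans (two_mul_exp_neg_div_le (by nlinarith))).trans ?_
    exact mul_le_mul_of_nonneg_left (Real.exp_le_exp.mpr (by nlinarith)) (by norm_num)
  have hx2 : Real.exp (-2) ≤ 1 / 7 := by
    rw [Real.exp_neg, one_div]
    apply inv_anti₀ (by norm_num)
    have e : Real.exp 2 = Real.exp 1 ^ 2 := by rw [← Real.exp_nat_mul]; norm_num
    rw [e]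
    nlinarith [Real.exp_one_gt_d9]
  have hx6 : Real.exp (-6) ≤ 1 / 343 := by
    have e : Real.exp (-6) = Real.exp (-2) ^ 3 := by rw [← Real.exp_nat_mul]; norm_num
    rw [e]
    have := pow_le_pow_left₀ (Real.exp_pos _).le hx2 3
    norm_num at this ⊢
    exact this
  have hS : 1 ≤ 2 * Real.sin (2 * Real.pi / ((d : ℝ) + 3)) := by
    have h3 : Real.sin (Real.pi / 6) ≤ Real.sin (2 * Real.pi / ((d : ℝ) + 3)) := by
      apply Real.sin_le_sin_of_le_of_le_pi_div_two
      · linarith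
      · rw [div_le_div_iff₀ (by positivity) (by norm_num)]; nlinarith
      · rw [div_le_div_iff₀ (by norm_num) (by positivity)]; nlinarith
    rw [Real.sin_pi_div_six] at h3
    linarith
  set S := 2 * Real.sin (2 * Real.pi / ((d : ℝ) + 3)) with hSdef
  have hScast : (2 * (Real.sin (2 * Real.pi / ((d : ℝ) + 3)) : ℂ)) = (S : ℂ) := by
    rw [hSdef]; push_cast; rfl
  rw [hScast] at h
  have hn1' : 49 / 50 ≤ ‖(S : ℂ) + E₂‖ := by
    have h4 := norm_sub_le_norm_add (S : ℂ) E₂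
    rw [Complex.norm_of_nonneg (by linarith)] at h4
    linarith
  have hn2 : ‖1 + E₁ / Real.sqrt 3‖ ≤ 8 / 5 := by
    have hs3 : 1 ≤ Real.sqrt 3 := Real.one_le_sqrt.mpr (by norm_num)
    have h5 : ‖E₁ / Real.sqrt 3‖ ≤ ‖E₁‖ := by
      rw [norm_div, Complex.norm_real, Real.norm_of_nonneg (by positivity)]
      exact div_le_self (norm_nonneg _) hs3
    have := norm_add_le (1 : ℂ) (E₁ / Real.sqrt 3)
    rw [norm_one] at this
    linarith
  have hn3 : ‖Complex.exp (poleCoeff d * ((saddle d n : ℝ) : ℂ)⁻¹ + kap d * (saddle d n : ℝ))‖ ≤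
      Real.exp (m d n) * (14 / 5) := by
    rw [Complex.norm_exp, Complex.add_re, Complex.re_ofReal_mul, hre, Complex.re_ofReal_mul,
      Complex.ofReal_re, Real.exp_add]
    gcongr
    have h6 : kap d * saddle d n ≤ 1 := by
      have := (le_abs_self _).trans (abs_kap_le hd)
      nlinarith
    have h7 := Real.exp_le_exp.mpr h6
    linarith [Real.exp_one_lt_d9]
  have hfin : ‖genQ d (saddle d n)‖ * (49 / 50) ≤ (Real.exp (m d n) * (14 / 5)) * (8 / 5) := by
    calc ‖genQ d (saddle d n)‖ * (49 / 50) ≤ ‖genQ d (saddle d n)‖ * ‖(S : ℂ) + E₂‖ := by gcongr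
      _ = ‖Complex.exp (poleCoeff d * ((saddle d n : ℝ) : ℂ)⁻¹ + kap d * (saddle d n : ℝ))‖ *
          ‖1 + E₁ / Real.sqrt 3‖ := by rw [← norm_mul, h, norm_mul]
      _ ≤ _ := by gcongr
  have hex := Real.exp_pos (m d n)
  have e2 : Real.exp (2 * m d n) = Real.exp (m d n) * Real.exp (m d n) := by
    rw [← Real.exp_add]; ring_nf
  rw [e2]
  have : ‖genQ d (saddle d n)‖ ≤ 5 * Real.exp (m d n) := by linarith
  calc (Q d 2 n : ℝ) ≤ ‖genQ d (saddle d n)‖ * Real.exp (m d n) := hQ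
    _ ≤ (5 * Real.exp (m d n)) * Real.exp (m d n) := by gcongr
    _ = _ := by ring

lemma mainTerm_le_of_small {d n : ℕ} (hd : 4 ≤ d) (hd8 : d ≤ 8) (hn : 1 ≤ n) :
    mainTerm d n ≤ 5 * Real.exp (2 * m d n) := by
  have hd8' : (d : ℝ) ≤ 8 := by exact_mod_cast hd8
  have hn1 : (1 : ℝ) ≤ n := by exact_mod_cast hn
  have hS := two_sin_lower hd
  have hS0 := sin_pos_two_pi_div hd
  have hS2 : 8 / 11 ≤ 8 / ((d : ℝ) + 3) := by gcongr; linarith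
  rw [mainTerm, two_m_eq]
  gcongr
  have h1 : (n : ℝ) ^ (-(3 / 4) : ℝ) ≤ 1 :=
    Real.rpow_le_one_of_one_le_of_nonpos hn1 (by norm_num)
  have h2 : 1 ≤ (3 * ((d : ℝ) + 3)) ^ (1 / 4 : ℝ) :=
    Real.one_le_rpow (by have : (0 : ℝ) ≤ d := d.cast_nonneg
                         linarith) (by norm_num)
  have h3 : 1 / (4 * (3 * ((d : ℝ) + 3)) ^ (1 / 4 : ℝ) *
      Real.sin (2 * Real.pi / ((d : ℝ) + 3))) ≤ 5 := by
    rw [div_le_iff₀ (by positivity)]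
    nlinarith
  calc _ ≤ (5 : ℝ) * 1 := by gcongr
    _ = 5 := by norm_num

/-- For `D ≤ 11` and `n` below `exp 44` the constant `c7` alone makes the error bounds larger than
both the main term and `Q d 2 n`. -/
lemma bounds_of_small {d n : ℕ} (hd : 4 ≤ d) (hd8 : d ≤ 8) (hn : 1 ≤ n) {δ : ℝ} (hδ : 0 < δ)
    (hδ' : δ < 2 / 3) (ε ymax : ℝ) (hy : Real.exp (-22) ≤ saddle d n) :
    5 * Real.exp (2 * m d n) ≤ errorBound d δ ε ymax n ∧
      5 * Real.exp (2 * m d n) ≤ errorBound' d δ ε ymax n := by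
  have hd' : (4 : ℝ) ≤ d := by exact_mod_cast hd
  have hd8' : (d : ℝ) ≤ 8 := by exact_mod_cast hd8
  have hn1 : (1 : ℝ) ≤ n := by exact_mod_cast hn
  have hn' : (0 : ℝ) < n := by linarith
  have hpi := Real.pi_pos
  have hpi3 := Real.pi_gt_three
  have hpi4 := Real.pi_lt_four
  have hS := sin_pos_two_pi_div hd
  have hS1 := Real.sin_le_one (2 * Real.pi / ((d : ℝ) + 3))
  have hm0 := m_pos d hn
  have hE : (0 : ℝ) < 3 * ((d : ℝ) + 3) := by positivity
  have hA1 : 1 / 4 ≤ poleCoeff d := by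
    unfold poleCoeff
    rw [div_le_div_iff₀ (by norm_num) (by positivity)]
    nlinarith
  have hm : 1 / 2 ≤ m d n := by
    have := m_sq d hn
    nlinarith
  have h10 : 3 ≤ c10 d δ := by
    have h := c10_lower hd hδ
    have h2 : 1 / 2 ≤ Real.sqrt (poleCoeff d) := by
      apply Real.le_sqrt_of_sq_le; linarith
    nlinarith
  have h7 : Real.exp 55 ≤ c7 d δ := by
    refine le_trans ?_ (c7_lower d δ)
    have h6 := exp_le_c6 hd hd8 hδ
    have : (1 : ℝ) ≤ c10 d δ ^ 3 := one_le_pow₀ (by linarith)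
    have h0 := Real.exp_pos 55
    nlinarith
  have hnle : (n : ℝ) ≤ Real.exp 44 := by
    have h1 := saddle_sq d hn
    have h2 : Real.exp (-22) ^ 2 ≤ saddle d n ^ 2 := pow_le_pow_left₀ (Real.exp_pos _).le hy 2
    rw [h1, le_div_iff₀ hn', ← Real.exp_nat_mul] at h2
    have h3 := h2.trans (poleCoeff_le_one hd)
    have e : Real.exp (((2 : ℕ) : ℝ) * -22) * Real.exp 44 = 1 := by
      rw [← Real.exp_add]; norm_num
    have h4 := Real.exp_pos (44 : ℝ)
    calc (n : ℝ) = (Real.exp (((2 : ℕ) : ℝ) * -22) * n) * Real.exp 44 := by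
          rw [mul_right_comm, e, one_mul]
      _ ≤ 1 * Real.exp 44 := by gcongr
      _ = _ := one_mul _
  have hc7n : 20000 * (n : ℝ) ≤ c7 d δ := by
    have e : Real.exp 55 = Real.exp 11 * Real.exp 44 := by rw [← Real.exp_add]; norm_num
    have h11 : (20000 : ℝ) ≤ Real.exp 11 := by
      have e2 : Real.exp 11 = Real.exp 1 ^ 11 := by rw [← Real.exp_nat_mul]; norm_num
      rw [e2]
      have := pow_le_pow_left₀ (by norm_num) Real.exp_one_gt_d9.le 11
      norm_num at this ⊢
      linarith
    refine le_trans ?_ h7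
    rw [e]
    gcongr
  have hc7 : 0 < c7 d δ := c7_pos d δ
  set S := Real.sin (2 * Real.pi / ((d : ℝ) + 3)) with hSdef
  constructor
  · refine le_trans ?_ (errorBound_ge hd hn δ ε ymax)
    have hmδ : 1 / 2 ≤ m d n ^ δ := by
      rcases le_total 1 (m d n) with h | h
      · linarith [Real.one_le_rpow h hδ.le]
      · have := Real.rpow_le_rpow_of_exponent_ge hm0 h (show δ ≤ 1 by linarith)
        rw [Real.rpow_one] at this
        linarith
    have e2 : m d n * Real.exp (2 * m d n) / (4 * Real.pi * n * S) *
        (2 * c10 d δ * c7 d δ * m d n ^ (δ - 1)) =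
        (c10 d δ * c7 d δ * m d n ^ δ / (2 * Real.pi * n * S)) * Real.exp (2 * m d n) := by
      rw [Real.rpow_sub hm0, Real.rpow_one]
      field_simp
      norm_num
    rw [e2]
    gcongr
    rw [le_div_iff₀ (by positivity)]
    calc 5 * (2 * Real.pi * n * S) ≤ 5 * (2 * 4 * n * 1) := by gcongr
      _ ≤ 3 * (20000 * (n : ℝ)) * (1 / 2) := by linarith
      _ ≤ _ := by gcongr
  · unfold errorBound'
    rw [← hSdef, two_m_eq]
    have h1 : 5 ≤ (n : ℝ) ^ (-1 + δ / 2) * (c7 d δ * Real.pi ^ (1 + δ / 2) /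
        ((3 * ((d : ℝ) + 3)) ^ 2 * S)) := by
      have a1 : (n : ℝ)⁻¹ ≤ (n : ℝ) ^ (-1 + δ / 2) := by
        rw [← Real.rpow_neg_one]
        exact Real.rpow_le_rpow_of_exponent_le hn1 (by linarith)
      have a2 : 1 ≤ Real.pi ^ (1 + δ / 2) := Real.one_le_rpow (by linarith) (by linarith)
      have a3 : (3 * ((d : ℝ) + 3)) ^ 2 * S ≤ 1089 * 1 := by
        gcongr
        nlinarith
      calc (5 : ℝ) ≤ (n : ℝ)⁻¹ * ((20000 * n) * 1 / (1089 * 1)) := by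
            field_simp; norm_num
        _ ≤ _ := by gcongr
    have h2 := mul_le_mul_of_nonneg_right h1 (Real.exp_pos (2 * m d n)).le
    have h3 : 0 ≤ (n : ℝ) ^ (-(1 / 4) : ℝ) * (Real.pi ^ (1 / 2 : ℝ) *
        (3 * ((d : ℝ) + 3)) ^ (-(3 / 4) : ℝ) / (2 * S)) *
        Real.exp (2 * m d n - (n : ℝ) ^ (-(δ / 8)) * 2 * Real.pi ^ (2 - δ / 4) *
          (3 * ((d : ℝ) + 3)) ^ (-2 + 3 * δ / 8)) := by positivity
    have h5 := Real.exp_pos (2 * m d n -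
      c3 d δ ε ymax * (n : ℝ) ^ (ε / 2) *
        (Real.pi ^ 2 / (3 * ((d : ℝ) + 3))) ^ (-(3 * ε / 2)))
    linarith

/-! ### Comparison for small saddle points -/

/-- At a saddle point below both `exp (-22)` and `exp (-2 D)` the relative error of the main term
is at most `500 / m`, and `m` is large in terms of `D`. -/
lemma abs_Q_sub_mainTerm_le {d n : ℕ} (hd : 4 ≤ d) (hd_even : Even d) (hn : 1 ≤ n)
    (h22 : saddle d n ≤ Real.exp (-22)) (h2D : saddle d n ≤ Real.exp (-(2 * ((d : ℝ) + 3)))) :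
    500 ≤ m d n ∧ ((d : ℝ) + 3) ^ 4 / 1000 ≤ m d n ∧
      |(Q d 2 n : ℝ) - mainTerm d n| ≤ 500 / m d n * mainTerm d n := by
  have hd' : (4 : ℝ) ≤ d := by exact_mod_cast hd
  have hpi := Real.pi_pos
  have hpi3 := Real.pi_gt_three
  have hy0 := saddle_pos d hn
  have hmy := m_eq_div d hn
  have hm0 := m_pos d hn
  have hS := sin_pos_two_pi_div hd
  obtain ⟨t, ht⟩ : ∃ t, saddle d n = Real.exp (-t) :=
    ⟨-Real.log (saddle d n), by rw [neg_neg, Real.exp_log hy0]⟩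
  have ht22 : 22 ≤ t := by
    rw [ht, Real.exp_le_exp] at h22; linarith
  have htD : 2 * ((d : ℝ) + 3) ≤ t := by
    rw [ht, Real.exp_le_exp] at h2D; linarith
  set D : ℝ := (d : ℝ) + 3 with hD
  have hD7 : 7 ≤ D := by linarith
  have hinv : (saddle d n)⁻¹ = Real.exp t := by rw [ht, Real.exp_neg, inv_inv]
  have hprod : Real.exp t * saddle d n = 1 := by rw [← hinv]; exact inv_mul_cancel₀ hy0.ne'
  -- the exponential dominates every power of `t` that occurs
  have h8 : t ^ 8 / 40320 ≤ Real.exp t := by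
    have := Real.pow_div_factorial_le_exp t (by linarith) 8
    norm_num [Nat.factorial] at this
    exact this
  have ht3 : (10000 : ℝ) ≤ t ^ 3 := by
    calc (10000 : ℝ) ≤ 22 ^ 3 := by norm_num
      _ ≤ t ^ 3 := by gcongr
  have ht5 : 48 * t ^ 5 ≤ 256 * Real.exp t := by
    have e : t ^ 8 = t ^ 3 * t ^ 5 := by ring
    have : 10000 * t ^ 5 ≤ t ^ 8 := by rw [e]; gcongr
    have h5 : 0 < t ^ 5 := by positivity
    linarith
  have hDt : D ≤ t / 2 := by linarith
  have hD4 : D ^ 4 * 16 ≤ t ^ 4 := by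
    have := pow_le_pow_left₀ (by linarith : 0 ≤ D) hDt 4
    rw [div_pow] at this
    linarith
  have hexp : 3 * t ≤ Real.exp t / D ^ 4 := by
    rw [le_div_iff₀ (by positivity)]
    have h1 : 3 * t * (D ^ 4 * 16) ≤ 3 * t * t ^ 4 := by gcongr
    have e : 3 * t * t ^ 4 = 3 * t ^ 5 := by ring
    linarith
  have hmexp : m d n = poleCoeff d * Real.exp t := by rw [hmy, div_eq_mul_inv, hinv]
  have hA : 3 / D ≤ poleCoeff d := by
    unfold poleCoeff
    rw [← hD, div_le_div_iff₀ (by positivity) (by positivity)]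
    have h9 : 9 ≤ Real.pi ^ 2 := by nlinarith
    nlinarith
  have hA0 := poleCoeff_pos d
  have hmlow : D ^ 3 * (9 * t) ≤ m d n := by
    rw [hmexp]
    rw [le_div_iff₀ (by positivity)] at hexp
    calc D ^ 3 * (9 * t) = 3 / D * (3 * t * D ^ 4) := by field_simp; norm_num
      _ ≤ poleCoeff d * Real.exp t := by gcongr
  have hD3 : (343 : ℝ) ≤ D ^ 3 := by
    calc (343 : ℝ) = 7 ^ 3 := by norm_num
      _ ≤ D ^ 3 := by gcongr
  have hm500 : 500 ≤ m d n := by nlinarith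
  have hmD4 : D ^ 4 ≤ m d n := by
    refine le_trans ?_ hmlow
    have e : D ^ 4 = D ^ 3 * D := by ring
    rw [e]
    gcongr
    linarith
  have hmD : D ≤ m d n := by
    refine le_trans ?_ hmD4
    exact le_self_pow₀ (by linarith) (by norm_num)
  have hy4 : D ^ 4 * saddle d n ≤ 1 := by
    have h1 : D ^ 4 ≤ Real.exp t := by
      rw [le_div_iff₀ (by positivity)] at hexp
      have h4 : 0 < D ^ 4 := by positivity
      nlinarith
    calc D ^ 4 * saddle d n ≤ Real.exp t * saddle d n := by gcongr
      _ = 1 := hprod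
  have hDy : D * saddle d n ≤ 1 / 100 := by
    have h1 : D * 343 ≤ D ^ 4 := by
      have e : D ^ 4 = D * D ^ 3 := by ring
      rw [e]; gcongr
    nlinarith
  have hD2y : D ^ 2 * saddle d n ≤ 1 := by
    refine le_trans ?_ hy4
    gcongr
    · linarith
    · norm_num
  have hmin : Real.exp (-(1 / (D ^ 4 * saddle d n))) ≤ saddle d n ^ 3 := by
    have e1 : 1 / (D ^ 4 * saddle d n) = Real.exp t / D ^ 4 := by
      rw [← hinv]; field_simp
    have e2 : saddle d n ^ 3 = Real.exp (-(3 * t)) := by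
      rw [ht, ← Real.exp_nat_mul]; norm_num
    rw [e1, e2, Real.exp_le_exp]
    linarith
  refine ⟨hm500, ?_, ?_⟩
  · have : 0 < D ^ 4 := by positivity
    linarith
  have key := abs_Q_sub_le (n := n) hd hd_even hy0 hmy rfl (by linarith) hmD hDy hD2y hmin
  rw [← mainTerm_eq hd hn, ← hD] at key
  set S := Real.sin (2 * Real.pi / D)
  have hc : 0 < 2 * Real.pi * (2 * S) := by positivity
  have e3 : 2 * Real.pi * (Q d 2 n : ℝ) * (2 * S) - 2 * Real.pi * mainTerm d n * (2 * S) =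
      (2 * Real.pi * (2 * S)) * ((Q d 2 n : ℝ) - mainTerm d n) := by ring
  have e4 : 500 / m d n * (2 * Real.pi * mainTerm d n * (2 * S)) =
      (2 * Real.pi * (2 * S)) * (500 / m d n * mainTerm d n) := by ring
  rw [e3, e4, abs_mul, abs_of_pos hc] at key
  exact le_of_mul_le_mul_left key hc

/-- Both error bounds hold at a saddle point below `exp (-22)` and `exp (-2 D)`. -/
lemma bounds_of_saddle_le {d n : ℕ} (hd : 4 ≤ d) (hd_even : Even d) (hn : 1 ≤ n) {δ : ℝ}
    (hδ : 0 < δ) (hδ' : δ < 2 / 3) (ε ymax : ℝ)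
    (h22 : saddle d n ≤ Real.exp (-22)) (h2D : saddle d n ≤ Real.exp (-(2 * ((d : ℝ) + 3)))) :
    |(Q d 2 n : ℝ) - mainTerm d n| ≤ errorBound d δ ε ymax n ∧
      |(Q d 2 n : ℝ) - mainTerm d n| ≤ errorBound' d δ ε ymax n := by
  obtain ⟨h1, h2, h3⟩ := abs_Q_sub_mainTerm_le hd hd_even hn h22 h2D
  refine ⟨h3.trans (mainTerm_mul_le_errorBound hd hn hδ ε ymax (by linarith) h2),
    h3.trans (le_trans ?_ (mainTerm_le_errorBound' hd hn hδ hδ' ε ymax (by linarith)))⟩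
  exact mul_le_of_le_one_left (mainTerm_pos hd hn).le ((div_le_one (by linarith)).mpr h1)

end AlderQ

theorem theorem1p2 (d : ℕ) (hd : 4 ≤ d) (hd_even : Even d) :
    ∃ R : ℕ → ℝ,
      (∀ n : ℕ, 1 ≤ n → (AlderQ.Q d 2 n : ℝ) = AlderQ.mainTerm d n + R n) ∧
      ∀ δ ε : ℝ, 0 < δ → δ < 2 / 3 → 0 < ε → ε < δ / 2 →
        (∀ᶠ ymax in 𝓝[>] (0 : ℝ), 0 < AlderQ.c4 d δ ymax ∧ 0 < AlderQ.c5 d ymax) ∧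
        ∀ ymax : ℝ, 0 < ymax → 0 < AlderQ.c4 d δ ymax → 0 < AlderQ.c5 d ymax →
          ∀ n : ℕ, 1 ≤ n → AlderQ.saddle d n ≤ ymax →
            |R n| ≤ AlderQ.errorBound d δ ε ymax n ∧
            |R n| ≤ AlderQ.errorBound' d δ ε ymax n := by
  refine ⟨fun n => AlderQ.Q d 2 n - AlderQ.mainTerm d n, fun n _ => by ring,
    fun δ ε hδ hδ' _ _ => ⟨AlderQ.eventually_c4_c5_pos hd hδ, ?_⟩⟩
  intro ymax hymax _ h5 n hn hsad
  rcases le_or_gt 10 d with h10 | h10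
  · have hd' : (10 : ℝ) ≤ d := by exact_mod_cast h10
    have h := hsad.trans (AlderQ.le_exp_of_c5_pos h10 hymax h5)
    exact AlderQ.bounds_of_saddle_le hd hd_even hn hδ hδ' ε ymax
      (h.trans (Real.exp_le_exp.mpr (by linarith))) (h.trans (Real.exp_le_exp.mpr (by linarith)))
  · have hd8 : d ≤ 8 := by
      obtain ⟨k, rfl⟩ := hd_even
      omega
    have hd8' : (d : ℝ) ≤ 8 := by exact_mod_cast hd8
    rcases le_total (AlderQ.saddle d n) (Real.exp (-22)) with h | h
    · exact AlderQ.bounds_of_saddle_le hd hd_even hn hδ hδ' ε ymax h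
        (h.trans (Real.exp_le_exp.mpr (by linarith)))
    · obtain ⟨b1, b2⟩ := AlderQ.bounds_of_small hd hd8 hn hδ hδ' ε ymax h
      have hR : |(AlderQ.Q d 2 n : ℝ) - AlderQ.mainTerm d n| ≤ 5 * Real.exp (2 * AlderQ.m d n) :=
        abs_sub_le_of_nonneg_of_le (Nat.cast_nonneg _) (AlderQ.Q_le_of_small hd hd8 hn)
          (AlderQ.mainTerm_pos hd hn).le (AlderQ.mainTerm_le_of_small hd hd8 hn)
      exact ⟨hR.trans b1, hR.trans b2⟩
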